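/- Let $\gamma,\lambda,\mu>0$. Let $Q=H^1(\mathbb R^+)\oplus H^1(\mathbb R^-)$ be the space of functions $\psi:\mathbb R\to\mathbb C$ whose restrictions to the two open half-lines are of class $H^1$. Write $\psi'$ for the derivative of $\psi$ away from the origin, $\psi(0\pm)$ for the one-sided boundary values at $0$, $\|\cdot\|_p$ for the $L^p(\mathbb R)$ norm and $\|\cdot\|=\|\cdot\|_2$. For $\omega\in\mathbb R$ and $\psi\in Q$ put $$S_\omega(\psi)=\tfrac12\|\psi'\|^2+\tfrac{\omega}{2}\|\psi\|^2-\tfrac1{2\gamma}|\psi(0+)-\psi(0-)|^2-\tfrac{\lambda}{2\mu+2}\|\psi\|_{2\mu+2}^{2\mu+2},$$ $$I_\omega(\psi)=\|\psi'\|^2+\omega\|\psi\|^2-\tfrac1{\gamma}|\psi(0+)-\psi(0-)|^2-\lambda\|\psi\|_{2\mu+2}^{2\mu+2},$$ $$d(\omega)=\inf\{S_\omega(\psi):\ \psi\in Q\setminus\{0\},\ I_\omega(\psi)=0\},\qquad \omega_0=\frac4{\gamma^2},\qquad \omega^*=\frac4{\gamma^2}\,\frac{\mu+1}{\mu}.$$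 **Proposition 6.5.** There is a number $\mu^\star\in(2,\,2.5)$, independent of $\gamma,\lambda$, such that for all $\gamma,\lambda,\mu>0$ the following holds. The function $d$ is differentiable on $(\omega_0,+\infty)$ and twice differentiable on $(\omega_0,\omega^*)\cup(\omega^*,+\infty)$. The limits $d''(\omega^*\pm0)=\lim_{\omega\to\omega^*\pm0}d''(\omega)$ exist in $\mathbb R$ and are equal to the right and left derivatives, respectively, of $d'$ at $\omega^*$. Moreover: 1. If $0<\mu\le2$, then $d''(\omega)>0$ for every $\omega\in(\omega_0,\omega^*)\cup(\omega^*,+\infty)$, and $0<d''(\omega^*+0)<d''(\omega^*-0)$. 2. If $\mu>2$, then $d''(\omega)>0$ for every $\omega\in(\omega_0,\omega^*)$, and $d''(\omega^*-0)>0$. 3. (a) If $\mu<\mu^\star$, then $d''(\omega^*+0)>0$, and there is $\omega_1>\omega^*$ such that $d''(\omega)>0$ for every $\omega\in(\omega^*,\omega_1)$. (b) If $\mu=\mu^\star$, then $d''(\omega^*+0)=0$. (c) If $\mu>\mu^\star$, then $d''(\omega^*+0)<0$. 4. If $\mu>2$, then there is $\omega_2\ge\omega^*$ such that $d''(\omega)<0$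 for every $\omega>\omega_2$. -/

import Mathlib

open MeasureTheory Set Filter Topology

namespace DeltaPrimeNLS

/-- `g` is the weak (distributional) derivative of `u` on the open set `U ⊆ ℝ`. It is only used for
`u` and `g` that are square integrable on `U`, so that all the integrals converge. -/
def IsWeakDerivOn (U : Set ℝ) (u g : ℝ → ℂ) : Prop :=
  ∀ φ : ℝ → ℝ, ContDiff ℝ (⊤ : ℕ∞) φ → HasCompactSupport φ → tsupport φ ⊆ U →
    ∫ x in U, deriv φ x • u x = -∫ x in U, φ x • g x

/-- `u` belongs to the Sobolev space `H¹(U)`, with weak derivative `g`. -/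
structure IsH1On (U : Set ℝ) (u g : ℝ → ℂ) : Prop where
  memLp : MemLp u 2 (volume.restrict U)
  memLp_deriv : MemLp g 2 (volume.restrict U)
  isWeakDeriv : IsWeakDerivOn U u g

/-- `a` is the value `u(0+)`: the value at `0` of the representative of `u` on `(0, ∞)` that is
continuous up to the boundary. -/
def IsRightTrace (u : ℝ → ℂ) (a : ℂ) : Prop :=
  ∃ v : ℝ → ℂ, ContinuousOn v (Ici 0) ∧ v =ᵐ[volume.restrict (Ioi 0)] u ∧ v 0 = a

/-- `a` is the value `u(0-)`: the value at `0` of the representative of `u` on `(-∞, 0)` that is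
continuous up to the boundary. -/
def IsLeftTrace (u : ℝ → ℂ) (a : ℂ) : Prop :=
  ∃ v : ℝ → ℂ, ContinuousOn v (Iic 0) ∧ v =ᵐ[volume.restrict (Iio 0)] u ∧ v 0 = a

/-- The energy space `Q = H¹(ℝ⁺) ⊕ H¹(ℝ⁻)`. An element is given by a representative `ψ : ℝ → ℂ`,
recorded together with its weak derivative `ψ'` away from the origin and its two boundary values
`ψ(0+)`, `ψ(0-)`; the function determines the boundary values, and the derivative up to null
sets. -/
structure EnergySpace where
  toFun : ℝ → ℂ
  weakDeriv : ℝ → ℂ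
  valRight : ℂ
  valLeft : ℂ
  isH1_right : IsH1On (Ioi 0) toFun weakDeriv
  isH1_left : IsH1On (Iio 0) toFun weakDeriv
  isRightTrace : IsRightTrace toFun valRight
  isLeftTrace : IsLeftTrace toFun valLeft

/-- The action `S_ω(ψ) = ½‖ψ'‖² + (ω/2)‖ψ‖² - (1/(2γ))|ψ(0+) - ψ(0-)|²
  - (λ/(2μ+2))‖ψ‖_{2μ+2}^{2μ+2}`; the coupling constant `λ` is called `lam`. -/
noncomputable def action (γ lam μ ω : ℝ) (ψ : EnergySpace) : ℝ :=
  1 / 2 * (∫ x, ‖ψ.weakDeriv x‖ ^ 2) + ω / 2 * (∫ x, ‖ψ.toFun x‖ ^ 2)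
    - 1 / (2 * γ) * ‖ψ.valRight - ψ.valLeft‖ ^ 2
    - lam / (2 * μ + 2) * ∫ x, ‖ψ.toFun x‖ ^ (2 * μ + 2)

/-- The Nehari functional `I_ω(ψ) = ‖ψ'‖² + ω‖ψ‖² - (1/γ)|ψ(0+) - ψ(0-)|²
  - λ‖ψ‖_{2μ+2}^{2μ+2}`. -/
noncomputable def nehari (γ lam μ ω : ℝ) (ψ : EnergySpace) : ℝ :=
  (∫ x, ‖ψ.weakDeriv x‖ ^ 2) + ω * (∫ x, ‖ψ.toFun x‖ ^ 2)
    - 1 / γ * ‖ψ.valRight - ψ.valLeft‖ ^ 2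
    - lam * ∫ x, ‖ψ.toFun x‖ ^ (2 * μ + 2)

/-- `d(ω) = inf {S_ω(ψ) : ψ ∈ Q \ {0}, I_ω(ψ) = 0}`. -/
noncomputable def groundAction (γ lam μ ω : ℝ) : ℝ :=
  sInf {s : ℝ | ∃ ψ : EnergySpace, ¬ ψ.toFun =ᵐ[volume] 0 ∧
    nehari γ lam μ ω ψ = 0 ∧ s = action γ lam μ ω ψ}

/-- The frequency `ω₀ = 4/γ²` of the linear ground state. -/
noncomputable def freqLinear (γ : ℝ) : ℝ := 4 / γ ^ 2

/-- The bifurcation frequency `ω* = (4/γ²)(μ+1)/μ`. -/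
noncomputable def freqBif (γ μ : ℝ) : ℝ := 4 / γ ^ 2 * ((μ + 1) / μ)

/-- `L = f''(a + 0)`: the right limit of `f''` at `a` exists and equals `L`, and so does the right
derivative of `f'` at `a`. -/
def IsRightSecondDeriv (f : ℝ → ℝ) (a L : ℝ) : Prop :=
  Tendsto (deriv (deriv f)) (𝓝[>] a) (𝓝 L) ∧ HasDerivWithinAt (deriv f) L (Ioi a) a

/-- `L = f''(a - 0)`: the left limit of `f''` at `a` exists and equals `L`, and so does the left
derivative of `f'` at `a`. -/
def IsLeftSecondDeriv (f : ℝ → ℝ) (a L : ℝ) : Prop :=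
  Tendsto (deriv (deriv f)) (𝓝[<] a) (𝓝 L) ∧ HasDerivWithinAt (deriv f) L (Iio a) a

end DeltaPrimeNLS

namespace DeltaPrimeNLS

/-! ### Functions of class `H¹` on a half-line -/

/-! The variational problem collapses to a minimax for a function of two real variables; what
remains is calculus along an explicit curve.

Put k = γ√ω, f(s) = s√(1 - s^{2μ}) (`field`), G its primitive (`fieldInt`), and r_k(x, y) = G(x) +
G(y) - (x+y)²/(2k) (`reduced`). After division by the soliton amplitude m, decaying stationary
profiles on a half-line solve w' = -√ω f(w). Gluing two of them with boundary values x and -y gives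
a state of action √ω m² r_k(x, y), which lies on the Nehari manifold when (x, y) is a critical point
of r_k. Conversely, let ψ be on the Nehari manifold, and let A, B be the suprema of |ψ| on the two
half-lines. The action is maximal at ψ along its own ray, and the Modica–Mortola inequality |w'|² +
ω f(w)² ≥ 2√ω f(w)|w'| bounds the half-line energies, so S_ω(ψ) ≥ √ω m² r_k(tA, tB) whenever tA, tB
≤ 1 (`exists_reduced_le_action`). Hence a critical point whose value is at most the supremum of r_k
on every ray computes d (`groundAction_eq`).

That property is checked on a curve meeting all rays (`isRayMinimax_of_curve`). The asymmetric
solutions of f(x) = f(y), with x/y = e^z, are explicit quotients of hyperbolic sines. Along them the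
critical k increases from the bifurcation value 2√((μ+1)/μ) to infinity, and for fixed k above that
value r_k is smallest at the critical point (`isRayMinimax_branch`). Up to the bifurcation, a shrunk
copy of the curve issuing from the symmetric critical point does the same job
(`isRayMinimax_symVal`). The inequalities between the rates come from the convexity of x coth x.

Thus d = C ω^{1/2+1/μ} D(k) with D the minimax value. The envelope theorem gives D' = P/(2k²), P
being the squared jump x + y of the ground state. P is continuous at the bifurcation, so d is C¹
there, but its logarithmic derivative R = d log P / d log k jumps. Up to a positive factor d''
equals (1/μ² - 1/4) D + P/(2k) · (1/μ - 1/4 + R/4) (`curvature`). On the symmetric branch R ≥ 2,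
which gives positivity for all μ (`symmetric_curvature_pos`). On the asymmetric branch R < 0; for μ
≤ 2 the last bracket is still positive (`jumpRate_lt`), and for μ > 2 the negative first term wins
as k grows, because D increases while P/k tends to 0 (`curvature_neg_of_large`). From the right R
tends to -2(2μ+1)/(4μ+5), so the sign of d''(ω*+0) is that of a function of μ alone (`signFun`):
positive up to 2, negative from 5/2 on, strictly decreasing in between (`exists_threshold`). -/

lemma deriv_smoothTransition_eq_zero {t : ℝ} (ht : t ∉ Icc (0 : ℝ) 1) :
    deriv Real.smoothTransition t = 0 := by
  have hc : ∀ c : ℝ, Real.smoothTransition =ᶠ[𝓝 t] (fun _ => c) →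
      deriv Real.smoothTransition t = 0 := fun c h => by rw [h.deriv_eq]; simp
  by_cases h : t < 0
  · refine hc 0 ?_
    filter_upwards [Iio_mem_nhds h] with s hs
    exact Real.smoothTransition.zero_of_nonpos (le_of_lt hs)
  · have h1 : 1 < t := by
      by_contra h2
      exact ht ⟨not_lt.1 h, not_lt.1 h2⟩
    refine hc 1 ?_
    filter_upwards [Ioi_mem_nhds h1] with s hs
    exact Real.smoothTransition.one_of_one_le (le_of_lt hs)

lemma hasDerivAt_smoothStep (x ε s : ℝ) :
    HasDerivAt (fun s => Real.smoothTransition ((s - x) / ε))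
      (deriv Real.smoothTransition ((s - x) / ε) / ε) s := by
  have h1 : HasDerivAt Real.smoothTransition (deriv Real.smoothTransition ((s - x) / ε))
      ((s - x) / ε) :=
    ((Real.smoothTransition.contDiff (n := 1)).differentiable (by norm_num) _).hasDerivAt
  have h2 : HasDerivAt (fun s : ℝ => (s - x) / ε) (1 / ε) s :=
    ((hasDerivAt_id s).sub_const x).div_const ε
  have := h1.comp s h2
  rwa [mul_one_div] at this

lemma continuous_deriv_smoothTransition : Continuous (deriv Real.smoothTransition) :=
  (Real.smoothTransition.contDiff (n := 1)).continuous_deriv (by norm_num)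

lemma integral_deriv_smoothTransition :
    ∫ τ in (0 : ℝ)..1, deriv Real.smoothTransition τ = 1 := by
  rw [intervalIntegral.integral_deriv_eq_sub]
  · simp [Real.smoothTransition.one, Real.smoothTransition.zero]
  · intro x _
    exact (Real.smoothTransition.contDiff (n := 1)).differentiable (by norm_num) _
  · exact continuous_deriv_smoothTransition.intervalIntegrable _ _

lemma integrable_smoothStep_deriv {w : ℝ → ℂ} (hw : Continuous w) {x ε : ℝ} (hε : 0 < ε) :
    Integrable (fun s => (deriv Real.smoothTransition ((s - x) / ε) / ε) • w s) := by
  refine Continuous.integrable_of_hasCompactSupport ?_ ?_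
  · exact ((continuous_deriv_smoothTransition.comp (by fun_prop)).div_const ε).smul hw
  · refine HasCompactSupport.intro (isCompact_Icc (a := x) (b := x + ε)) fun s hs => ?_
    rw [deriv_smoothTransition_eq_zero, zero_div, zero_smul]
    intro h
    refine hs ⟨?_, ?_⟩
    · have := (le_div_iff₀ hε).1 h.1
      linarith
    · have := (div_le_one hε).1 h.2
      linarith

/-- The derivative of the rescaled step is an approximate identity carried by [x, x + ε]: the
substitution s = x + ετ turns the integral into an average of w(x + ετ) against a fixed density of
mass one. -/
lemma tendsto_integral_smoothStep {w : ℝ → ℂ} (hw : Continuous w) {x : ℝ} (hx : 0 < x) :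
    Tendsto (fun ε : ℝ => ∫ s in Ioi 0, (deriv Real.smoothTransition ((s - x) / ε) / ε) • w s)
      (𝓝[>] 0) (𝓝 (w x)) := by
  set Ψ : ℝ → ℂ := fun ε => ∫ τ in (0 : ℝ)..1, deriv Real.smoothTransition τ • w (x + ε * τ)
  have hΨ : Continuous Ψ := by
    apply intervalIntegral.continuous_parametric_intervalIntegral_of_continuous'
    exact (continuous_deriv_smoothTransition.comp continuous_snd).smul (hw.comp (by fun_prop))
  have hΨ0 : Ψ 0 = w x := by
    simp only [Ψ, zero_mul, add_zero]
    rw [intervalIntegral.integral_smul_const, integral_deriv_smoothTransition, one_smul]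
  have hlim : Tendsto Ψ (𝓝[>] 0) (𝓝 (w x)) := by
    rw [← hΨ0]; exact hΨ.continuousAt.tendsto.mono_left nhdsWithin_le_nhds
  refine hlim.congr' ?_
  filter_upwards [self_mem_nhdsWithin] with ε hε
  have hε : 0 < ε := hε
  have key := intervalIntegral.smul_integral_comp_add_mul (a := 0) (b := 1)
    (fun s => (deriv Real.smoothTransition ((s - x) / ε) / ε) • w s) ε x
  have e1 : ∫ s in Ioi 0, (deriv Real.smoothTransition ((s - x) / ε) / ε) • w s =
      ∫ s in Icc x (x + ε), (deriv Real.smoothTransition ((s - x) / ε) / ε) • w s := by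
    refine setIntegral_eq_of_subset_of_forall_sdiff_eq_zero measurableSet_Ioi ?_ ?_
    · intro s hs; exact lt_of_lt_of_le hx hs.1
    · intro s hs
      rw [deriv_smoothTransition_eq_zero, zero_div, zero_smul]
      intro h
      refine hs.2 ⟨?_, ?_⟩
      · have := (le_div_iff₀ hε).1 h.1
        linarith
      · have := (div_le_one hε).1 h.2
        linarith
  rw [e1, integral_Icc_eq_integral_Ioc, ← intervalIntegral.integral_of_le (by linarith)]
  rw [mul_zero, add_zero, mul_one] at key
  rw [← key, ← intervalIntegral.integral_smul]
  refine intervalIntegral.integral_congr fun τ _ => ?_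
  simp only [add_sub_cancel_left, smul_smul]
  rw [mul_div_cancel_left₀ _ hε.ne', mul_div_cancel₀ _ hε.ne']

lemma MemLp.intervalIntegrable_of_Ioi {g : ℝ → ℂ} (hg : MemLp g 2 (volume.restrict (Ioi 0)))
    {x y : ℝ} (hx : 0 ≤ x) (hy : 0 ≤ y) : IntervalIntegrable g volume x y := by
  rw [intervalIntegrable_iff]
  have hsub : uIoc x y ⊆ Ioi 0 := fun s hs => lt_of_le_of_lt (le_min hx hy) hs.1
  have : MemLp g 2 (volume.restrict (uIoc x y)) :=
    hg.mono_measure (Measure.restrict_mono hsub le_rfl)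
  have hfin : IsFiniteMeasure (volume.restrict (uIoc x y)) :=
    ⟨by rw [Measure.restrict_apply_univ]; exact measure_Ioc_lt_top⟩
  exact this.integrable (by norm_num)

/-- Test the weak derivative against a smoothed indicator of (x, y]. As ε → 0 the derivative of the
test function evaluates v at x and at y, while the test function itself tends to the indicator. -/
lemma IsWeakDerivOn.sub_eq_integral {u g v : ℝ → ℂ}
    (hg : MemLp g 2 (volume.restrict (Ioi 0))) (hw : IsWeakDerivOn (Ioi 0) u g)
    (hv : Continuous v) (hvu : v =ᵐ[volume.restrict (Ioi 0)] u) {x y : ℝ} (hx : 0 < x)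
    (hxy : x < y) : v y - v x = ∫ s in x..y, g s := by
  set φ : ℝ → ℝ → ℝ := fun ε s =>
    Real.smoothTransition ((s - x) / ε) - Real.smoothTransition ((s - y) / ε)
  have hφ0 : ∀ ε > 0, ∀ s ∉ Icc x (y + ε), φ ε s = 0 := by
    intro ε hε s hs
    by_cases h : s < x
    · simp only [φ]
      rw [Real.smoothTransition.zero_of_nonpos, Real.smoothTransition.zero_of_nonpos, sub_zero]
      · exact div_nonpos_of_nonpos_of_nonneg (by linarith) hε.le
      · exact div_nonpos_of_nonpos_of_nonneg (by linarith) hε.le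
    · have h' : y + ε < s := by
        by_contra h2; exact hs ⟨not_lt.1 h, not_lt.1 h2⟩
      simp only [φ]
      rw [Real.smoothTransition.one_of_one_le, Real.smoothTransition.one_of_one_le, sub_self]
      · rw [one_le_div hε]; linarith
      · rw [one_le_div hε]; linarith
  have hid : ∀ ε > 0, (∫ s in Ioi 0, (deriv Real.smoothTransition ((s - x) / ε) / ε) • v s) -
      (∫ s in Ioi 0, (deriv Real.smoothTransition ((s - y) / ε) / ε) • v s) =
      -∫ s in Ioi 0, φ ε s • g s := by
    intro ε hε
    rw [← hw (φ ε)]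
    · rw [← integral_sub (integrable_smoothStep_deriv hv hε).integrableOn
        (integrable_smoothStep_deriv hv hε).integrableOn]
      refine integral_congr_ae ?_
      filter_upwards [hvu] with s hs
      have hd : HasDerivAt (φ ε) _ s :=
        (hasDerivAt_smoothStep x ε s).sub (hasDerivAt_smoothStep y ε s)
      rw [← hs, ← sub_smul, hd.deriv]
    · exact (Real.smoothTransition.contDiff.comp (by fun_prop)).sub
        (Real.smoothTransition.contDiff.comp (by fun_prop))
    · exact HasCompactSupport.intro isCompact_Icc (hφ0 ε hε)
    · refine (closure_minimal (fun s hs => ?_) isClosed_Icc).trans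
        (fun s (hs : s ∈ Icc x (y + ε)) => lt_of_lt_of_le hx hs.1)
      by_contra h
      exact hs (hφ0 ε hε s h)
  have hl1 := (tendsto_integral_smoothStep hv hx).sub
    (tendsto_integral_smoothStep hv (hx.trans hxy))
  have hl2 : Tendsto (fun ε : ℝ => ∫ s in Ioi 0, φ ε s • g s) (𝓝[>] 0)
      (𝓝 (∫ s in Ioi 0, (Ioc x y).indicator g s)) := by
    refine tendsto_integral_filter_of_dominated_convergence
      ((Icc x (y + 1)).indicator fun s => ‖g s‖) ?_ ?_ ?_ ?_
    · refine Eventually.of_forall fun ε => ?_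
      have : Continuous (φ ε) := (Real.smoothTransition.continuous.comp (by fun_prop)).sub
        (Real.smoothTransition.continuous.comp (by fun_prop))
      exact this.aestronglyMeasurable.smul hg.1
    · filter_upwards [Ioo_mem_nhdsGT (zero_lt_one' ℝ)] with ε hε
      refine Eventually.of_forall fun s => ?_
      by_cases hs : s ∈ Icc x (y + 1)
      · rw [indicator_of_mem hs, norm_smul]
        refine mul_le_of_le_one_left (norm_nonneg _) ?_
        rw [Real.norm_eq_abs, abs_le]
        have h1 := Real.smoothTransition.nonneg ((s - x) / ε)
        have h2 := Real.smoothTransition.le_one ((s - x) / ε)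
        have h3 := Real.smoothTransition.nonneg ((s - y) / ε)
        have h4 := Real.smoothTransition.le_one ((s - y) / ε)
        constructor <;> simp only [φ] <;> linarith
      · rw [indicator_of_notMem hs, hφ0 ε hε.1 s, zero_smul, norm_zero]
        intro h
        exact hs ⟨h.1, h.2.trans (by linarith [hε.2])⟩
    · rw [integrable_indicator_iff measurableSet_Icc]
      rw [IntegrableOn, Measure.restrict_restrict measurableSet_Icc]
      have hsub : Icc x (y + 1) ∩ Ioi 0 ⊆ Icc x (y + 1) := inter_subset_left
      have : MemLp g 2 (volume.restrict (Icc x (y + 1) ∩ Ioi 0)) :=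
        hg.mono_measure (Measure.restrict_mono inter_subset_right le_rfl)
      have hfin : IsFiniteMeasure (volume.restrict (Icc x (y + 1) ∩ Ioi 0)) :=
        ⟨by
          rw [Measure.restrict_apply_univ]
          exact lt_of_le_of_lt (measure_mono hsub) measure_Icc_lt_top⟩
      exact (this.integrable (by norm_num)).norm
    · refine Eventually.of_forall fun s => ?_
      refine tendsto_const_nhds.congr' ?_
      rcases le_or_gt s x with hsx | hsx
      · filter_upwards [self_mem_nhdsWithin] with ε hε
        have hε : 0 < ε := hε
        rw [indicator_of_notMem (fun h => absurd h.1 (not_lt.2 hsx))]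
        simp only [φ]
        rw [Real.smoothTransition.zero_of_nonpos, Real.smoothTransition.zero_of_nonpos, sub_zero,
          zero_smul]
        · exact div_nonpos_of_nonpos_of_nonneg (by linarith) hε.le
        · exact div_nonpos_of_nonpos_of_nonneg (by linarith) hε.le
      · rcases le_or_gt s y with hsy | hsy
        · filter_upwards [Ioo_mem_nhdsGT (sub_pos.2 hsx)] with ε hε
          rw [indicator_of_mem (show s ∈ Ioc x y from ⟨hsx, hsy⟩)]
          simp only [φ]
          rw [Real.smoothTransition.one_of_one_le, Real.smoothTransition.zero_of_nonpos, sub_zero,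
            one_smul]
          · exact div_nonpos_of_nonpos_of_nonneg (by linarith) hε.1.le
          · rw [one_le_div hε.1]; exact hε.2.le
        · filter_upwards [Ioo_mem_nhdsGT (sub_pos.2 hsy)] with ε hε
          rw [indicator_of_notMem (fun h => absurd h.2 (not_le.2 hsy))]
          simp only [φ]
          rw [Real.smoothTransition.one_of_one_le, Real.smoothTransition.one_of_one_le, sub_self,
            zero_smul]
          · rw [one_le_div hε.1]; exact hε.2.le
          · rw [one_le_div hε.1]; linarith [hε.2]
  have hl3 : Tendsto (fun ε : ℝ => -∫ s in Ioi 0, φ ε s • g s) (𝓝[>] 0) (𝓝 (v x - v y)) := by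
    refine hl1.congr' ?_
    filter_upwards [self_mem_nhdsWithin] with ε hε
    exact hid ε hε
  have := tendsto_nhds_unique hl3 hl2.neg
  rw [integral_indicator measurableSet_Ioc, Measure.restrict_restrict measurableSet_Ioc,
    inter_eq_left.2 (show Ioc x y ⊆ Ioi 0 from fun s hs => lt_trans hx hs.1),
    ← intervalIntegral.integral_of_le hxy.le] at this
  rw [← neg_sub, this, neg_neg]

/-- `v` is the continuous representative on `[0, ∞)` of a function of class `H¹(0, ∞)` with
weak derivative `g`. -/
structure HalfLineH1 (v g : ℝ → ℂ) : Prop where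
  continuous : Continuous v
  memLp : MemLp v 2 (volume.restrict (Ioi 0))
  memLp_deriv : MemLp g 2 (volume.restrict (Ioi 0))
  sub_eq : ∀ x y, 0 ≤ x → x ≤ y → v y - v x = ∫ s in x..y, g s

lemma HalfLineH1.of_isH1On {u g : ℝ → ℂ} {a : ℂ} (h : IsH1On (Ioi 0) u g)
    (ha : IsRightTrace u a) :
    ∃ v, HalfLineH1 v g ∧ v =ᵐ[volume.restrict (Ioi 0)] u ∧ v 0 = a := by
  obtain ⟨v₀, hv₀, hvu, hva⟩ := ha
  -- Freezing the representative at its boundary value on the negative axis makes it continuous on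
  -- all of ℝ and changes nothing on the half-line.
  set v : ℝ → ℂ := fun s => v₀ (max s 0)
  have hvc : Continuous v :=
    hv₀.comp_continuous (by fun_prop) (fun s => le_max_right s 0)
  have hveq : v =ᵐ[volume.restrict (Ioi 0)] u := by
    filter_upwards [hvu, ae_restrict_mem measurableSet_Ioi] with s hs hs0
    simp only [v]
    rw [max_eq_left (le_of_lt hs0), hs]
  refine ⟨v, ⟨hvc, (memLp_congr_ae hveq).2 h.memLp, h.memLp_deriv, ?_⟩, hveq, by simp [v, hva]⟩
  intro x y hx hxy
  have hint : ∀ a b, 0 ≤ a → 0 ≤ b → IntervalIntegrable g volume a b :=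
    fun a b ha hb => MemLp.intervalIntegrable_of_Ioi h.memLp_deriv ha hb
  have hpos : ∀ x y, 0 < x → x ≤ y → v y - v x = ∫ s in x..y, g s := by
    intro x y hx hxy
    rcases hxy.eq_or_lt with rfl | hxy
    · simp
    · exact IsWeakDerivOn.sub_eq_integral h.memLp_deriv h.isWeakDeriv hvc hveq hx hxy
  rcases hx.eq_or_lt with rfl | hx
  · rcases hxy.eq_or_lt with rfl | hy
    · simp
    -- Test functions supported in (0, ∞) only give the formula for positive endpoints; the endpoint
    -- 0 is reached by continuity of both sides.
    have h1 : Tendsto (fun x => v y - v x) (𝓝[>] 0) (𝓝 (v y - v 0)) :=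
      (tendsto_const_nhds.sub hvc.continuousAt.tendsto).mono_left nhdsWithin_le_nhds
    have h2 : ContinuousOn (fun x => ∫ s in y..x, g s) (uIcc y 0) := by
      apply intervalIntegral.continuousOn_primitive_interval'
      · exact hint y 0 hy.le le_rfl
      · exact left_mem_uIcc
    have h3 : Tendsto (fun x => ∫ s in y..x, g s) (𝓝[>] 0) (𝓝 (∫ s in y..0, g s)) := by
      refine (h2 0 right_mem_uIcc).tendsto.mono_left ?_
      rw [uIcc_of_ge hy.le]
      refine nhdsWithin_le_of_mem ?_
      filter_upwards [Ioo_mem_nhdsGT hy] with s hs using ⟨hs.1.le, hs.2.le⟩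
    have h4 := tendsto_nhds_unique_of_eventuallyEq h1 h3.neg (by
      filter_upwards [Ioo_mem_nhdsGT hy] with s hs
      rw [hpos s y hs.1 hs.2.le, intervalIntegral.integral_symm])
    rw [h4, intervalIntegral.integral_symm]; simp
  · exact hpos x y hx hxy

lemma IsH1On.reflect {u g : ℝ → ℂ} (h : IsH1On (Iio 0) u g) :
    IsH1On (Ioi 0) (fun x => u (-x)) (fun x => -g (-x)) := by
  have hmp : MeasurePreserving (fun x : ℝ => -x) (volume.restrict (Ioi 0))
      (volume.restrict (Iio 0)) := by
    have := (Measure.measurePreserving_neg (volume : Measure ℝ)).restrict_preimage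
      (measurableSet_Iio (a := (0 : ℝ)))
    simpa using this
  refine ⟨h.memLp.comp_measurePreserving hmp, (h.memLp_deriv.comp_measurePreserving hmp).neg, ?_⟩
  intro φ hφ hφc hφs
  have hsub : tsupport (fun x => φ (-x)) ⊆ Iio 0 := by
    have : tsupport (fun x => φ (-x)) = (fun x : ℝ => -x) ⁻¹' tsupport φ :=
      tsupport_comp_eq_preimage φ (Homeomorph.neg ℝ)
    rw [this]
    intro x hx
    have := hφs hx
    simpa using this
  have key := h.isWeakDeriv (fun x => φ (-x)) (hφ.comp contDiff_neg)
    (hφc.comp_homeomorph (Homeomorph.neg ℝ)) hsub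
  have e : ∀ f : ℝ → ℂ, ∫ x in Ioi 0, f (-x) = ∫ x in Iio 0, f x := fun f => by
    rw [integral_comp_neg_Ioi, neg_zero, integral_Iic_eq_integral_Iio]
  rw [← e, ← e] at key
  simp only [deriv_comp_neg, neg_neg, neg_smul] at key
  rw [integral_neg] at key
  simp only [smul_neg, integral_neg, neg_neg]
  linear_combination -key

lemma HalfLineH1.of_isH1On_left {u g : ℝ → ℂ} {b : ℂ} (h : IsH1On (Iio 0) u g)
    (hb : IsLeftTrace u b) :
    ∃ v, HalfLineH1 v (fun x => -g (-x)) ∧ v =ᵐ[volume.restrict (Ioi 0)] (fun x => u (-x)) ∧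
      v 0 = b := by
  refine HalfLineH1.of_isH1On h.reflect ?_
  obtain ⟨v, hv, hvu, hvb⟩ := hb
  refine ⟨fun x => v (-x), ?_, ?_, by simpa using hvb⟩
  · refine hv.comp continuousOn_neg fun x hx => ?_
    simpa using hx
  · have hmp : MeasurePreserving (fun x : ℝ => -x) (volume.restrict (Ioi 0))
        (volume.restrict (Iio 0)) := by
      have := (Measure.measurePreserving_neg (volume : Measure ℝ)).restrict_preimage
        (measurableSet_Iio (a := (0 : ℝ)))
      simpa using this
    exact hmp.quasiMeasurePreserving.ae_eq_comp hvu

lemma HalfLineH1.smul {v g : ℝ → ℂ} (h : HalfLineH1 v g) (t : ℝ) :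
    HalfLineH1 (fun x => t • v x) (fun x => t • g x) := by
  refine ⟨h.continuous.const_smul t, h.memLp.const_smul t, h.memLp_deriv.const_smul t, ?_⟩
  intro x y hx hxy
  rw [intervalIntegral.integral_smul, ← h.sub_eq x y hx hxy, smul_sub]

lemma HalfLineH1.intervalIntegrable {v g : ℝ → ℂ} (h : HalfLineH1 v g) {x y : ℝ} (hx : 0 ≤ x)
    (hy : 0 ≤ y) : IntervalIntegrable g volume x y :=
  MemLp.intervalIntegrable_of_Ioi h.memLp_deriv hx hy

lemma HalfLineH1.integrableOn_sq {v g : ℝ → ℂ} (h : HalfLineH1 v g) :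
    IntegrableOn (fun x => ‖v x‖ ^ 2) (Ioi 0) :=
  h.memLp.integrable_norm_pow two_ne_zero

lemma HalfLineH1.integrableOn_deriv_sq {v g : ℝ → ℂ} (h : HalfLineH1 v g) :
    IntegrableOn (fun x => ‖g x‖ ^ 2) (Ioi 0) :=
  h.memLp_deriv.integrable_norm_pow two_ne_zero

/-- The chain rule for a primitive of `F` along `‖v‖`, as an inequality. -/
lemma HalfLineH1.abs_integral_le {v g : ℝ → ℂ} (h : HalfLineH1 v g) {F : ℝ → ℝ}
    (hF : Continuous F) (hF0 : ∀ s, 0 ≤ s → 0 ≤ F s) {x y : ℝ} (hx : 0 ≤ x) (hxy : x ≤ y) :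
    |∫ s in ‖v x‖..‖v y‖, F s| ≤ ∫ s in x..y, F ‖v s‖ * ‖g s‖ := by
  have hFv : Continuous fun s => F ‖v s‖ := hF.comp h.continuous.norm
  have hgn : ∀ a b, 0 ≤ a → 0 ≤ b → IntervalIntegrable (fun s => ‖g s‖) volume a b :=
    fun a b ha hb => (h.intervalIntegrable ha hb).norm
  have hii : ∀ a b, 0 ≤ a → 0 ≤ b → IntervalIntegrable (fun s => F ‖v s‖ * ‖g s‖) volume a b :=
    fun a b ha hb => (hgn a b ha hb).continuousOn_mul hFv.continuousOn
  have hiε : ∀ ε a b, 0 ≤ a → 0 ≤ b →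
      IntervalIntegrable (fun s => (F ‖v s‖ + ε) * ‖g s‖) volume a b :=
    fun ε a b ha hb => (hgn a b ha hb).continuousOn_mul (hFv.add continuous_const).continuousOn
  have hFi : ∀ a b, IntervalIntegrable F volume a b := fun a b => hF.intervalIntegrable a b
  -- Continuous induction along [x, y]. The slack ε absorbs the oscillation of F over a short step,
  -- on which ‖v‖ changes by at most the integral of ‖g‖; no almost-everywhere differentiability of
  -- ‖v‖ is used.
  have main : ∀ ε > 0, ∀ t ∈ Icc x y,
      |∫ s in ‖v x‖..‖v t‖, F s| ≤ ∫ s in x..t, (F ‖v s‖ + ε) * ‖g s‖ := by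
    intro ε hε
    set Q : Set ℝ := {t | |∫ s in ‖v x‖..‖v t‖, F s| ≤ ∫ s in x..t, (F ‖v s‖ + ε) * ‖g s‖}
    have hy : 0 ≤ y := hx.trans hxy
    have hclosed : IsClosed (Q ∩ Icc x y) := by
      have h1 : ContinuousOn (fun t => |∫ s in ‖v x‖..‖v t‖, F s|) (Icc x y) :=
        ((intervalIntegral.continuous_primitive hFi ‖v x‖).comp h.continuous.norm).abs.continuousOn
      have h2 : ContinuousOn (fun t => ∫ s in x..t, (F ‖v s‖ + ε) * ‖g s‖) (Icc x y) := by
        have := intervalIntegral.continuousOn_primitive_interval' (hiε ε x y hx hy)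
          (left_mem_uIcc (a := x) (b := y))
        rwa [uIcc_of_le hxy] at this
      have := isClosed_Icc.isClosed_le h1 h2
      convert this using 1
      ext t; simp only [Q, mem_inter_iff, mem_ofPred_eq]; tauto
    refine hclosed.Icc_subset_of_forall_mem_nhdsWithin (by simp [Q]) ?_
    rintro t ⟨htQ, htx, hty⟩
    have ht0 : 0 ≤ t := hx.trans htx
    obtain ⟨η, hη, hFη⟩ := Metric.continuousAt_iff.1 (hF.continuousAt (x := ‖v t‖)) (ε / 2)
      (half_pos hε)
    obtain ⟨δ, hδ, hvδ⟩ := Metric.continuousAt_iff.1 (h.continuous.norm.continuousAt (x := t)) η hη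
    filter_upwards [Ioo_mem_nhdsGT (show t < t + δ by linarith)] with t' ht'
    have htQ' : |∫ s in ‖v x‖..‖v t‖, F s| ≤ ∫ s in x..t, (F ‖v s‖ + ε) * ‖g s‖ := htQ
    change |∫ s in ‖v x‖..‖v t'‖, F s| ≤ ∫ s in x..t', (F ‖v s‖ + ε) * ‖g s‖
    have ht0' : 0 ≤ t' := ht0.trans ht'.1.le
    rw [← intervalIntegral.integral_add_adjacent_intervals (hFi ‖v x‖ ‖v t‖) (hFi ‖v t‖ ‖v t'‖),
      ← intervalIntegral.integral_add_adjacent_intervals (hiε ε x t hx ht0) (hiε ε t t' ht0 ht0')]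
    refine (abs_add_le _ _).trans (add_le_add htQ' ?_)
    have hF0t := hF0 ‖v t‖ (norm_nonneg _)
    have hb1 : |∫ s in ‖v t‖..‖v t'‖, F s| ≤ (F ‖v t‖ + ε / 2) * |‖v t'‖ - ‖v t‖| := by
      rw [← Real.norm_eq_abs (∫ s in ‖v t‖..‖v t'‖, F s)]
      refine intervalIntegral.norm_integral_le_of_norm_le_const fun s hs => ?_
      have hvt : dist ‖v t'‖ ‖v t‖ < η := hvδ (by
        rw [Real.dist_eq, abs_of_pos (by linarith [ht'.1])]; linarith [ht'.2])
      have hs' : |s - ‖v t‖| ≤ |‖v t'‖ - ‖v t‖| :=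
        abs_sub_left_of_mem_uIcc (uIoc_subset_uIcc hs)
      have := hFη (x := s) (lt_of_le_of_lt (by rw [Real.dist_eq]; exact hs') hvt)
      rw [Real.dist_eq] at this
      have := abs_lt.1 this
      rw [Real.norm_eq_abs, abs_le]
      constructor <;> linarith
    have hb2 : |‖v t'‖ - ‖v t‖| ≤ ∫ s in t..t', ‖g s‖ := by
      refine (abs_norm_sub_norm_le _ _).trans ?_
      rw [h.sub_eq t t' ht0 ht'.1.le]
      exact intervalIntegral.norm_integral_le_integral_norm ht'.1.le
    calc |∫ s in ‖v t‖..‖v t'‖, F s| ≤ (F ‖v t‖ + ε / 2) * ∫ s in t..t', ‖g s‖ :=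
          hb1.trans (mul_le_mul_of_nonneg_left hb2 (by linarith))
      _ = ∫ s in t..t', (F ‖v t‖ + ε / 2) * ‖g s‖ := by
          rw [intervalIntegral.integral_const_mul]
      _ ≤ ∫ s in t..t', (F ‖v s‖ + ε) * ‖g s‖ := by
          refine intervalIntegral.integral_mono_on ht'.1.le
            ((hgn t t' ht0 ht0').const_mul _) (hiε ε t t' ht0 ht0') fun s hs => ?_
          refine mul_le_mul_of_nonneg_right ?_ (norm_nonneg _)
          have hvt : dist ‖v s‖ ‖v t‖ < η := hvδ (by
            rw [Real.dist_eq, abs_of_nonneg (by linarith [hs.1])]; linarith [hs.2, ht'.2])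
          have := hFη hvt
          rw [Real.dist_eq] at this
          have := abs_lt.1 this
          linarith
  have hlim : Tendsto (fun ε : ℝ => ∫ s in x..y, (F ‖v s‖ + ε) * ‖g s‖) (𝓝[>] 0)
      (𝓝 (∫ s in x..y, F ‖v s‖ * ‖g s‖)) := by
    have hy : 0 ≤ y := hx.trans hxy
    have e : ∀ ε : ℝ, ∫ s in x..y, (F ‖v s‖ + ε) * ‖g s‖ =
        (∫ s in x..y, F ‖v s‖ * ‖g s‖) + ε * ∫ s in x..y, ‖g s‖ := by
      intro ε
      rw [← intervalIntegral.integral_const_mul, ← intervalIntegral.integral_add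
        (hii x y hx hy) ((hgn x y hx hy).const_mul ε)]
      simp only [add_mul]
    simp only [e]
    have : Tendsto (fun ε : ℝ => (∫ s in x..y, F ‖v s‖ * ‖g s‖) + ε * ∫ s in x..y, ‖g s‖) (𝓝 0)
        (𝓝 ((∫ s in x..y, F ‖v s‖ * ‖g s‖) + 0 * ∫ s in x..y, ‖g s‖)) :=
      Continuous.tendsto (by fun_prop) 0
    simpa using this.mono_left nhdsWithin_le_nhds
  refine ge_of_tendsto hlim ?_
  filter_upwards [self_mem_nhdsWithin] with ε hε
  exact main ε hε y ⟨hxy, le_rfl⟩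

lemma HalfLineH1.exists_norm_lt {v g : ℝ → ℂ} (h : HalfLineH1 v g) {x ε : ℝ} (hx : 0 ≤ x)
    (hε : 0 < ε) : ∃ y, x ≤ y ∧ ‖v y‖ < ε := by
  by_contra! hcon
  have h1 : IntegrableOn (fun s => ‖v s‖ ^ 2) (Ioi x) :=
    h.integrableOn_sq.mono_set (Ioi_subset_Ioi hx)
  have h2 : IntegrableOn (fun _ : ℝ => ε ^ 2) (Ioi x) := by
    refine Integrable.mono' h1 aestronglyMeasurable_const ?_
    filter_upwards [ae_restrict_mem measurableSet_Ioi] with s hs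
    rw [Real.norm_of_nonneg (by positivity)]
    exact pow_le_pow_left₀ hε.le (hcon s (le_of_lt hs)) 2
  rw [integrableOn_const_iff] at h2
  rcases h2 with h2 | h2
  · exact absurd h2 (by simp [hε.ne'])
  · simp at h2

/-- The Modica–Mortola type lower bound on a half-line. -/
lemma HalfLineH1.two_mul_sub_le {v g : ℝ → ℂ} (h : HalfLineH1 v g) {F : ℝ → ℝ}
    (hF : Continuous F) (hF0 : ∀ s, 0 ≤ s → 0 ≤ F s)
    (hint : IntegrableOn (fun s => ‖g s‖ ^ 2 + F ‖v s‖ ^ 2) (Ioi 0)) {x : ℝ} (hx : 0 ≤ x) :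
    2 * (2 * (∫ s in (0 : ℝ)..‖v x‖, F s) - ∫ s in (0 : ℝ)..‖v 0‖, F s) ≤
      ∫ s in Ioi 0, (‖g s‖ ^ 2 + F ‖v s‖ ^ 2) := by
  have hFi : ∀ a b, IntervalIntegrable F volume a b := fun a b => hF.intervalIntegrable a b
  set G : ℝ → ℝ := fun a => ∫ s in (0 : ℝ)..a, F s
  have hG : Continuous G := intervalIntegral.continuous_primitive hFi 0
  have hGsub : ∀ a b, ∫ s in a..b, F s = G b - G a := fun a b => by
    rw [← intervalIntegral.integral_interval_sub_left (hFi 0 b) (hFi 0 a)]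
  have hFv : Continuous fun s => F ‖v s‖ := hF.comp h.continuous.norm
  have key : ∀ a b, 0 ≤ a → a ≤ b →
      2 * |G ‖v b‖ - G ‖v a‖| ≤ ∫ s in a..b, (‖g s‖ ^ 2 + F ‖v s‖ ^ 2) := by
    intro a b ha hab
    have hi : IntervalIntegrable (fun s => ‖g s‖ ^ 2 + F ‖v s‖ ^ 2) volume a b := by
      rw [intervalIntegrable_iff, uIoc_of_le hab]
      exact hint.mono_set fun s hs => lt_of_le_of_lt ha hs.1
    have hii : IntervalIntegrable (fun s => F ‖v s‖ * ‖g s‖) volume a b :=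
      (h.intervalIntegrable ha (ha.trans hab)).norm.continuousOn_mul hFv.continuousOn
    rw [← hGsub]
    refine (mul_le_mul_of_nonneg_left (h.abs_integral_le hF hF0 ha hab) zero_le_two).trans ?_
    rw [← intervalIntegral.integral_const_mul]
    refine intervalIntegral.integral_mono_on hab (hii.const_mul 2) hi fun s _ => ?_
    nlinarith [sq_nonneg (‖g s‖ - F ‖v s‖)]
  -- Two passages are paid for: from ‖v 0‖ to ‖v x‖, and then down to nearly zero, since ‖v‖ is
  -- small somewhere beyond x. This is why G ‖v x‖ is counted twice.
  have hb : ∀ ε > 0, 2 * (2 * G ‖v x‖ - G ‖v 0‖) ≤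
      (∫ s in Ioi 0, (‖g s‖ ^ 2 + F ‖v s‖ ^ 2)) + ε := by
    intro ε hε
    obtain ⟨η, hη, hGη⟩ := Metric.continuousAt_iff.1 (hG.continuousAt (x := 0)) (ε / 2)
      (half_pos hε)
    obtain ⟨y, hxy, hy⟩ := h.exists_norm_lt hx hη
    have hGy : G ‖v y‖ ≤ ε / 2 := by
      have := hGη (x := ‖v y‖) (by
        rw [Real.dist_eq, sub_zero, abs_of_nonneg (norm_nonneg _)]; exact hy)
      rw [Real.dist_eq] at this
      have h0 : G 0 = 0 := by simp [G]
      rw [h0, sub_zero] at this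
      exact (le_abs_self _).trans this.le
    have k1 := key 0 x le_rfl hx
    have k2 := key x y hx hxy
    have hadd : (∫ s in (0 : ℝ)..x, (‖g s‖ ^ 2 + F ‖v s‖ ^ 2)) +
        (∫ s in x..y, (‖g s‖ ^ 2 + F ‖v s‖ ^ 2)) ≤
        ∫ s in Ioi 0, (‖g s‖ ^ 2 + F ‖v s‖ ^ 2) := by
      have hy0 : 0 ≤ y := hx.trans hxy
      rw [intervalIntegral.integral_add_adjacent_intervals]
      · rw [intervalIntegral.integral_of_le hy0]
        refine setIntegral_mono_set hint (Eventually.of_forall fun s => by positivity) ?_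
        exact (Ioc_subset_Ioi_self).eventuallyLE
      · rw [intervalIntegrable_iff, uIoc_of_le hx]
        exact hint.mono_set Ioc_subset_Ioi_self
      · rw [intervalIntegrable_iff, uIoc_of_le hxy]
        exact hint.mono_set fun s hs => lt_of_le_of_lt hx hs.1
    have a1 := le_abs_self (G ‖v x‖ - G ‖v 0‖)
    have a2 := neg_abs_le (G ‖v y‖ - G ‖v x‖)
    linarith
  exact le_of_forall_pos_le_add hb

/-- The increment of ‖v‖² is at most the integral of 2‖v‖‖g‖, which is controlled by the H¹ norm. -/
lemma HalfLineH1.exists_isLUB {v g : ℝ → ℂ} (h : HalfLineH1 v g) :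
    ∃ A, IsLUB ((fun x => ‖v x‖) '' Ici 0) A := by
  have hint : IntegrableOn (fun s => ‖v s‖ ^ 2 + ‖g s‖ ^ 2) (Ioi 0) :=
    h.integrableOn_sq.add h.integrableOn_deriv_sq
  refine Real.exists_isLUB ⟨_, mem_image_of_mem _ (self_mem_Ici (a := (0 : ℝ)))⟩
    ⟨√(‖v 0‖ ^ 2 + ∫ s in Ioi 0, (‖v s‖ ^ 2 + ‖g s‖ ^ 2)), ?_⟩
  rintro _ ⟨x, hx, rfl⟩
  have hx : 0 ≤ x := hx
  apply Real.le_sqrt_of_sq_le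
  have h1 := h.abs_integral_le (F := fun s => 2 * s) (by fun_prop) (fun s hs => by positivity)
    le_rfl hx
  have h2 : ∫ s in ‖v 0‖..‖v x‖, 2 * s = ‖v x‖ ^ 2 - ‖v 0‖ ^ 2 := by
    rw [intervalIntegral.integral_const_mul, integral_id]; ring
  have h3 : ∫ s in (0 : ℝ)..x, 2 * ‖v s‖ * ‖g s‖ ≤ ∫ s in Ioi 0, (‖v s‖ ^ 2 + ‖g s‖ ^ 2) := by
    calc ∫ s in (0 : ℝ)..x, 2 * ‖v s‖ * ‖g s‖ ≤ ∫ s in (0 : ℝ)..x, (‖v s‖ ^ 2 + ‖g s‖ ^ 2) := by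
          refine intervalIntegral.integral_mono_on hx ?_ ?_ fun s _ => ?_
          · exact (h.intervalIntegrable le_rfl hx).norm.continuousOn_mul
              (continuous_const.mul h.continuous.norm).continuousOn
          · rw [intervalIntegrable_iff, uIoc_of_le hx]
            exact hint.mono_set Ioc_subset_Ioi_self
          · nlinarith [sq_nonneg (‖g s‖ - ‖v s‖)]
      _ ≤ _ := by
          rw [intervalIntegral.integral_of_le hx]
          refine setIntegral_mono_set hint (Eventually.of_forall fun s => by positivity) ?_
          exact (Ioc_subset_Ioi_self).eventuallyLE
  rw [h2] at h1
  linarith [le_abs_self (‖v x‖ ^ 2 - ‖v 0‖ ^ 2)]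

lemma HalfLineH1.norm_le_of_isLUB {v : ℝ → ℂ} {A : ℝ}
    (hA : IsLUB ((fun x => ‖v x‖) '' Ici 0) A) {x : ℝ} (hx : 0 ≤ x) : ‖v x‖ ≤ A :=
  hA.1 (mem_image_of_mem _ hx)

lemma HalfLineH1.integrableOn_rpow {v g : ℝ → ℂ} (h : HalfLineH1 v g) {μ : ℝ} (hμ : 0 < μ) :
    IntegrableOn (fun x => ‖v x‖ ^ (2 * μ + 2)) (Ioi 0) := by
  obtain ⟨A, hA⟩ := h.exists_isLUB
  refine Integrable.mono' (h.integrableOn_sq.const_mul (A ^ (2 * μ))) ?_ ?_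
  · have : Continuous fun x => ‖v x‖ ^ (2 * μ + 2) :=
      h.continuous.norm.rpow_const fun _ => Or.inr (by positivity)
    exact this.aestronglyMeasurable
  · filter_upwards [ae_restrict_mem measurableSet_Ioi] with x hx
    rw [Real.norm_of_nonneg (by positivity)]
    have e : ‖v x‖ ^ (2 * μ + 2) = ‖v x‖ ^ (2 * μ) * ‖v x‖ ^ 2 := by
      rw [Real.rpow_add' (norm_nonneg _) (by positivity), Real.rpow_two]
    rw [e]
    refine mul_le_mul_of_nonneg_right ?_ (by positivity)
    exact Real.rpow_le_rpow (norm_nonneg _) (HalfLineH1.norm_le_of_isLUB hA (le_of_lt hx))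
      (by positivity)

/-! ### The rescaled first-order system -/

/-- `-w'` as a function of `w`, for the decaying profile of amplitude one at frequency one. -/
noncomputable def field (μ s : ℝ) : ℝ := s * √(1 - s ^ (2 * μ))

/-- The primitive of `field μ`: the action of the decaying profile starting at the value `x`. -/
noncomputable def fieldInt (μ x : ℝ) : ℝ := ∫ s in (0 : ℝ)..x, field μ s

lemma continuous_field {μ : ℝ} (hμ : 0 < μ) : Continuous (field μ) :=
  continuous_id.mul ((continuous_const.sub
    (Real.continuous_rpow_const (by positivity))).sqrt)

lemma field_nonneg {μ s : ℝ} (hs : 0 ≤ s) : 0 ≤ field μ s := mul_nonneg hs (Real.sqrt_nonneg _)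

lemma hasDerivAt_fieldInt {μ : ℝ} (hμ : 0 < μ) (x : ℝ) :
    HasDerivAt (fieldInt μ) (field μ x) x :=
  ((continuous_field hμ).integral_hasStrictDerivAt 0 x).hasDerivAt

lemma continuous_fieldInt {μ : ℝ} (hμ : 0 < μ) : Continuous (fieldInt μ) :=
  continuous_iff_continuousAt.2 fun x => (hasDerivAt_fieldInt hμ x).continuousAt

lemma monotoneOn_fieldInt {μ : ℝ} (hμ : 0 < μ) : MonotoneOn (fieldInt μ) (Ici 0) := by
  refine monotoneOn_of_deriv_nonneg (convex_Ici 0) (continuous_fieldInt hμ).continuousOn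
    (fun x _ => (hasDerivAt_fieldInt hμ x).differentiableAt.differentiableWithinAt) fun x hx => ?_
  rw [(hasDerivAt_fieldInt hμ x).deriv]
  rw [interior_Ici] at hx
  exact field_nonneg (le_of_lt hx)

lemma rpow_two_mul_add_two {s μ : ℝ} (hs : 0 ≤ s) (hμ : 0 < μ) :
    s ^ (2 * μ + 2) = s ^ (2 * μ) * s ^ 2 := by
  rw [Real.rpow_add' hs (by positivity), Real.rpow_two]

lemma sq_field {μ s : ℝ} (hμ : 0 < μ) (hs : 0 ≤ s) (hs1 : s ≤ 1) :
    field μ s ^ 2 = s ^ 2 - s ^ (2 * μ + 2) := by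
  have : s ^ (2 * μ) ≤ 1 := Real.rpow_le_one hs hs1 (by positivity)
  rw [field, mul_pow, Real.sq_sqrt (by linarith), rpow_two_mul_add_two hs hμ]
  ring

/-- The reduced action of two decaying profiles with boundary values `x` and `-y`. -/
noncomputable def reduced (μ k x y : ℝ) : ℝ :=
  fieldInt μ x + fieldInt μ y - (x + y) ^ 2 / (2 * k)

/-- As long as t‖v‖ ≤ 1, the right side is exactly the integral of ‖t g‖² + ω (`field μ ‖t v‖`)², so
`two_mul_sub_le` applies with F = √ω · `field μ`; the intermediate point is then moved along a
sequence on which ‖v‖ tends to its supremum A. -/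
lemma HalfLineH1.le_energy {v g : ℝ → ℂ} (h : HalfLineH1 v g) {μ ω A t : ℝ} (hμ : 0 < μ)
    (hω : 0 < ω) (hA : IsLUB ((fun x => ‖v x‖) '' Ici 0) A) (ht : 0 ≤ t) (htA : t * A ≤ 1) :
    2 * √ω * (2 * fieldInt μ (t * A) - fieldInt μ (t * ‖v 0‖)) ≤
      t ^ 2 * (∫ x in Ioi 0, ‖g x‖ ^ 2) + ω * (t ^ 2 * (∫ x in Ioi 0, ‖v x‖ ^ 2) -
        t ^ (2 * μ + 2) * ∫ x in Ioi 0, ‖v x‖ ^ (2 * μ + 2)) := by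
  have hle : ∀ x, 0 ≤ x → t * ‖v x‖ ≤ 1 := fun x hx =>
    (mul_le_mul_of_nonneg_left (HalfLineH1.norm_le_of_isLUB hA hx) ht).trans htA
  have hI : ∀ x ∈ Ioi (0 : ℝ), ‖t • g x‖ ^ 2 + (√ω * field μ ‖t • v x‖) ^ 2 =
      t ^ 2 * ‖g x‖ ^ 2 + ω * (t ^ 2 * ‖v x‖ ^ 2 - t ^ (2 * μ + 2) * ‖v x‖ ^ (2 * μ + 2)) := by
    intro x hx
    rw [norm_smul, norm_smul, Real.norm_of_nonneg ht, mul_pow, mul_pow, Real.sq_sqrt hω.le,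
      sq_field hμ (by positivity) (hle x (le_of_lt hx)), Real.mul_rpow ht (norm_nonneg _), mul_pow]
  have hi1 : IntegrableOn (fun x => t ^ 2 * ‖v x‖ ^ 2 - t ^ (2 * μ + 2) * ‖v x‖ ^ (2 * μ + 2))
      (Ioi 0) := (h.integrableOn_sq.const_mul (t ^ 2)).sub
    ((h.integrableOn_rpow hμ).const_mul (t ^ (2 * μ + 2)))
  have hi2 := (h.integrableOn_deriv_sq.const_mul (t ^ 2)).add (hi1.const_mul ω)
  have hint : IntegrableOn (fun x => ‖t • g x‖ ^ 2 + (√ω * field μ ‖t • v x‖) ^ 2) (Ioi 0) :=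
    (integrableOn_congr_fun hI measurableSet_Ioi).2 hi2
  have hF : Continuous fun s => √ω * field μ s := continuous_const.mul (continuous_field hμ)
  have hval : ∫ x in Ioi 0, (‖t • g x‖ ^ 2 + (√ω * field μ ‖t • v x‖) ^ 2) =
      t ^ 2 * (∫ x in Ioi 0, ‖g x‖ ^ 2) + ω * (t ^ 2 * (∫ x in Ioi 0, ‖v x‖ ^ 2) -
        t ^ (2 * μ + 2) * ∫ x in Ioi 0, ‖v x‖ ^ (2 * μ + 2)) := by
    rw [setIntegral_congr_fun measurableSet_Ioi hI]
    rw [integral_add (h.integrableOn_deriv_sq.const_mul (t ^ 2)) (hi1.const_mul ω),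
      integral_const_mul, integral_const_mul,
      integral_sub (h.integrableOn_sq.const_mul (t ^ 2))
        ((h.integrableOn_rpow hμ).const_mul (t ^ (2 * μ + 2))),
      integral_const_mul, integral_const_mul]
  rw [← hval]
  have hbd : ∀ x, 0 ≤ x → 2 * √ω * (2 * fieldInt μ (t * ‖v x‖) - fieldInt μ (t * ‖v 0‖)) ≤
      ∫ x in Ioi 0, (‖t • g x‖ ^ 2 + (√ω * field μ ‖t • v x‖) ^ 2) := by
    intro x hx
    have := (h.smul t).two_mul_sub_le hF
      (fun s hs => mul_nonneg (Real.sqrt_nonneg _) (field_nonneg hs)) hint hx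
    simp only [intervalIntegral.integral_const_mul, norm_smul, Real.norm_of_nonneg ht] at this ⊢
    simp only [fieldInt]
    linarith
  obtain ⟨u, -, -, hu, humem⟩ := hA.exists_seq_monotone_tendsto
    ⟨_, mem_image_of_mem _ (self_mem_Ici (a := (0 : ℝ)))⟩
  have hlim : Tendsto (fun n => 2 * √ω * (2 * fieldInt μ (t * u n) - fieldInt μ (t * ‖v 0‖)))
      atTop (𝓝 (2 * √ω * (2 * fieldInt μ (t * A) - fieldInt μ (t * ‖v 0‖)))) := by
    have hc : Continuous fun a => 2 * √ω * (2 * fieldInt μ (t * a) - fieldInt μ (t * ‖v 0‖)) := by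
      have := continuous_fieldInt hμ
      fun_prop
    exact (hc.tendsto A).comp hu
  refine le_of_tendsto' hlim fun n => ?_
  obtain ⟨x, hx, hxu⟩ := humem n
  rw [← hxu]
  exact hbd x hx

/-! ### Lower bound on the Nehari manifold -/

lemma integrableOn_Iic_of_comp_neg {f : ℝ → ℝ} (hf : IntegrableOn (fun x => f (-x)) (Ioi 0)) :
    IntegrableOn f (Iic 0) := by
  have h := (Measure.measurePreserving_neg (volume : Measure ℝ)).integrableOn_comp_preimage
    (Homeomorph.neg ℝ).measurableEmbedding (f := f) (s := Iio 0)
  rw [integrableOn_Iic_iff_integrableOn_Iio]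
  refine h.1 ?_
  have e : (Neg.neg : ℝ → ℝ) ⁻¹' Iio 0 = Ioi 0 := by ext x; simp
  rw [e]
  exact hf

lemma integral_eq_add_comp_neg {f : ℝ → ℝ} (hf : IntegrableOn f (Ioi 0))
    (hf' : IntegrableOn (fun x => f (-x)) (Ioi 0)) :
    ∫ x, f x = (∫ x in Ioi 0, f x) + ∫ x in Ioi 0, f (-x) := by
  rw [integral_comp_neg_Ioi, neg_zero, add_comm,
    intervalIntegral.integral_Iic_add_Ioi (integrableOn_Iic_of_comp_neg hf') hf]

/-- The amplitude `((μ+1)ω/λ)^{1/(2μ)}` of the soliton on the line. -/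
noncomputable def amplitude (lam μ ω : ℝ) : ℝ := ((μ + 1) * ω / lam) ^ (1 / (2 * μ))

lemma amplitude_pos {lam μ ω : ℝ} (hlam : 0 < lam) (hμ : 0 < μ) (hω : 0 < ω) :
    0 < amplitude lam μ ω := by
  unfold amplitude; positivity

lemma amplitude_rpow {lam μ ω : ℝ} (hlam : 0 < lam) (hμ : 0 < μ) (hω : 0 < ω) :
    lam * amplitude lam μ ω ^ (2 * μ) = (μ + 1) * ω := by
  unfold amplitude
  rw [← Real.rpow_mul (by positivity), one_div_mul_cancel (by positivity), Real.rpow_one]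
  field_simp

/-- Bernoulli's inequality for θ² with exponent μ + 1. It expresses that the action along the ray θψ
through a Nehari point is largest at θ = 1. -/
lemma sq_half_sub_rpow_le {μ θ : ℝ} (hμ : 0 < μ) (hθ : 0 ≤ θ) :
    θ ^ 2 / 2 - θ ^ (2 * μ + 2) / (2 * μ + 2) ≤ 1 / 2 - 1 / (2 * μ + 2) := by
  have h := one_add_mul_self_le_rpow_one_add (s := θ ^ 2 - 1) (by nlinarith [sq_nonneg θ])
    (p := μ + 1) (by linarith)
  rw [add_sub_cancel, ← Real.rpow_two, ← Real.rpow_mul hθ, Real.rpow_two,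
    show (2 : ℝ) * (μ + 1) = 2 * μ + 2 by ring] at h
  have e : (1 : ℝ) / 2 - 1 / (2 * μ + 2) - (θ ^ 2 / 2 - θ ^ (2 * μ + 2) / (2 * μ + 2)) =
      (θ ^ (2 * μ + 2) - (1 + (μ + 1) * (θ ^ 2 - 1))) / (2 * μ + 2) := by
    field_simp; ring
  have : 0 ≤ (θ ^ (2 * μ + 2) - (1 + (μ + 1) * (θ ^ 2 - 1))) / (2 * μ + 2) :=
    div_nonneg (by linarith) (by positivity)
  linarith

/-- A and B are the suprema of |ψ| on the two half-lines. Compare ψ with its multiple by t times the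
amplitude: by the Nehari constraint this multiple has no larger action, and its action is bounded
below by `le_energy` on each side together with the bound A + B for the jump. -/
lemma exists_reduced_le_action {γ lam μ ω : ℝ} (hγ : 0 < γ) (hlam : 0 < lam) (hμ : 0 < μ)
    (hω : 0 < ω) (ψ : EnergySpace) (hne : ¬ ψ.toFun =ᵐ[volume] 0)
    (hN : nehari γ lam μ ω ψ = 0) :
    ∃ A B : ℝ, 0 ≤ A ∧ 0 ≤ B ∧ 0 < max A B ∧ ∀ t, 0 ≤ t → t * A ≤ 1 → t * B ≤ 1 →
      √ω * amplitude lam μ ω ^ 2 * reduced μ (γ * √ω) (t * A) (t * B) ≤ action γ lam μ ω ψ := by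
  obtain ⟨v, hv, hvu, hv0⟩ := HalfLineH1.of_isH1On ψ.isH1_right ψ.isRightTrace
  obtain ⟨w, hw, hwu, hw0⟩ := HalfLineH1.of_isH1On_left ψ.isH1_left ψ.isLeftTrace
  obtain ⟨A, hA⟩ := hv.exists_isLUB
  obtain ⟨B, hB⟩ := hw.exists_isLUB
  have hvA : ∀ x, 0 ≤ x → ‖v x‖ ≤ A := fun x hx => HalfLineH1.norm_le_of_isLUB hA hx
  have hwB : ∀ x, 0 ≤ x → ‖w x‖ ≤ B := fun x hx => HalfLineH1.norm_le_of_isLUB hB hx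
  have hA0 : 0 ≤ A := (norm_nonneg _).trans (hvA 0 le_rfl)
  have hB0 : 0 ≤ B := (norm_nonneg _).trans (hwB 0 le_rfl)
  refine ⟨A, B, hA0, hB0, ?_, ?_⟩
  · by_contra hcon
    have hA' : A = 0 := le_antisymm ((le_max_left A B).trans (not_lt.1 hcon)) hA0
    have hB' : B = 0 := le_antisymm ((le_max_right A B).trans (not_lt.1 hcon)) hB0
    apply hne
    have h1 : ψ.toFun =ᵐ[volume.restrict (Ioi 0)] 0 := by
      filter_upwards [hvu, ae_restrict_mem measurableSet_Ioi] with x hx hx0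
      have := hvA x (le_of_lt hx0)
      rw [hA', norm_le_zero_iff] at this
      rw [← hx, this]; rfl
    have h2 : ψ.toFun =ᵐ[volume.restrict (Iio 0)] 0 := by
      have h3 : (fun x => ψ.toFun (-x)) =ᵐ[volume.restrict (Ioi 0)] 0 := by
        filter_upwards [hwu, ae_restrict_mem measurableSet_Ioi] with x hx hx0
        have := hwB x (le_of_lt hx0)
        rw [hB', norm_le_zero_iff] at this
        rw [← hx, this]; rfl
      have hmp : MeasurePreserving (fun x : ℝ => -x) (volume.restrict (Iio 0))
          (volume.restrict (Ioi 0)) := by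
        have := (Measure.measurePreserving_neg (volume : Measure ℝ)).restrict_preimage
          (measurableSet_Ioi (a := (0 : ℝ)))
        simpa using this
      have := hmp.quasiMeasurePreserving.ae_eq_comp h3
      filter_upwards [this] with x hx
      simpa using hx
    have h4 : ψ.toFun =ᵐ[volume.restrict (Iio 0 ∪ Ioi 0)] 0 :=
      (ae_restrict_union_iff _ _ _).2 ⟨h2, h1⟩
    rw [Iio_union_Ioi] at h4
    rwa [restrict_compl_singleton] at h4
  intro t ht htA htB
  have hsplit : ∀ f : ℂ → ℝ, IntegrableOn (fun x => f (v x)) (Ioi 0) →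
      IntegrableOn (fun x => f (w x)) (Ioi 0) →
      ∫ x, f (ψ.toFun x) = (∫ x in Ioi 0, f (v x)) + ∫ x in Ioi 0, f (w x) := by
    intro f hf1 hf2
    have e1 : (fun x => f (v x)) =ᵐ[volume.restrict (Ioi 0)] fun x => f (ψ.toFun x) := by
      filter_upwards [hvu] with x hx; rw [hx]
    have e2 : (fun x => f (w x)) =ᵐ[volume.restrict (Ioi 0)] fun x => f (ψ.toFun (-x)) := by
      filter_upwards [hwu] with x hx; rw [hx]
    rw [integral_eq_add_comp_neg (hf1.congr e1) (hf2.congr e2), integral_congr_ae e1,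
      integral_congr_ae e2]
  have i2 := hsplit (fun z => ‖z‖ ^ 2) hv.integrableOn_sq hw.integrableOn_sq
  have ip := hsplit (fun z => ‖z‖ ^ (2 * μ + 2)) (hv.integrableOn_rpow hμ)
    (hw.integrableOn_rpow hμ)
  have ig : ∫ x, ‖ψ.weakDeriv x‖ ^ 2 = (∫ x in Ioi 0, ‖ψ.weakDeriv x‖ ^ 2) +
      ∫ x in Ioi 0, ‖-ψ.weakDeriv (-x)‖ ^ 2 := by
    have h1 := hw.integrableOn_deriv_sq
    simp only [norm_neg] at h1 ⊢
    exact integral_eq_add_comp_neg (f := fun x => ‖ψ.weakDeriv x‖ ^ 2) hv.integrableOn_deriv_sq h1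
  have eR := hv.le_energy hμ hω hA ht htA
  have eL := hw.le_energy hμ hω hB ht htB
  have hJ : ‖ψ.valRight - ψ.valLeft‖ ≤ ‖v 0‖ + ‖w 0‖ := by
    rw [hv0, hw0]; exact norm_sub_le _ _
  have hP0 : 0 ≤ ∫ x, ‖ψ.toFun x‖ ^ (2 * μ + 2) := integral_nonneg fun x => by positivity
  unfold nehari at hN
  unfold action reduced
  rw [i2, ip, ig] at hN ⊢
  rw [ip] at hP0
  set ER := ∫ x in Ioi 0, ‖ψ.weakDeriv x‖ ^ 2
  set EL := ∫ x in Ioi 0, ‖-ψ.weakDeriv (-x)‖ ^ 2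
  set NR := ∫ x in Ioi 0, ‖v x‖ ^ 2
  set NL := ∫ x in Ioi 0, ‖w x‖ ^ 2
  set PR := ∫ x in Ioi 0, ‖v x‖ ^ (2 * μ + 2)
  set PL := ∫ x in Ioi 0, ‖w x‖ ^ (2 * μ + 2)
  set J := ‖ψ.valRight - ψ.valLeft‖
  set m := amplitude lam μ ω
  have hm : 0 < m := amplitude_pos hlam hμ hω
  have hmr : lam * m ^ (2 * μ) = (μ + 1) * ω := amplitude_rpow hlam hμ hω
  -- The choice θ = t m is forced by the identity for the amplitude m, which turns λ m^{2μ}/(2μ+2)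
  -- into ω/2, the coefficient that `le_energy` requires.
  have hs := sq_half_sub_rpow_le hμ (mul_nonneg ht hm.le)
  have hrp : (t * m) ^ (2 * μ + 2) = t ^ (2 * μ + 2) * (m ^ (2 * μ) * m ^ 2) := by
    rw [Real.mul_rpow ht hm.le, rpow_two_mul_add_two hm.le hμ]
  rw [hrp] at hs
  have hmonoA : fieldInt μ (t * ‖v 0‖) ≤ fieldInt μ (t * A) :=
    monotoneOn_fieldInt hμ (mem_Ici.2 (by positivity)) (mem_Ici.2 (by positivity))
      (mul_le_mul_of_nonneg_left (hvA 0 le_rfl) ht)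
  have hmonoB : fieldInt μ (t * ‖w 0‖) ≤ fieldInt μ (t * B) :=
    monotoneOn_fieldInt hμ (mem_Ici.2 (by positivity)) (mem_Ici.2 (by positivity))
      (mul_le_mul_of_nonneg_left (hwB 0 le_rfl) ht)
  have hJ2 : J ^ 2 ≤ (A + B) ^ 2 :=
    pow_le_pow_left₀ (norm_nonneg _) (hJ.trans (add_le_add (hvA 0 le_rfl) (hwB 0 le_rfl))) 2
  have hsω : 0 < √ω := Real.sqrt_pos.2 hω
  have hJγ : t ^ 2 * (1 / γ * J ^ 2) ≤ (t * A + t * B) ^ 2 / γ := by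
    calc t ^ 2 * (1 / γ * J ^ 2) = t ^ 2 / γ * J ^ 2 := by ring
      _ ≤ t ^ 2 / γ * (A + B) ^ 2 := mul_le_mul_of_nonneg_left hJ2 (by positivity)
      _ = _ := by ring
  have hkey : √ω * ((t * A + t * B) ^ 2 / (2 * (γ * √ω))) = (t * A + t * B) ^ 2 / γ / 2 := by
    field_simp
  set gA := fieldInt μ (t * A)
  set gB := fieldInt μ (t * B)
  have h1 : √ω * (gA + gB - (t * A + t * B) ^ 2 / (2 * (γ * √ω))) ≤
      1 / 2 * (t ^ 2 * (ER + EL + ω * (NR + NL) - 1 / γ * J ^ 2) -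
        ω * (t ^ (2 * μ + 2) * (PR + PL))) := by
    have a1 : 2 * √ω * gA ≤ 2 * √ω * (2 * gA - fieldInt μ (t * ‖v 0‖)) :=
      mul_le_mul_of_nonneg_left (by linarith) (by positivity)
    have a2 : 2 * √ω * gB ≤ 2 * √ω * (2 * gB - fieldInt μ (t * ‖w 0‖)) :=
      mul_le_mul_of_nonneg_left (by linarith) (by positivity)
    rw [mul_sub, hkey]
    linarith
  have h2 := mul_le_mul_of_nonneg_left h1 (sq_nonneg m)
  have h3 := mul_le_mul_of_nonneg_left hs (mul_nonneg hlam.le hP0)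
  have hQ : ER + EL + ω * (NR + NL) - 1 / γ * J ^ 2 = lam * (PR + PL) := by linarith
  have e1 : 1 / 2 * (ER + EL) + ω / 2 * (NR + NL) - 1 / (2 * γ) * J ^ 2 =
      1 / 2 * (lam * (PR + PL)) := by
    rw [← hQ]; field_simp
  rw [e1]
  rw [hQ] at h2
  have e2 : lam * (PR + PL) * (t ^ (2 * μ + 2) * (m ^ (2 * μ) * m ^ 2) / (2 * μ + 2)) =
      m ^ 2 * (1 / 2 * (ω * (t ^ (2 * μ + 2) * (PR + PL)))) := by
    rw [show lam * (PR + PL) * (t ^ (2 * μ + 2) * (m ^ (2 * μ) * m ^ 2) / (2 * μ + 2)) =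
      (lam * m ^ (2 * μ)) * ((PR + PL) * t ^ (2 * μ + 2) * m ^ 2) / (2 * μ + 2) by ring, hmr]
    field_simp
  have e3 : lam / (2 * μ + 2) * (PR + PL) = lam * (PR + PL) * (1 / (2 * μ + 2)) := by ring
  rw [e3]
  rw [mul_sub, mul_sub, e2, mul_pow] at h3
  linarith

/-! ### The explicit stationary profiles -/

/-- `w`, with derivative `w'`, is the decaying profile with boundary value `x`. -/
structure IsProfile (μ ω x : ℝ) (w w' : ℝ → ℝ) : Prop where
  hasDerivAt : ∀ s, HasDerivAt w (w' s) s
  continuous_deriv : Continuous w'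
  val_zero : w 0 = x
  pos : ∀ s, 0 < w s
  integrableOn_sq : IntegrableOn (fun s => w s ^ 2) (Ioi 0)
  integrableOn_deriv_sq : IntegrableOn (fun s => w' s ^ 2) (Ioi 0)
  integrableOn_rpow : IntegrableOn (fun s => w s ^ (2 * μ + 2)) (Ioi 0)
  action_eq : (∫ s in Ioi 0, w' s ^ 2) + ω * (∫ s in Ioi 0, w s ^ 2) -
    ω * (∫ s in Ioi 0, w s ^ (2 * μ + 2)) = 2 * √ω * fieldInt μ x
  nehari_eq : (∫ s in Ioi 0, w' s ^ 2) + ω * (∫ s in Ioi 0, w s ^ 2) -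
    (μ + 1) * ω * (∫ s in Ioi 0, w s ^ (2 * μ + 2)) = √ω * (x * field μ x)

/-- The profile is w(s) = cosh(c₀ + μ√ω s)^{-1/μ} with cosh c₀ = x^{-μ}. For s ≥ 0 it satisfies w' =
-√ω `field μ w`, and w'' = ωw - (μ+1)ω w^{2μ+1}; hence the integrands of the two identities are the
derivatives of -2√ω `fieldInt μ w` and of w w'. -/
lemma exists_isProfile {μ ω x : ℝ} (hμ : 0 < μ) (hω : 0 < ω) (hx : 0 < x) (hx1 : x < 1) :
    ∃ w w', IsProfile μ ω x w w' := by
  have hsω : 0 < √ω := Real.sqrt_pos.2 hω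
  have hxμ : 1 < x ^ (-μ) := Real.one_lt_rpow_of_pos_of_lt_one_of_neg hx hx1 (by linarith)
  obtain ⟨c₀, hc₀, hcosh⟩ : ∃ c₀ : ℝ, 0 < c₀ ∧ Real.cosh c₀ = x ^ (-μ) :=
    ⟨Real.arcosh (x ^ (-μ)), Real.arcosh_pos hxμ, Real.cosh_arcosh hxμ.le⟩
  set c : ℝ → ℝ := fun s => c₀ + μ * √ω * s with hc
  have hcd : ∀ s, HasDerivAt c (μ * √ω) s := fun s => by
    exact (((hasDerivAt_id s).const_mul (μ * √ω)).const_add c₀).congr_deriv (by ring)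
  have hcpos : ∀ s, 0 ≤ s → 0 < c s := fun s hs => by simp only [hc]; positivity
  set w : ℝ → ℝ := fun s => Real.cosh (c s) ^ (-(1 / μ)) with hw
  set w' : ℝ → ℝ := fun s => -√ω * (Real.sinh (c s) / Real.cosh (c s)) * w s with hw'
  have hch : ∀ s, 0 < Real.cosh (c s) := fun s => Real.cosh_pos _
  have hwpos : ∀ s, 0 < w s := fun s => Real.rpow_pos_of_pos (hch s) _
  have hwd : ∀ s, HasDerivAt w (w' s) s := by
    intro s
    have h1 : HasDerivAt (fun s => Real.cosh (c s)) (Real.sinh (c s) * (μ * √ω)) s :=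
      (Real.hasDerivAt_cosh (c s)).comp s (hcd s)
    have h2 := h1.rpow_const (p := -(1 / μ)) (Or.inl (hch s).ne')
    convert h2 using 1
    simp only [hw', hw]
    rw [Real.rpow_sub_one (hch s).ne']
    field_simp
  have hwc : Continuous w := continuous_iff_continuousAt.2 fun s => (hwd s).continuousAt
  have hcc : Continuous c := continuous_iff_continuousAt.2 fun s => (hcd s).continuousAt
  have hw'c : Continuous w' :=
    (continuous_const.mul ((Real.continuous_sinh.comp hcc).div (Real.continuous_cosh.comp hcc)
      fun s => (hch s).ne')).mul hwc
  have hw2μ : ∀ s, w s ^ (2 * μ) = (Real.cosh (c s) ^ 2)⁻¹ := by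
    intro s
    simp only [hw]
    rw [← Real.rpow_mul (hch s).le, show -(1 / μ) * (2 * μ) = -2 by field_simp,
      Real.rpow_neg (hch s).le, Real.rpow_two]
  have hw2μ' : ∀ s, w s ^ (2 * μ + 2) = (Real.cosh (c s) ^ 2)⁻¹ * w s ^ 2 := fun s => by
    rw [rpow_two_mul_add_two (hwpos s).le hμ, hw2μ]
  have hfield : ∀ s, 0 ≤ s → field μ (w s) = Real.sinh (c s) / Real.cosh (c s) * w s := by
    intro s hs
    have h1 : 1 - w s ^ (2 * μ) = (Real.sinh (c s) / Real.cosh (c s)) ^ 2 := by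
      rw [hw2μ, div_pow, Real.sinh_sq]
      have := (hch s).ne'
      field_simp
    rw [field, h1, Real.sqrt_sq, mul_comm]
    exact div_nonneg (Real.sinh_nonneg_iff.2 (hcpos s hs).le) (hch s).le
  have hw0 : w 0 = x := by
    simp only [hw, hc, mul_zero, add_zero, hcosh]
    rw [← Real.rpow_mul hx.le, show -μ * -(1 / μ) = 1 by field_simp, Real.rpow_one]
  have hctop : Tendsto c atTop atTop :=
    tendsto_atTop_add_const_left _ _ (tendsto_id.const_mul_atTop (by positivity))
  have hwlim : Tendsto w atTop (𝓝 0) := by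
    have h1 : Tendsto (fun s => Real.cosh (c s)) atTop atTop := by
      have h2 : Tendsto (fun s => Real.exp (c s) / 2) atTop atTop :=
        (Real.tendsto_exp_atTop.comp hctop).atTop_div_const two_pos
      refine tendsto_atTop_mono (fun s => ?_) h2
      rw [Real.cosh_eq]
      have := Real.exp_pos (-c s)
      linarith
    exact (tendsto_rpow_neg_atTop (by positivity : 0 < 1 / μ)).comp h1
  set T₀ := Real.sinh c₀ / Real.cosh c₀
  have hT₀ : 0 < T₀ := div_pos (Real.sinh_pos_iff.2 hc₀) (Real.cosh_pos _)
  have hTmono : ∀ s, 0 ≤ s → T₀ ≤ Real.sinh (c s) / Real.cosh (c s) := by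
    intro s hs
    rw [div_le_div_iff₀ (Real.cosh_pos _) (hch s)]
    have h1 : 0 ≤ Real.sinh (c s - c₀) := Real.sinh_nonneg_iff.2 (by
      simp only [hc]; ring_nf; positivity)
    rw [Real.sinh_sub] at h1
    linarith
  have hle1 : ∀ s, (Real.cosh (c s) ^ 2)⁻¹ ≤ 1 := fun s =>
    inv_le_one_of_one_le₀ (one_le_pow₀ (Real.one_le_cosh _))
  have hTle1 : ∀ s, (Real.sinh (c s) / Real.cosh (c s)) ^ 2 ≤ 1 := fun s => by
    rw [div_pow, div_le_one (by have := hch s; positivity), Real.sinh_sq]; linarith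
  -- w² decreases to 0, so its derivative 2ww' is integrable; since sinh/cosh stays above its
  -- initial value T₀ > 0, a multiple of |2ww'| dominates w².
  have hsqi : IntegrableOn (fun s => w s ^ 2) (Ioi 0) := by
    have h1 : IntegrableOn (fun s => 2 * w s * w' s) (Ioi 0) := by
      refine integrableOn_Ioi_deriv_of_nonpos (g := fun s => w s ^ 2) (l := 0)
        (hwc.pow 2).continuousWithinAt (fun s _ => ?_) (fun s hs => ?_) ?_
      · exact ((hwd s).pow 2).congr_deriv (by norm_num)
      · have := hwpos s
        have hs0 : (0 : ℝ) < s := hs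
        have h2 : 0 ≤ Real.sinh (c s) / Real.cosh (c s) := hT₀.le.trans (hTmono s hs0.le)
        have h3 : w' s = -(√ω * (Real.sinh (c s) / Real.cosh (c s)) * w s) := by
          simp only [hw']; ring
        rw [h3, mul_neg]
        have : 0 ≤ 2 * w s * (√ω * (Real.sinh (c s) / Real.cosh (c s)) * w s) := by positivity
        linarith
      · simpa using hwlim.pow 2
    refine Integrable.mono' (h1.const_mul (-(2 * √ω * T₀)⁻¹))
      (hwc.pow 2).aestronglyMeasurable ?_
    filter_upwards [ae_restrict_mem measurableSet_Ioi] with s hs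
    have hs0 : (0 : ℝ) < s := hs
    rw [Real.norm_of_nonneg (sq_nonneg _)]
    have e : -(2 * √ω * T₀)⁻¹ * (2 * w s * w' s) =
        (Real.sinh (c s) / Real.cosh (c s)) / T₀ * w s ^ 2 := by
      simp only [hw']; field_simp
    rw [e]
    refine le_mul_of_one_le_left (sq_nonneg _) ?_
    rw [one_le_div hT₀]
    exact hTmono s hs0.le
  have hdsqi : IntegrableOn (fun s => w' s ^ 2) (Ioi 0) := by
    refine Integrable.mono' (hsqi.const_mul ω) (hw'c.pow 2).aestronglyMeasurable ?_
    refine Eventually.of_forall fun s => ?_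
    rw [Real.norm_of_nonneg (sq_nonneg _)]
    simp only [hw', mul_pow, neg_sq, Real.sq_sqrt hω.le]
    refine mul_le_mul_of_nonneg_right ?_ (sq_nonneg _)
    exact mul_le_of_le_one_right hω.le (hTle1 s)
  have hrpi : IntegrableOn (fun s => w s ^ (2 * μ + 2)) (Ioi 0) := by
    refine Integrable.mono' hsqi ?_ ?_
    · exact (hwc.rpow_const fun s => Or.inl (hwpos s).ne').aestronglyMeasurable
    · refine Eventually.of_forall fun s => ?_
      have := hwpos s
      rw [Real.norm_of_nonneg (by positivity), hw2μ']
      exact mul_le_of_le_one_left (sq_nonneg _) (hle1 s)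
  have hcomb : ∀ b : ℝ, IntegrableOn (fun s => w' s ^ 2 + ω * w s ^ 2 - b * w s ^ (2 * μ + 2))
      (Ioi 0) ∧ ∫ s in Ioi 0, (w' s ^ 2 + ω * w s ^ 2 - b * w s ^ (2 * μ + 2)) =
      (∫ s in Ioi 0, w' s ^ 2) + ω * (∫ s in Ioi 0, w s ^ 2) -
      b * (∫ s in Ioi 0, w s ^ (2 * μ + 2)) := by
    intro b
    have h1 : IntegrableOn (fun s => w' s ^ 2 + ω * w s ^ 2) (Ioi 0) :=
      hdsqi.add (hsqi.const_mul ω)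
    refine ⟨h1.sub (hrpi.const_mul b), ?_⟩
    rw [integral_sub h1 (hrpi.const_mul b), integral_add hdsqi (hsqi.const_mul ω),
      integral_const_mul, integral_const_mul]
  refine ⟨w, w', hwd, hw'c, hw0, hwpos, hsqi, hdsqi, hrpi, ?_, ?_⟩
  · rw [← (hcomb ω).2]
    have h1 : Tendsto (fun s => -(2 * √ω) * fieldInt μ (w s)) atTop (𝓝 0) := by
      have := (((continuous_fieldInt hμ).tendsto 0).comp hwlim).const_mul (-(2 * √ω))
      simpa [fieldInt] using this
    rw [integral_Ioi_of_hasDerivAt_of_tendsto (f := fun s => -(2 * √ω) * fieldInt μ (w s))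
      ((continuous_const.mul ((continuous_fieldInt hμ).comp hwc)).continuousWithinAt)
      (fun s hs => ?_) (hcomb ω).1 h1, hw0]
    · ring
    · have h2 := ((hasDerivAt_fieldInt hμ (w s)).comp s (hwd s)).const_mul (-(2 * √ω))
      refine h2.congr_deriv ?_
      have hs0 : (0 : ℝ) < s := hs
      rw [hfield s hs0.le, hw2μ']
      simp only [hw']
      have e1 : (Real.cosh (c s) ^ 2)⁻¹ = 1 - (Real.sinh (c s) / Real.cosh (c s)) ^ 2 := by
        rw [div_pow, Real.sinh_sq]
        have := (hch s).ne'
        field_simp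
        ring
      rw [e1]
      linear_combination ((Real.sinh (c s) / Real.cosh (c s)) ^ 2 * w s ^ 2) *
        Real.sq_sqrt hω.le
  · rw [← (hcomb ((μ + 1) * ω)).2]
    have hw'd : ∀ s, HasDerivAt w' (ω * w s - (μ + 1) * ω * ((Real.cosh (c s) ^ 2)⁻¹ * w s)) s := by
      intro s
      have h1 : HasDerivAt (fun s => Real.sinh (c s)) (Real.cosh (c s) * (μ * √ω)) s :=
        (Real.hasDerivAt_sinh (c s)).comp s (hcd s)
      have h2 : HasDerivAt (fun s => Real.cosh (c s)) (Real.sinh (c s) * (μ * √ω)) s :=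
        (Real.hasDerivAt_cosh (c s)).comp s (hcd s)
      have h3 := (((h1.div h2 (hch s).ne').const_mul (-√ω)).mul (hwd s))
      refine h3.congr_deriv ?_
      simp only [hw', Pi.div_apply]
      have hne := (hch s).ne'
      have hsq : ω = √ω ^ 2 := (Real.sq_sqrt hω.le).symm
      have hcs : Real.sinh (c s) ^ 2 = Real.cosh (c s) ^ 2 - 1 := Real.sinh_sq _
      field_simp
      rw [Real.sq_sqrt hω.le, hcs]
      ring
    have h1 : Tendsto (fun s => w s * w' s) atTop (𝓝 0) := by
      have h2 : Tendsto (fun s => √ω * w s ^ 2) atTop (𝓝 0) := by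
        simpa using (hwlim.pow 2).const_mul √ω
      refine squeeze_zero_norm (fun s => ?_) h2
      have : |Real.sinh (c s) / Real.cosh (c s)| ≤ 1 := by
        rw [← sq_le_one_iff_abs_le_one]; exact hTle1 s
      simp only [hw']
      rw [Real.norm_eq_abs, show w s * (-√ω * (Real.sinh (c s) / Real.cosh (c s)) * w s) =
        -(√ω * w s ^ 2 * (Real.sinh (c s) / Real.cosh (c s))) by ring, abs_neg, abs_mul,
        abs_of_nonneg (by have := hwpos s; positivity)]
      exact mul_le_of_le_one_right (by have := hwpos s; positivity) this
    rw [integral_Ioi_of_hasDerivAt_of_tendsto (f := fun s => w s * w' s)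
      (hwc.mul hw'c).continuousWithinAt (fun s _ => ?_) (hcomb ((μ + 1) * ω)).1 h1]
    · have := hfield 0 le_rfl
      rw [hw0] at this
      simp only [hw', hw0]
      rw [this]
      ring
    · have h2 := (hwd s).mul (hw'd s)
      refine h2.congr_deriv ?_
      rw [hw2μ']
      ring

/-! ### Gluing two profiles into an element of the energy space -/

lemma isWeakDerivOn_of_hasDerivAt {U : Set ℝ} {u u₁ : ℝ → ℂ}
    (hu : ∀ s, HasDerivAt u (u₁ s) s) (hu₁ : Continuous u₁) : IsWeakDerivOn U u u₁ := by
  intro φ hφ hφc hφU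
  have huc : Continuous u := continuous_iff_continuousAt.2 fun s => (hu s).continuousAt
  have hφ1 : ContDiff ℝ 1 φ := hφ.of_le (by exact_mod_cast le_top)
  have hz : ∀ s ∉ U, φ s = 0 := fun s hs => by
    by_contra h; exact hs (hφU (subset_tsupport _ h))
  have hz' : ∀ s ∉ U, deriv φ s = 0 := fun s hs => by
    by_contra h; exact hs (hφU (support_deriv_subset h))
  rw [setIntegral_eq_integral_of_forall_compl_eq_zero fun s hs => by rw [hz' s hs, zero_smul],
    setIntegral_eq_integral_of_forall_compl_eq_zero fun s hs => by rw [hz s hs, zero_smul]]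
  have hd : ∀ s, HasDerivAt φ (deriv φ s) s := fun s =>
    (hφ1.differentiable (by norm_num) s).hasDerivAt
  have i1 : Integrable fun s => deriv φ s • u s :=
    ((hφ1.continuous_deriv (by norm_num)).smul huc).integrable_of_hasCompactSupport
      (HasCompactSupport.smul_right hφc.deriv)
  have i2 : Integrable fun s => φ s • u₁ s :=
    (hφ1.continuous.smul hu₁).integrable_of_hasCompactSupport (HasCompactSupport.smul_right hφc)
  have i3 : Integrable fun s => φ s • u s :=
    (hφ1.continuous.smul huc).integrable_of_hasCompactSupport (HasCompactSupport.smul_right hφc)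
  have h0 := integral_eq_zero_of_hasDerivAt_of_integrable
    (fun s => (hd s).smul (hu s)) (i2.add i1) i3
  rw [integral_add i2 i1] at h0
  linear_combination h0

lemma IsH1On.congr_on {U : Set ℝ} (hU : MeasurableSet U) {u g u' g' : ℝ → ℂ} (h : IsH1On U u g)
    (hu : ∀ s ∈ U, u' s = u s) (hg : ∀ s ∈ U, g' s = g s) : IsH1On U u' g' := by
  have hu' : u' =ᵐ[volume.restrict U] u := (ae_restrict_mem hU).mono hu
  have hg' : g' =ᵐ[volume.restrict U] g := (ae_restrict_mem hU).mono hg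
  refine ⟨(memLp_congr_ae hu').2 h.memLp, (memLp_congr_ae hg').2 h.memLp_deriv, ?_⟩
  intro φ h1 h2 h3
  have e1 : ∫ s in U, deriv φ s • u' s = ∫ s in U, deriv φ s • u s :=
    setIntegral_congr_fun hU fun s hs => by simp only [hu s hs]
  have e2 : ∫ s in U, φ s • g' s = ∫ s in U, φ s • g s :=
    setIntegral_congr_fun hU fun s hs => by simp only [hg s hs]
  rw [e1, e2]
  exact h.isWeakDeriv φ h1 h2 h3

lemma IsProfile.isH1On {μ ω x : ℝ} {w w' : ℝ → ℝ} (h : IsProfile μ ω x w w') (m : ℝ) :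
    IsH1On (Ioi 0) (fun s => ((m * w s : ℝ) : ℂ)) (fun s => ((m * w' s : ℝ) : ℂ)) := by
  have hwc : Continuous w := continuous_iff_continuousAt.2 fun s => (h.hasDerivAt s).continuousAt
  have hc1 : Continuous fun s => ((m * w s : ℝ) : ℂ) := by fun_prop
  have hc2 : Continuous fun s => ((m * w' s : ℝ) : ℂ) :=
    Complex.continuous_ofReal.comp (continuous_const.mul h.continuous_deriv)
  refine ⟨?_, ?_, ?_⟩
  · rw [memLp_two_iff_integrable_sq_norm hc1.aestronglyMeasurable]
    simp only [Complex.norm_real, Real.norm_eq_abs, sq_abs, mul_pow]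
    exact h.integrableOn_sq.const_mul _
  · rw [memLp_two_iff_integrable_sq_norm hc2.aestronglyMeasurable]
    simp only [Complex.norm_real, Real.norm_eq_abs, sq_abs, mul_pow]
    exact h.integrableOn_deriv_sq.const_mul _
  · exact isWeakDerivOn_of_hasDerivAt (fun s => ((h.hasDerivAt s).const_mul m).ofReal_comp) hc2

lemma IsProfile.continuous {μ ω x : ℝ} {w w' : ℝ → ℝ} (h : IsProfile μ ω x w w') :
    Continuous w := continuous_iff_continuousAt.2 fun s => (h.hasDerivAt s).continuousAt

/-- The function equal to `m u` on the right half-line and to the odd reflection of `m w` on the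
left half-line. -/
noncomputable def pairedState {μ ω x y : ℝ} {u u' w w' : ℝ → ℝ} (hu : IsProfile μ ω x u u')
    (hw : IsProfile μ ω y w w') (m : ℝ) : EnergySpace where
  toFun s := if 0 < s then ((m * u s : ℝ) : ℂ) else ((-(m * w (-s)) : ℝ) : ℂ)
  weakDeriv s := if 0 < s then ((m * u' s : ℝ) : ℂ) else ((m * w' (-s) : ℝ) : ℂ)
  valRight := ((m * x : ℝ) : ℂ)
  valLeft := ((-(m * y) : ℝ) : ℂ)
  isH1_right := (hu.isH1On m).congr_on measurableSet_Ioi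
    (fun s hs => if_pos hs) (fun s hs => if_pos hs)
  isH1_left := by
    have h1 : IsH1On (Iio 0) (fun s => ((-(m * w (-s)) : ℝ) : ℂ))
        (fun s => ((m * w' (-s) : ℝ) : ℂ)) := by
      have hmp : MeasurePreserving (fun x : ℝ => -x) (volume.restrict (Iio 0))
          (volume.restrict (Ioi 0)) := by
        have := (Measure.measurePreserving_neg (volume : Measure ℝ)).restrict_preimage
          (measurableSet_Ioi (a := (0 : ℝ)))
        simpa using this
      have h0 := hw.isH1On m
      refine ⟨?_, ?_, ?_⟩
      · have := (h0.memLp.comp_measurePreserving hmp).neg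
        refine (memLp_congr_ae (Eventually.of_forall fun s => ?_)).1 this
        simp
      · exact h0.memLp_deriv.comp_measurePreserving hmp
      · refine isWeakDerivOn_of_hasDerivAt (fun s => ?_) ?_
        · have h2 := (((hw.hasDerivAt (-s)).comp s (hasDerivAt_neg s)).const_mul m).neg
          have h3 : HasDerivAt (fun s => -(m * w (-s))) (m * w' (-s)) s :=
            h2.congr_deriv (by ring)
          exact h3.ofReal_comp
        · have := hw.continuous_deriv
          fun_prop
    exact h1.congr_on measurableSet_Iio (fun s hs => if_neg (not_lt.2 (le_of_lt hs)))
      (fun s hs => if_neg (not_lt.2 (le_of_lt hs)))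
  isRightTrace := by
    refine ⟨fun s => ((m * u s : ℝ) : ℂ), ?_, ?_, by simp only [hu.val_zero]⟩
    · have := hu.continuous
      fun_prop
    · filter_upwards [ae_restrict_mem measurableSet_Ioi] with s hs
      exact (if_pos hs).symm
  isLeftTrace := by
    refine ⟨fun s => ((-(m * w (-s)) : ℝ) : ℂ), ?_, ?_, by simp only [neg_zero, hw.val_zero]⟩
    · have := hw.continuous
      fun_prop
    · filter_upwards [ae_restrict_mem measurableSet_Iio] with s hs
      exact (if_neg (not_lt.2 (le_of_lt hs))).symm

section pairedState

variable {μ ω x y : ℝ} {u u' w w' : ℝ → ℝ} (hu : IsProfile μ ω x u u')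
  (hw : IsProfile μ ω y w w') (m : ℝ)

lemma integral_comp_pair {a b : ℝ → ℂ} (f : ℂ → ℝ) {p q : ℝ → ℝ}
    (hp : ∀ s, f (a s) = p s) (hq : ∀ s, f (b (-s)) = q s) (ip : IntegrableOn p (Ioi 0))
    (iq : IntegrableOn q (Ioi 0)) :
    ∫ s, f (if 0 < s then a s else b s) = (∫ s in Ioi 0, p s) + ∫ s in Ioi 0, q s := by
  have e1 : ∀ s ∈ Ioi (0 : ℝ), f (if 0 < s then a s else b s) = p s := fun s hs => by
    rw [if_pos (show (0 : ℝ) < s from hs), hp]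
  have e2 : ∀ s ∈ Ioi (0 : ℝ), f (if 0 < -s then a (-s) else b (-s)) = q s := fun s hs => by
    rw [if_neg (not_lt.2 (by have : (0 : ℝ) < s := hs; linarith)), hq]
  rw [integral_eq_add_comp_neg (f := fun s => f (if 0 < s then a s else b s))
    ((integrableOn_congr_fun e1 measurableSet_Ioi).2 ip)
    ((integrableOn_congr_fun e2 measurableSet_Ioi).2 iq),
    setIntegral_congr_fun measurableSet_Ioi e1, setIntegral_congr_fun measurableSet_Ioi e2]

lemma pairedState_integral_deriv_sq :
    ∫ s, ‖(pairedState hu hw m).weakDeriv s‖ ^ 2 =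
      m ^ 2 * ((∫ s in Ioi 0, u' s ^ 2) + ∫ s in Ioi 0, w' s ^ 2) := by
  rw [mul_add, ← integral_const_mul, ← integral_const_mul]
  refine integral_comp_pair (fun z => ‖z‖ ^ 2) (fun s => ?_) (fun s => ?_)
    (hu.integrableOn_deriv_sq.const_mul _) (hw.integrableOn_deriv_sq.const_mul _)
  · simp only [Complex.norm_real, Real.norm_eq_abs, sq_abs, mul_pow]
  · simp only [neg_neg, Complex.norm_real, Real.norm_eq_abs, sq_abs, mul_pow]

lemma pairedState_integral_sq :
    ∫ s, ‖(pairedState hu hw m).toFun s‖ ^ 2 =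
      m ^ 2 * ((∫ s in Ioi 0, u s ^ 2) + ∫ s in Ioi 0, w s ^ 2) := by
  rw [mul_add, ← integral_const_mul, ← integral_const_mul]
  refine integral_comp_pair (fun z => ‖z‖ ^ 2) (fun s => ?_) (fun s => ?_)
    (hu.integrableOn_sq.const_mul _) (hw.integrableOn_sq.const_mul _)
  · simp only [Complex.norm_real, Real.norm_eq_abs, sq_abs, mul_pow]
  · simp only [neg_neg, Complex.norm_real, Real.norm_eq_abs, sq_abs, mul_pow, neg_sq]

lemma pairedState_integral_rpow (hm : 0 < m) :
    ∫ s, ‖(pairedState hu hw m).toFun s‖ ^ (2 * μ + 2) =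
      m ^ (2 * μ + 2) *
        ((∫ s in Ioi 0, u s ^ (2 * μ + 2)) + ∫ s in Ioi 0, w s ^ (2 * μ + 2)) := by
  rw [mul_add, ← integral_const_mul, ← integral_const_mul]
  refine integral_comp_pair (fun z => ‖z‖ ^ (2 * μ + 2)) (fun s => ?_) (fun s => ?_)
    (hu.integrableOn_rpow.const_mul _) (hw.integrableOn_rpow.const_mul _)
  · rw [Complex.norm_real, Real.norm_of_nonneg (mul_pos hm (hu.pos s)).le,
      Real.mul_rpow hm.le (hu.pos s).le]
  · rw [neg_neg, Complex.norm_real, norm_neg, Real.norm_of_nonneg (mul_pos hm (hw.pos s)).le,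
      Real.mul_rpow hm.le (hw.pos s).le]

lemma pairedState_norm_jump_sq :
    ‖(pairedState hu hw m).valRight - (pairedState hu hw m).valLeft‖ ^ 2 =
      m ^ 2 * (x + y) ^ 2 := by
  have : (pairedState hu hw m).valRight - (pairedState hu hw m).valLeft =
      ((m * (x + y) : ℝ) : ℂ) := by
    simp only [pairedState]
    push_cast
    ring
  rw [this, Complex.norm_real, Real.norm_eq_abs, sq_abs, mul_pow]

lemma pairedState_ne_zero (hm : 0 < m) : ¬ (pairedState hu hw m).toFun =ᵐ[volume] 0 := by
  intro h
  have h1 : ∀ᵐ s ∂(volume : Measure ℝ), s ∉ Ioo (0 : ℝ) 1 := by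
    filter_upwards [h] with s hs hs'
    simp only [pairedState, if_pos hs'.1, Pi.zero_apply, Complex.ofReal_eq_zero] at hs
    exact (mul_pos hm (hu.pos s)).ne' hs
  have h2 := (measure_eq_zero_iff_ae_notMem (μ := (volume : Measure ℝ)) (s := Ioo (0 : ℝ) 1)).2 h1
  simp at h2

end pairedState

/-- The pair of boundary values of a stationary state, rescaled. -/
structure IsCritical (μ k x y : ℝ) : Prop where
  left_mem : x ∈ Ioo (0 : ℝ) 1
  right_mem : y ∈ Ioo (0 : ℝ) 1
  field_left : field μ x = (x + y) / k
  field_right : field μ y = (x + y) / k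

/-- The sign flip on the left half-line makes the jump equal to m(x + y). Criticality is what lets
the two boundary contributions x · `field μ x` and y · `field μ y` cancel the jump term in the
Nehari functional. -/
lemma IsCritical.exists_state {γ lam μ ω x y : ℝ} (hγ : 0 < γ) (hlam : 0 < lam) (hμ : 0 < μ)
    (hω : 0 < ω) (h : IsCritical μ (γ * √ω) x y) :
    ∃ ψ : EnergySpace, ¬ ψ.toFun =ᵐ[volume] 0 ∧ nehari γ lam μ ω ψ = 0 ∧
      √ω * amplitude lam μ ω ^ 2 * reduced μ (γ * √ω) x y = action γ lam μ ω ψ := by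
  obtain ⟨u, u', hu⟩ := exists_isProfile hμ hω h.left_mem.1 h.left_mem.2
  obtain ⟨w, w', hw⟩ := exists_isProfile hμ hω h.right_mem.1 h.right_mem.2
  have hm := amplitude_pos hlam hμ hω
  have hmr := amplitude_rpow hlam hμ hω
  have hsω : 0 < √ω := Real.sqrt_pos.2 hω
  set m := amplitude lam μ ω
  have a1 := hu.action_eq
  have a2 := hw.action_eq
  have n1 := hu.nehari_eq
  have n2 := hw.nehari_eq
  rw [h.field_left] at n1
  rw [h.field_right] at n2
  refine ⟨pairedState hu hw m, pairedState_ne_zero hu hw m hm, ?_, ?_⟩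
  · unfold nehari
    rw [pairedState_integral_deriv_sq, pairedState_integral_sq,
      pairedState_integral_rpow hu hw m hm, pairedState_norm_jump_sq,
      rpow_two_mul_add_two hm.le hμ]
    have e : √ω * (x * ((x + y) / (γ * √ω))) + √ω * (y * ((x + y) / (γ * √ω))) =
        1 / γ * (x + y) ^ 2 := by
      field_simp
    linear_combination m ^ 2 * (n1 + n2 + e) - m ^ 2 *
      ((∫ s in Ioi 0, u s ^ (2 * μ + 2)) + ∫ s in Ioi 0, w s ^ (2 * μ + 2)) * hmr
  · unfold action reduced
    rw [pairedState_integral_deriv_sq, pairedState_integral_sq,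
      pairedState_integral_rpow hu hw m hm, pairedState_norm_jump_sq,
      rpow_two_mul_add_two hm.le hμ]
    have e : √ω * ((x + y) ^ 2 / (2 * (γ * √ω))) = 1 / (2 * γ) * (x + y) ^ 2 := by
      field_simp
    have e2 : lam / (2 * μ + 2) * m ^ (2 * μ) = ω / 2 := by
      rw [div_mul_eq_mul_div, hmr]; field_simp
    linear_combination (-m ^ 2 / 2) * (a1 + a2) - m ^ 2 * e + m ^ 2 *
      ((∫ s in Ioi 0, u s ^ (2 * μ + 2)) + ∫ s in Ioi 0, w s ^ (2 * μ + 2)) * e2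

/-- The reduced action at `(x, y)` is at most its supremum along each ray of the unit square. -/
def IsRayMinimax (μ k x y : ℝ) : Prop :=
  ∀ A B c : ℝ, 0 ≤ A → 0 ≤ B → 0 < max A B →
    (∀ t, 0 ≤ t → t * A ≤ 1 → t * B ≤ 1 → reduced μ k (t * A) (t * B) ≤ c) →
      reduced μ k x y ≤ c

/-- The glued profiles attain the value, and `exists_reduced_le_action` combined with the ray
condition bounds every competitor from below by it. -/
lemma groundAction_eq {γ lam μ ω x y : ℝ} (hγ : 0 < γ) (hlam : 0 < lam) (hμ : 0 < μ)
    (hω : 0 < ω) (h : IsCritical μ (γ * √ω) x y) (hmin : IsRayMinimax μ (γ * √ω) x y) :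
    groundAction γ lam μ ω = √ω * amplitude lam μ ω ^ 2 * reduced μ (γ * √ω) x y := by
  refine IsLeast.csInf_eq ⟨h.exists_state hγ hlam hμ hω, ?_⟩
  rintro s ⟨ψ, hne, hN, rfl⟩
  obtain ⟨A, B, hA, hB, hAB, hle⟩ := exists_reduced_le_action hγ hlam hμ hω ψ hne hN
  have hpos : 0 < √ω * amplitude lam μ ω ^ 2 :=
    mul_pos (Real.sqrt_pos.2 hω) (pow_pos (amplitude_pos hlam hμ hω) 2)
  rw [mul_comm, ← le_div_iff₀ hpos]
  refine hmin A B _ hA hB hAB fun t ht htA htB => ?_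
  rw [le_div_iff₀ hpos, mul_comm]
  exact hle t ht htA htB

/-! ### The function `x coth x` -/

/-- Its convexity and monotonicity are inherited by m ↦ m coth(mz), whose difference quotients make
up all the rates along the asymmetric branch. -/
noncomputable def xcoth (x : ℝ) : ℝ := x * Real.cosh x / Real.sinh x

lemma sinh_lt_mul_cosh {x : ℝ} (hx : 0 < x) : Real.sinh x < x * Real.cosh x := by
  have hd : ∀ t : ℝ, HasDerivAt (fun t => t * Real.cosh t - Real.sinh t) (t * Real.sinh t) t :=
    fun t => (((hasDerivAt_id t).mul (Real.hasDerivAt_cosh t)).sub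
      (Real.hasDerivAt_sinh t)).congr_deriv (by simp)
  have hm : StrictMonoOn (fun t => t * Real.cosh t - Real.sinh t) (Ici 0) := by
    refine strictMonoOn_of_deriv_pos (convex_Ici 0) (by fun_prop) fun t ht => ?_
    rw [interior_Ici] at ht
    rw [(hd t).deriv]
    exact mul_pos ht (Real.sinh_pos_iff.2 ht)
  have := hm (mem_Ici.2 le_rfl) (mem_Ici.2 hx.le) hx
  simp only [Real.sinh_zero, zero_mul, sub_zero] at this
  linarith

lemma hasDerivAt_xcoth {x : ℝ} (hx : 0 < x) :
    HasDerivAt xcoth ((Real.cosh x * Real.sinh x - x) / Real.sinh x ^ 2) x := by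
  have hs := Real.sinh_pos_iff.2 hx
  refine ((((hasDerivAt_id x).mul (Real.hasDerivAt_cosh x)).div (Real.hasDerivAt_sinh x)
    hs.ne')).congr_deriv ?_
  simp only [id, Pi.mul_apply]
  have := Real.cosh_sq x
  congr 1
  linear_combination (-x) * this

lemma hasDerivAt_deriv_xcoth {x : ℝ} (hx : 0 < x) :
    HasDerivAt (fun x => (Real.cosh x * Real.sinh x - x) / Real.sinh x ^ 2)
      (2 * (x * Real.cosh x - Real.sinh x) / Real.sinh x ^ 3) x := by
  have hs := Real.sinh_pos_iff.2 hx
  refine ((((Real.hasDerivAt_cosh x).mul (Real.hasDerivAt_sinh x)).sub (hasDerivAt_id x)).div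
    ((Real.hasDerivAt_sinh x).pow 2) (pow_ne_zero 2 hs.ne')).congr_deriv ?_
  simp only [id, Pi.mul_apply, Pi.sub_apply, Pi.pow_apply]
  have := Real.cosh_sq x
  field_simp
  simp only [Nat.add_one_sub_one, pow_one, Nat.cast_ofNat]
  linear_combination (-Real.sinh x ^ 2) * this

lemma continuousOn_xcoth : ContinuousOn xcoth (Ioi 0) := fun _ hx =>
  (hasDerivAt_xcoth hx).continuousAt.continuousWithinAt

lemma strictConvexOn_xcoth : StrictConvexOn ℝ (Ioi 0) xcoth := by
  refine StrictMonoOn.strictConvexOn_of_deriv (convex_Ioi 0) continuousOn_xcoth ?_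
  rw [interior_Ioi]
  have h1 : StrictMonoOn (fun x => (Real.cosh x * Real.sinh x - x) / Real.sinh x ^ 2) (Ioi 0) := by
    refine strictMonoOn_of_deriv_pos (convex_Ioi 0)
      (fun x hx => (hasDerivAt_deriv_xcoth hx).continuousAt.continuousWithinAt) fun x hx => ?_
    rw [interior_Ioi] at hx
    rw [(hasDerivAt_deriv_xcoth hx).deriv]
    have := Real.sinh_pos_iff.2 hx
    have := sinh_lt_mul_cosh hx
    exact div_pos (by linarith) (by positivity)
  exact h1.congr fun x hx => ((hasDerivAt_xcoth hx).deriv).symm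

lemma strictMonoOn_xcoth : StrictMonoOn xcoth (Ioi 0) := by
  refine strictMonoOn_of_deriv_pos (convex_Ioi 0) continuousOn_xcoth fun x hx => ?_
  rw [interior_Ioi] at hx
  rw [(hasDerivAt_xcoth hx).deriv]
  have hx : 0 < x := hx
  have h1 := Real.sinh_pos_iff.2 hx
  have h2 := Real.self_lt_sinh_iff.2 hx
  have h3 := Real.one_le_cosh x
  exact div_pos (by nlinarith) (by positivity)

/-- The derivative of `xcoth` is at most 1: after clearing sinh² this is 1 - e^{-2x} ≤ 2x. -/
lemma antitoneOn_xcoth_sub : AntitoneOn (fun x => xcoth x - x) (Ioi 0) := by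
  have hd : ∀ x ∈ Ioi (0 : ℝ), HasDerivAt (fun x => xcoth x - x)
      ((Real.cosh x * Real.sinh x - x) / Real.sinh x ^ 2 - 1) x := fun x hx =>
    (hasDerivAt_xcoth hx).sub (hasDerivAt_id x)
  refine antitoneOn_of_deriv_nonpos (convex_Ioi 0)
    (fun x hx => (hd x hx).continuousAt.continuousWithinAt)
    (fun x hx => ?_) fun x hx => ?_
  · rw [interior_Ioi] at hx
    exact (hd x hx).differentiableAt.differentiableWithinAt
  · rw [interior_Ioi] at hx
    rw [(hd x hx).deriv, sub_nonpos]
    have h1 := Real.sinh_pos_iff.2 hx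
    rw [div_le_one (by positivity)]
    have h2 := Real.add_one_le_exp (-(2 * x))
    have h3 : Real.exp (-(2 * x)) = Real.exp (-x) ^ 2 := by
      rw [← Real.exp_nat_mul]; push_cast; ring_nf
    have h4 : Real.exp x * Real.exp (-x) = 1 := by rw [← Real.exp_add]; simp
    rw [Real.cosh_eq, Real.sinh_eq]
    nlinarith

lemma tendsto_sinh_div_self : Tendsto (fun x : ℝ => Real.sinh x / x) (𝓝[>] 0) (𝓝 1) := by
  have h := (Real.hasDerivAt_sinh 0).tendsto_slope
  rw [Real.cosh_zero] at h
  refine (h.mono_left (nhdsWithin_mono _ fun x (hx : 0 < x) => hx.ne')).congr fun x => ?_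
  simp [slope_def_field]

lemma tendsto_xcoth_sub_one_div_sq :
    Tendsto (fun x => (xcoth x - 1) / x ^ 2) (𝓝[>] 0) (𝓝 (1 / 3)) := by
  have h1 : Tendsto (fun x : ℝ => (x * Real.cosh x - Real.sinh x) / x ^ 3) (𝓝[>] 0)
      (𝓝 (1 / 3)) := by
    refine HasDerivAt.lhopital_zero_nhdsGT (f' := fun x => x * Real.sinh x)
      (g' := fun x => 3 * x ^ 2) ?_ ?_ ?_ ?_ ?_ ?_
    · exact Eventually.of_forall fun t => (((hasDerivAt_id t).mul (Real.hasDerivAt_cosh t)).sub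
        (Real.hasDerivAt_sinh t)).congr_deriv (by simp)
    · exact Eventually.of_forall fun t => (hasDerivAt_pow 3 t).congr_deriv (by norm_num)
    · filter_upwards [self_mem_nhdsWithin] with x hx
      have hx : (0 : ℝ) < x := hx
      positivity
    · have : Continuous fun x : ℝ => x * Real.cosh x - Real.sinh x := by fun_prop
      simpa using (this.tendsto 0).mono_left nhdsWithin_le_nhds
    · have : Continuous fun x : ℝ => x ^ 3 := by fun_prop
      simpa using (this.tendsto 0).mono_left nhdsWithin_le_nhds
    · have := tendsto_sinh_div_self.div_const 3
      refine this.congr' ?_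
      filter_upwards [self_mem_nhdsWithin] with x hx
      have hx : (0 : ℝ) < x := hx
      field_simp
  have h2 := h1.div tendsto_sinh_div_self one_ne_zero
  rw [div_one] at h2
  refine h2.congr' ?_
  filter_upwards [self_mem_nhdsWithin] with x hx
  have hx : (0 : ℝ) < x := hx
  have hs := Real.sinh_pos_iff.2 hx
  simp only [Pi.div_apply, xcoth]
  field_simp

/-- The logarithmic derivative of `z ↦ sinh (m z)`. -/
noncomputable def mcoth (m z : ℝ) : ℝ := m * Real.cosh (m * z) / Real.sinh (m * z)

lemma xcoth_mul {m z : ℝ} : xcoth (m * z) = z * mcoth m z := by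
  unfold xcoth mcoth; ring

lemma mcoth_sub_mcoth {m n z : ℝ} (hz : 0 < z) :
    mcoth m z - mcoth n z = (xcoth (m * z) - xcoth (n * z)) / z := by
  rw [xcoth_mul, xcoth_mul]; field_simp

lemma mcoth_lt {m n z : ℝ} (hm : 0 < m) (hmn : m < n) (hz : 0 < z) : mcoth m z < mcoth n z := by
  rw [← sub_pos, mcoth_sub_mcoth hz]
  refine div_pos (sub_pos.2 ?_) hz
  exact strictMonoOn_xcoth (mem_Ioi.2 (mul_pos hm hz)) (mem_Ioi.2 (mul_pos (hm.trans hmn) hz))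
    (mul_lt_mul_of_pos_right hmn hz)

lemma mcoth_sub_le {m n z : ℝ} (hm : 0 < m) (hmn : m ≤ n) (hz : 0 < z) :
    mcoth n z - mcoth m z ≤ n - m := by
  rw [mcoth_sub_mcoth hz, div_le_iff₀ hz]
  have := antitoneOn_xcoth_sub (mem_Ioi.2 (mul_pos hm hz))
    (mem_Ioi.2 (mul_pos (hm.trans_le hmn) hz)) (mul_le_mul_of_nonneg_right hmn hz.le)
  simp only at this
  linarith

lemma mcoth_secant_mono {l m n z : ℝ} (hl : 0 < l) (hm : 0 < m) (hn : 0 < n) (hz : 0 < z)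
    (hml : m ≠ l) (hnl : n ≠ l) (hmn : m ≤ n) :
    (mcoth m z - mcoth l z) / (m - l) ≤ (mcoth n z - mcoth l z) / (n - l) := by
  have h := strictConvexOn_xcoth.convexOn.secant_mono (a := l * z) (x := m * z) (y := n * z)
    (mem_Ioi.2 (mul_pos hl hz)) (mem_Ioi.2 (mul_pos hm hz)) (mem_Ioi.2 (mul_pos hn hz))
    (fun h => hml (mul_right_cancel₀ hz.ne' h)) (fun h => hnl (mul_right_cancel₀ hz.ne' h))
    (mul_le_mul_of_nonneg_right hmn hz.le)
  rw [mcoth_sub_mcoth hz, mcoth_sub_mcoth hz, div_div, div_div, mul_sub, mul_sub]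
  simpa only [mul_comm z] using h

lemma mcoth_slope_lt {l m n z : ℝ} (hl : 0 < l) (hlm : l < m) (hmn : m < n) (hz : 0 < z) :
    (mcoth m z - mcoth l z) / (m - l) < (mcoth n z - mcoth m z) / (n - m) := by
  have h := strictConvexOn_xcoth.slope_strict_mono_adjacent (x := l * z) (y := m * z) (z := n * z)
    (mem_Ioi.2 (mul_pos hl hz)) (mem_Ioi.2 (mul_pos (hl.trans (hlm.trans hmn)) hz))
    (mul_lt_mul_of_pos_right hlm hz) (mul_lt_mul_of_pos_right hmn hz)
  rw [mcoth_sub_mcoth hz, mcoth_sub_mcoth hz, div_div, div_div, mul_sub, mul_sub]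
  simpa only [mul_comm z] using h

/-! ### The two logarithmic derivatives along the asymmetric branch -/

/-- Minus the logarithmic derivative of the jump along the asymmetric branch. -/
noncomputable def jumpRate (μ z : ℝ) : ℝ :=
  ((mcoth (μ + 1) z - mcoth 1 z) / μ - Real.tanh (z / 2)) / 2

/-- The logarithmic derivative of `k` along the asymmetric branch. -/
noncomputable def paramRate (μ z : ℝ) : ℝ :=
  (Real.tanh (z / 2) + mcoth (μ + 1) z - mcoth μ z) / 2

lemma sinh_eq_half (z : ℝ) : Real.sinh z = 2 * Real.sinh (z / 2) * Real.cosh (z / 2) := by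
  rw [← Real.sinh_two_mul]; congr 1; ring

lemma cosh_eq_half (z : ℝ) : Real.cosh z = 1 + 2 * Real.sinh (z / 2) ^ 2 := by
  have h := Real.cosh_two_mul (z / 2)
  rw [show 2 * (z / 2) = z by ring, Real.cosh_sq] at h
  linarith

lemma tanh_pos_of_pos {z : ℝ} (hz : 0 < z) : 0 < Real.tanh z := by
  rw [Real.tanh_eq_sinh_div_cosh]
  exact div_pos (Real.sinh_pos_iff.2 hz) (Real.cosh_pos z)

lemma tanh_le_two_mul_tanh_half {z : ℝ} (hz : 0 < z) :
    Real.tanh z ≤ 2 * Real.tanh (z / 2) := by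
  have hs := Real.sinh_pos_iff.2 (half_pos hz)
  have hc := Real.cosh_pos (z / 2)
  have hcs := Real.cosh_sq (z / 2)
  rw [Real.tanh_eq_sinh_div_cosh, Real.tanh_eq_sinh_div_cosh, sinh_eq_half z,
    cosh_eq_half z,
    mul_div_assoc', div_le_div_iff₀ (by positivity) hc]
  nlinarith [mul_pos hs (pow_pos hs 2)]

/-- Exhibits tanh(z/2) as a slope of the convex function m ↦ `mcoth m z`, so that convexity can
compare it with the other slopes. -/
lemma mcoth_one_sub_half {z : ℝ} (hz : 0 < z) :
    (mcoth 1 z - mcoth (1 / 2) z) / (1 - 1 / 2) = Real.tanh (z / 2) := by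
  have hs := Real.sinh_pos_iff.2 (half_pos hz)
  have hc := Real.cosh_pos (z / 2)
  have hcs := Real.cosh_sq (z / 2)
  unfold mcoth
  rw [one_mul, one_mul, show 1 / 2 * z = z / 2 by ring, Real.tanh_eq_sinh_div_cosh, sinh_eq_half,
    cosh_eq_half]
  field_simp
  rw [hcs]
  ring

/-- By strict convexity the slope of m ↦ `mcoth m z` over [1, μ+1] exceeds its slope over [1/2, 1],
which is tanh(z/2). -/
lemma jumpRate_pos {μ z : ℝ} (hμ : 0 < μ) (hz : 0 < z) : 0 < jumpRate μ z := by
  have h := mcoth_slope_lt (l := 1 / 2) (m := 1) (n := μ + 1) (by norm_num) (by norm_num)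
    (by linarith) hz
  rw [mcoth_one_sub_half hz, add_sub_cancel_right] at h
  unfold jumpRate
  linarith

lemma paramRate_pos {μ z : ℝ} (hμ : 0 < μ) (hz : 0 < z) : 0 < paramRate μ z := by
  have h1 := tanh_pos_of_pos (half_pos hz)
  have h2 := mcoth_lt hμ (lt_add_one μ) hz
  unfold paramRate
  linarith

lemma mcoth_two_sub_one {z : ℝ} (hz : 0 < z) : mcoth 2 z - mcoth 1 z = Real.tanh z := by
  have hs := Real.sinh_pos_iff.2 hz
  have hc := Real.cosh_pos z
  have hcs := Real.cosh_sq z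
  unfold mcoth
  rw [one_mul, one_mul, Real.tanh_eq_sinh_div_cosh, Real.sinh_two_mul, Real.cosh_two_mul]
  field_simp
  ring

lemma mcoth_three_sub_one_le {z : ℝ} (hz : 0 < z) :
    mcoth 3 z - mcoth 1 z ≤ 8 / 3 * Real.tanh z := by
  have hs := Real.sinh_pos_iff.2 hz
  have hc := Real.cosh_pos z
  have hcs := Real.cosh_sq z
  unfold mcoth
  rw [one_mul, one_mul, Real.tanh_eq_sinh_div_cosh, Real.sinh_three_mul, Real.cosh_three_mul]
  have e : 3 * (4 * Real.cosh z ^ 3 - 3 * Real.cosh z) / (4 * Real.sinh z ^ 3 + 3 * Real.sinh z) -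
      Real.cosh z / Real.sinh z = 8 * Real.sinh z * Real.cosh z / (4 * Real.sinh z ^ 2 + 3) := by
    rw [show 4 * Real.sinh z ^ 3 + 3 * Real.sinh z = Real.sinh z * (4 * Real.sinh z ^ 2 + 3) by
      ring, show 4 * Real.cosh z ^ 3 - 3 * Real.cosh z = Real.cosh z * (4 * Real.cosh z ^ 2 - 3)
      by ring, hcs]
    field_simp
    ring
  rw [e, mul_div_assoc', div_le_div_iff₀ (by positivity) hc]
  have : 8 * Real.sinh z * Real.cosh z * Real.cosh z = 8 * Real.sinh z * (Real.sinh z ^ 2 + 1) := by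
    rw [← hcs]; ring
  rw [this]
  nlinarith [pow_pos hs 3]

/-- This is what keeps 1/μ - 1/4 + R/4 positive on the asymmetric branch, where R = -2
`jumpRate`/`paramRate`. The slope over [1, μ+1] is compared by convexity with slopes having integer
endpoints, over [1, 2] if μ ≤ 1 and over [1, 3] otherwise, where it is controlled by tanh z ≤ 2
tanh(z/2). -/
lemma jumpRate_lt {μ z : ℝ} (hμ : 0 < μ) (hμ2 : μ ≤ 2) (hz : 0 < z) :
    jumpRate μ z < paramRate μ z * (2 / μ - 1 / 2) := by
  have hT := tanh_pos_of_pos (half_pos hz)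
  have hT2 := tanh_le_two_mul_tanh_half hz
  have hB := paramRate_pos hμ hz
  rcases le_or_gt μ 1 with h1 | h1
  · have h2 : (3 : ℝ) / 2 ≤ 2 / μ - 1 / 2 := by
      have : (2 : ℝ) ≤ 2 / μ := by rw [le_div_iff₀ hμ]; linarith
      linarith
    refine lt_of_lt_of_le ?_ (mul_le_mul_of_nonneg_left h2 hB.le)
    have h3 := mcoth_secant_mono (l := 1) (m := μ + 1) (n := 2) one_pos (by linarith) two_pos hz
      (by linarith) (by norm_num) (by linarith)
    rw [add_sub_cancel_right, mcoth_two_sub_one hz] at h3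
    have h4 := mcoth_lt hμ (lt_add_one μ) hz
    unfold jumpRate paramRate
    norm_num at h3
    linarith
  · have h2 : (1 : ℝ) / 2 ≤ 2 / μ - 1 / 2 := by
      have : (1 : ℝ) ≤ 2 / μ := by rw [le_div_iff₀ hμ]; linarith
      linarith
    refine lt_of_lt_of_le ?_ (mul_le_mul_of_nonneg_left h2 hB.le)
    have h3 := mcoth_secant_mono (l := 1) (m := μ + 1) (n := 3) one_pos (by linarith) three_pos hz
      (by linarith) (by norm_num) (by linarith)
    have h4 := mcoth_three_sub_one_le hz
    -- Let S be the slope over [1, μ+1], Δ the slope over [μ, μ+1] and T = tanh(z/2). With the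
    -- factor 1/2 the claim reads 2S < 3T + Δ; it follows by adding S ≤ Δ, proved here, to S ≤ 8T/3
    -- < 3T.
    have h5 := mcoth_secant_mono (l := μ + 1) (m := 1) (n := μ) (by linarith) one_pos hμ hz
      (by linarith) (by linarith) h1.le
    have e1 : (mcoth 1 z - mcoth (μ + 1) z) / (1 - (μ + 1)) =
        (mcoth (μ + 1) z - mcoth 1 z) / μ := by
      rw [show (1 : ℝ) - (μ + 1) = -μ by ring, div_neg, ← neg_div, neg_sub]
    have e2 : (mcoth μ z - mcoth (μ + 1) z) / (μ - (μ + 1)) =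
        mcoth (μ + 1) z - mcoth μ z := by
      rw [show μ - (μ + 1) = (-1 : ℝ) by ring, div_neg, ← neg_div, neg_sub, div_one]
    rw [e1, e2] at h5
    rw [add_sub_cancel_right, show (3 : ℝ) - 1 = 2 by norm_num] at h3
    have h6 := tanh_pos_of_pos hz
    unfold jumpRate paramRate
    linarith

lemma tendsto_mcoth_sub_div {m n : ℝ} (hm : 0 < m) (hn : 0 < n) :
    Tendsto (fun z => (mcoth m z - mcoth n z) / z) (𝓝[>] 0) (𝓝 ((m ^ 2 - n ^ 2) / 3)) := by
  have h : ∀ m : ℝ, 0 < m → Tendsto (fun z => (xcoth (m * z) - 1) / z ^ 2) (𝓝[>] 0)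
      (𝓝 (m ^ 2 / 3)) := by
    intro m hm
    have h1 : Tendsto (fun z : ℝ => m * z) (𝓝[>] 0) (𝓝[>] 0) := by
      refine tendsto_nhdsWithin_iff.2 ⟨?_, ?_⟩
      · have : Continuous fun z : ℝ => m * z := by fun_prop
        simpa using (this.tendsto 0).mono_left nhdsWithin_le_nhds
      · filter_upwards [self_mem_nhdsWithin] with z hz
        exact mul_pos hm hz
    have h2 := (tendsto_xcoth_sub_one_div_sq.comp h1).const_mul (m ^ 2)
    rw [show m ^ 2 * (1 / 3) = m ^ 2 / 3 by ring] at h2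
    refine h2.congr' ?_
    filter_upwards [self_mem_nhdsWithin] with z hz
    have hz : (0 : ℝ) < z := hz
    simp only [Function.comp]
    field_simp
  have h3 := (h m hm).sub (h n hn)
  rw [← sub_div] at h3
  refine h3.congr' ?_
  filter_upwards [self_mem_nhdsWithin] with z hz
  have hz : (0 : ℝ) < z := hz
  rw [mcoth_sub_mcoth hz]
  field_simp
  ring

lemma tendsto_tanh_half_div : Tendsto (fun z : ℝ => Real.tanh (z / 2) / z) (𝓝[>] 0)
    (𝓝 (1 / 2)) := by
  have h1 : Tendsto (fun z : ℝ => z / 2) (𝓝[>] 0) (𝓝[>] 0) := by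
    refine tendsto_nhdsWithin_iff.2 ⟨?_, ?_⟩
    · have : Continuous fun z : ℝ => z / 2 := by fun_prop
      simpa using (this.tendsto 0).mono_left nhdsWithin_le_nhds
    · filter_upwards [self_mem_nhdsWithin] with z hz
      exact half_pos (mem_Ioi.1 hz)
  have h2 : Tendsto (fun z : ℝ => Real.cosh (z / 2)) (𝓝[>] 0) (𝓝 1) := by
    have : Continuous fun z : ℝ => Real.cosh (z / 2) := by fun_prop
    simpa using (this.tendsto 0).mono_left nhdsWithin_le_nhds
  have h3 := ((tendsto_sinh_div_self.comp h1).div h2 one_ne_zero).div_const 2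
  rw [div_one] at h3
  refine h3.congr' ?_
  filter_upwards [self_mem_nhdsWithin] with z hz
  have hz : (0 : ℝ) < z := hz
  have := Real.cosh_pos (z / 2)
  simp only [Pi.div_apply, Function.comp, Real.tanh_eq_sinh_div_cosh]
  field_simp

/-- Since x coth x = 1 + x²/3 + o(x²), both rates vanish linearly at z = 0, with slopes (2μ+1)/12
and (4μ+5)/12. This limit determines d''(ω*+0). -/
lemma tendsto_jumpRate_div_paramRate {μ : ℝ} (hμ : 0 < μ) :
    Tendsto (fun z => jumpRate μ z / paramRate μ z) (𝓝[>] 0)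
      (𝓝 ((2 * μ + 1) / (4 * μ + 5))) := by
  have hA : Tendsto (fun z => jumpRate μ z / z) (𝓝[>] 0) (𝓝 ((2 * μ + 1) / 12)) := by
    have h := (((tendsto_mcoth_sub_div (m := μ + 1) (n := 1) (by linarith)
      one_pos).div_const μ).sub tendsto_tanh_half_div).div_const 2
    convert h using 1
    · ext z; unfold jumpRate; ring
    · congr 1; field_simp; ring
  have hB : Tendsto (fun z => paramRate μ z / z) (𝓝[>] 0) (𝓝 ((4 * μ + 5) / 12)) := by
    have h := ((tendsto_mcoth_sub_div (m := μ + 1) (n := μ) (by linarith) hμ).add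
      tendsto_tanh_half_div).div_const 2
    convert h using 1
    · ext z; unfold paramRate; ring
    · congr 1; field_simp; ring
  have h := hA.div hB (by positivity)
  rw [div_div_div_cancel_right₀ (by norm_num)] at h
  refine h.congr' ?_
  filter_upwards [self_mem_nhdsWithin] with z hz
  have hz : (0 : ℝ) < z := hz
  simp only [Pi.div_apply]
  rw [div_div_div_cancel_right₀ hz.ne']

/-! ### The curve of asymmetric boundary values -/

/-- Two such quotients describe the branch. With x/y = e^z and x ≠ y, the equation `field μ x =
field μ y` forces (xy)^μ = sinh z / sinh((μ+1)z), and the square of the common value divided by xy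
is then sinh(μz) / sinh((μ+1)z). -/
noncomputable def sinhRatio (m n z : ℝ) : ℝ := Real.sinh (m * z) / Real.sinh (n * z)

lemma sinhRatio_pos {m n z : ℝ} (hm : 0 < m) (hn : 0 < n) (hz : 0 < z) : 0 < sinhRatio m n z :=
  div_pos (Real.sinh_pos_iff.2 (mul_pos hm hz)) (Real.sinh_pos_iff.2 (mul_pos hn hz))

lemma hasDerivAt_sinhRatio {m n z : ℝ} (hm : 0 < m) (hn : 0 < n) (hz : 0 < z) :
    HasDerivAt (sinhRatio m n) (sinhRatio m n z * (mcoth m z - mcoth n z)) z := by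
  have h : ∀ m : ℝ, HasDerivAt (fun z => Real.sinh (m * z)) (Real.cosh (m * z) * m) z := fun m =>
    (Real.hasDerivAt_sinh (m * z)).comp z (((hasDerivAt_id z).const_mul m).congr_deriv (mul_one m))
  have h1 := Real.sinh_pos_iff.2 (mul_pos hm hz)
  have h2 := Real.sinh_pos_iff.2 (mul_pos hn hz)
  refine ((h m).div (h n) h2.ne').congr_deriv ?_
  unfold sinhRatio mcoth
  field_simp

lemma tendsto_sinhRatio {m n : ℝ} (hm : 0 < m) (hn : 0 < n) :
    Tendsto (sinhRatio m n) (𝓝[>] 0) (𝓝 (m / n)) := by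
  have h : ∀ m : ℝ, 0 < m → Tendsto (fun z => Real.sinh (m * z) / z) (𝓝[>] 0) (𝓝 m) := by
    intro m hm
    have h1 : Tendsto (fun z : ℝ => m * z) (𝓝[>] 0) (𝓝[>] 0) := by
      refine tendsto_nhdsWithin_iff.2 ⟨?_, ?_⟩
      · have : Continuous fun z : ℝ => m * z := by fun_prop
        simpa using (this.tendsto 0).mono_left nhdsWithin_le_nhds
      · filter_upwards [self_mem_nhdsWithin] with z hz
        exact mul_pos hm hz
    have h2 := (tendsto_sinh_div_self.comp h1).const_mul m
    rw [mul_one] at h2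
    refine h2.congr' ?_
    filter_upwards [self_mem_nhdsWithin] with z hz
    have hz : (0 : ℝ) < z := hz
    simp only [Function.comp]
    field_simp
  refine ((h m hm).div (h n hn) hn.ne').congr' ?_
  filter_upwards [self_mem_nhdsWithin] with z hz
  have hz : (0 : ℝ) < z := hz
  simp only [Pi.div_apply, sinhRatio]
  rw [div_div_div_cancel_right₀ hz.ne']

/-- Amounts to e^{μz} sinh z + e^{-z} sinh(μz) = sinh((μ+1)z). The left side is the power x^{2μ} of
the larger boundary value, so this identity evaluates 1 - x^{2μ}, and with it `field`, on the
branch. -/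
lemma exp_mul_sinhRatio {μ z : ℝ} (hμ : 0 < μ) (hz : 0 < z) :
    Real.exp (μ * z) * sinhRatio 1 (μ + 1) z = 1 - Real.exp (-z) * sinhRatio μ (μ + 1) z := by
  have h1 := Real.sinh_pos_iff.2 (mul_pos (show 0 < μ + 1 by linarith) hz)
  unfold sinhRatio
  rw [mul_div_assoc', mul_div_assoc', eq_sub_iff_add_eq, ← add_div, div_eq_one_iff_eq h1.ne',
    one_mul, add_mul, one_mul, Real.sinh_add, ← Real.cosh_add_sinh, ← Real.cosh_sub_sinh]
  ring

lemma exp_neg_mul_sinhRatio {μ z : ℝ} (hμ : 0 < μ) (hz : 0 < z) :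
    Real.exp (-(μ * z)) * sinhRatio 1 (μ + 1) z = 1 - Real.exp z * sinhRatio μ (μ + 1) z := by
  have h1 := Real.sinh_pos_iff.2 (mul_pos (show 0 < μ + 1 by linarith) hz)
  unfold sinhRatio
  rw [mul_div_assoc', mul_div_assoc', eq_sub_iff_add_eq, ← add_div, div_eq_one_iff_eq h1.ne',
    one_mul, add_mul, one_mul, Real.sinh_add, ← Real.cosh_add_sinh z,
    ← Real.cosh_sub_sinh (μ * z)]
  ring

lemma sinhRatio_le_one {m n z : ℝ} (hn : 0 < n) (hmn : m ≤ n) (hz : 0 < z) :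
    sinhRatio m n z ≤ 1 := by
  rw [sinhRatio, div_le_one (Real.sinh_pos_iff.2 (mul_pos hn hz)), Real.sinh_le_sinh]
  exact mul_le_mul_of_nonneg_right hmn hz.le

lemma strictAntiOn_sinhRatio {m n : ℝ} (hm : 0 < m) (hmn : m < n) :
    StrictAntiOn (sinhRatio m n) (Ioi 0) := by
  have hn := hm.trans hmn
  refine strictAntiOn_of_deriv_neg (convex_Ioi 0)
    (fun z hz => (hasDerivAt_sinhRatio hm hn hz).continuousAt.continuousWithinAt) fun z hz => ?_
  rw [interior_Ioi] at hz
  rw [(hasDerivAt_sinhRatio hm hn hz).deriv]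
  exact mul_neg_of_pos_of_neg (sinhRatio_pos hm hn hz) (sub_neg.2 (mcoth_lt hm hmn hz))

lemma sinhRatio_le {m n z : ℝ} (hm : 0 < m) (hmn : m < n) (hz : 0 < z) :
    sinhRatio m n z ≤ m / n := by
  refine ge_of_tendsto (tendsto_sinhRatio hm (hm.trans hmn)) ?_
  filter_upwards [Ioo_mem_nhdsGT hz] with s hs
  exact (strictAntiOn_sinhRatio hm hmn (mem_Ioi.2 hs.1) (mem_Ioi.2 hz) hs.2).le

/-- The common scale of the two boundary values on the asymmetric branch. -/
noncomputable def profileScale (μ z : ℝ) : ℝ := sinhRatio 1 (μ + 1) z ^ (1 / (2 * μ))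

/-- The larger boundary value on the asymmetric branch, with the parameter `z` the logarithm of the
ratio of the two values. -/
noncomputable def branchRight (μ z : ℝ) : ℝ := Real.exp (z / 2) * profileScale μ z

/-- The smaller boundary value on the asymmetric branch. -/
noncomputable def branchLeft (μ z : ℝ) : ℝ := Real.exp (-(z / 2)) * profileScale μ z

/-- The value of `k` for which `(branchRight μ z, branchLeft μ z)` is critical. -/
noncomputable def branchParam (μ z : ℝ) : ℝ :=
  2 * Real.cosh (z / 2) / √(sinhRatio μ (μ + 1) z)

/-- The bifurcation value of `k`. -/
noncomputable def bifParam (μ : ℝ) : ℝ := 2 * √((μ + 1) / μ)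

lemma profileScale_pos {μ z : ℝ} (hμ : 0 < μ) (hz : 0 < z) : 0 < profileScale μ z :=
  Real.rpow_pos_of_pos (sinhRatio_pos one_pos (by linarith) hz) _

lemma branchRight_pos {μ z : ℝ} (hμ : 0 < μ) (hz : 0 < z) : 0 < branchRight μ z :=
  mul_pos (Real.exp_pos _) (profileScale_pos hμ hz)

lemma branchLeft_pos {μ z : ℝ} (hμ : 0 < μ) (hz : 0 < z) : 0 < branchLeft μ z :=
  mul_pos (Real.exp_pos _) (profileScale_pos hμ hz)

lemma branchLeft_eq (μ z : ℝ) : branchLeft μ z = Real.exp (-z) * branchRight μ z := by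
  unfold branchLeft branchRight
  rw [← mul_assoc, ← Real.exp_add]
  congr 2; ring

lemma branchParam_pos {μ z : ℝ} (hμ : 0 < μ) (hz : 0 < z) : 0 < branchParam μ z :=
  div_pos (mul_pos two_pos (Real.cosh_pos _))
    (Real.sqrt_pos.2 (sinhRatio_pos hμ (by linarith) hz))

lemma hasDerivAt_profileScale {μ z : ℝ} (hμ : 0 < μ) (hz : 0 < z) :
    HasDerivAt (profileScale μ) (profileScale μ z *
      (-((mcoth (μ + 1) z - mcoth 1 z) / μ) / 2)) z := by
  have h0 := sinhRatio_pos one_pos (show 0 < μ + 1 by linarith) hz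
  refine ((hasDerivAt_sinhRatio one_pos (show 0 < μ + 1 by linarith) hz).rpow_const
    (Or.inl h0.ne')).congr_deriv ?_
  rw [Real.rpow_sub_one h0.ne', profileScale]
  field_simp
  ring

lemma hasDerivAt_branchRight {μ z : ℝ} (hμ : 0 < μ) (hz : 0 < z) :
    HasDerivAt (branchRight μ) (branchRight μ z *
      ((1 - (mcoth (μ + 1) z - mcoth 1 z) / μ) / 2)) z := by
  have h1 : HasDerivAt (fun z : ℝ => Real.exp (z / 2)) (Real.exp (z / 2) * (1 / 2)) z :=
    (Real.hasDerivAt_exp _).comp z ((hasDerivAt_id z).div_const 2)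
  refine (h1.mul (hasDerivAt_profileScale hμ hz)).congr_deriv ?_
  unfold branchRight
  ring

lemma hasDerivAt_branchLeft {μ z : ℝ} (hμ : 0 < μ) (hz : 0 < z) :
    HasDerivAt (branchLeft μ) (branchLeft μ z *
      ((-1 - (mcoth (μ + 1) z - mcoth 1 z) / μ) / 2)) z := by
  have h1 : HasDerivAt (fun z : ℝ => Real.exp (-(z / 2))) (Real.exp (-(z / 2)) * (-(1 / 2))) z :=
    (Real.hasDerivAt_exp _).comp z ((hasDerivAt_id z).div_const 2).neg
  refine (h1.mul (hasDerivAt_profileScale hμ hz)).congr_deriv ?_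
  unfold branchLeft
  ring

lemma branch_add {μ z : ℝ} :
    branchRight μ z + branchLeft μ z = 2 * Real.cosh (z / 2) * profileScale μ z := by
  unfold branchLeft branchRight
  rw [Real.cosh_eq]; ring

lemma branch_sub {μ z : ℝ} :
    branchRight μ z - branchLeft μ z = 2 * Real.sinh (z / 2) * profileScale μ z := by
  unfold branchLeft branchRight
  rw [Real.sinh_eq]; ring

/-- The left side is the derivative of the sum of the two boundary values. The tanh in `jumpRate`
appears because their difference over their sum is tanh(z/2). -/
lemma branch_log_deriv {μ z : ℝ} :
    branchRight μ z * ((1 - (mcoth (μ + 1) z - mcoth 1 z) / μ) / 2) +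
      branchLeft μ z * ((-1 - (mcoth (μ + 1) z - mcoth 1 z) / μ) / 2) =
      -jumpRate μ z * (branchRight μ z + branchLeft μ z) := by
  have h : Real.tanh (z / 2) * (branchRight μ z + branchLeft μ z) =
      branchRight μ z - branchLeft μ z := by
    rw [branch_add, branch_sub, Real.tanh_eq_sinh_div_cosh]
    have := Real.cosh_pos (z / 2)
    field_simp
  unfold jumpRate
  linear_combination (-1 / 2) * h

lemma branchRight_rpow {μ z : ℝ} (hμ : 0 < μ) (hz : 0 < z) :
    branchRight μ z ^ (2 * μ) = 1 - Real.exp (-z) * sinhRatio μ (μ + 1) z := by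
  have h0 := sinhRatio_pos one_pos (show 0 < μ + 1 by linarith) hz
  rw [← exp_mul_sinhRatio hμ hz, branchRight, profileScale,
    Real.mul_rpow (Real.exp_pos _).le (by positivity), ← Real.rpow_mul h0.le,
    one_div_mul_cancel (by positivity), Real.rpow_one, ← Real.exp_mul]
  congr 2; ring

lemma branchLeft_rpow {μ z : ℝ} (hμ : 0 < μ) (hz : 0 < z) :
    branchLeft μ z ^ (2 * μ) = 1 - Real.exp z * sinhRatio μ (μ + 1) z := by
  have h0 := sinhRatio_pos one_pos (show 0 < μ + 1 by linarith) hz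
  rw [← exp_neg_mul_sinhRatio hμ hz, branchLeft, profileScale,
    Real.mul_rpow (Real.exp_pos _).le (by positivity), ← Real.rpow_mul h0.le,
    one_div_mul_cancel (by positivity), Real.rpow_one, ← Real.exp_mul]
  congr 2; ring

lemma branchRight_lt_one {μ z : ℝ} (hμ : 0 < μ) (hz : 0 < z) : branchRight μ z < 1 := by
  by_contra! h
  have h1 := Real.one_le_rpow h (show 0 ≤ 2 * μ by positivity)
  rw [branchRight_rpow hμ hz] at h1
  have := mul_pos (Real.exp_pos (-z)) (sinhRatio_pos hμ (show 0 < μ + 1 by linarith) hz)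
  linarith

lemma branchLeft_lt_branchRight {μ z : ℝ} (hμ : 0 < μ) (hz : 0 < z) :
    branchLeft μ z < branchRight μ z := by
  rw [branchLeft_eq]
  exact mul_lt_of_lt_one_left (branchRight_pos hμ hz) (Real.exp_lt_one_iff.2 (by linarith))

lemma branchLeft_lt_one {μ z : ℝ} (hμ : 0 < μ) (hz : 0 < z) : branchLeft μ z < 1 :=
  (branchLeft_lt_branchRight hμ hz).trans (branchRight_lt_one hμ hz)

lemma field_branchRight {μ z : ℝ} (hμ : 0 < μ) (hz : 0 < z) :
    field μ (branchRight μ z) = profileScale μ z * √(sinhRatio μ (μ + 1) z) := by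
  rw [field, branchRight_rpow hμ hz, sub_sub_cancel, Real.sqrt_mul (Real.exp_pos _).le,
    show -z = -(z / 2) + -(z / 2) by ring, Real.exp_add, Real.sqrt_mul_self (Real.exp_pos _).le,
    branchRight]
  have : Real.exp (z / 2) * Real.exp (-(z / 2)) = 1 := by rw [← Real.exp_add]; simp
  linear_combination profileScale μ z * √(sinhRatio μ (μ + 1) z) * this

lemma field_branchLeft {μ z : ℝ} (hμ : 0 < μ) (hz : 0 < z) :
    field μ (branchLeft μ z) = profileScale μ z * √(sinhRatio μ (μ + 1) z) := by
  rw [field, branchLeft_rpow hμ hz, sub_sub_cancel, Real.sqrt_mul (Real.exp_pos _).le]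
  nth_rewrite 2 [show z = z / 2 + z / 2 by ring]
  rw [Real.exp_add, Real.sqrt_mul_self (Real.exp_pos _).le, branchLeft]
  have : Real.exp (z / 2) * Real.exp (-(z / 2)) = 1 := by rw [← Real.exp_add]; simp
  linear_combination profileScale μ z * √(sinhRatio μ (μ + 1) z) * this

lemma branch_add_div_branchParam {μ z : ℝ} (hμ : 0 < μ) (hz : 0 < z) :
    (branchRight μ z + branchLeft μ z) / branchParam μ z =
      profileScale μ z * √(sinhRatio μ (μ + 1) z) := by
  have := Real.cosh_pos (z / 2)
  have := Real.sqrt_pos.2 (sinhRatio_pos hμ (show 0 < μ + 1 by linarith) hz)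
  rw [branch_add, branchParam]
  field_simp

lemma isCritical_branch {μ z : ℝ} (hμ : 0 < μ) (hz : 0 < z) :
    IsCritical μ (branchParam μ z) (branchRight μ z) (branchLeft μ z) where
  left_mem := ⟨branchRight_pos hμ hz, branchRight_lt_one hμ hz⟩
  right_mem := ⟨branchLeft_pos hμ hz, branchLeft_lt_one hμ hz⟩
  field_left := by rw [branch_add_div_branchParam hμ hz, field_branchRight hμ hz]
  field_right := by rw [branch_add_div_branchParam hμ hz, field_branchLeft hμ hz]

lemma hasDerivAt_branchParam {μ z : ℝ} (hμ : 0 < μ) (hz : 0 < z) :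
    HasDerivAt (branchParam μ) (branchParam μ z * paramRate μ z) z := by
  have h0 := sinhRatio_pos hμ (show 0 < μ + 1 by linarith) hz
  have h1 : HasDerivAt (fun z : ℝ => 2 * Real.cosh (z / 2))
      (2 * (Real.sinh (z / 2) * (1 / 2))) z :=
    ((Real.hasDerivAt_cosh _).comp z ((hasDerivAt_id z).div_const 2)).const_mul 2
  have h2 := (hasDerivAt_sinhRatio hμ (show 0 < μ + 1 by linarith) hz).sqrt h0.ne'
  have hs := Real.sqrt_pos.2 h0
  have hc := Real.cosh_pos (z / 2)
  refine (h1.div h2 hs.ne').congr_deriv ?_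
  unfold branchParam paramRate
  rw [Real.tanh_eq_sinh_div_cosh]
  have hsq : sinhRatio μ (μ + 1) z = √(sinhRatio μ (μ + 1) z) ^ 2 := (Real.sq_sqrt h0.le).symm
  nth_rewrite 2 [hsq]
  field_simp
  ring

lemma strictMonoOn_branchParam {μ : ℝ} (hμ : 0 < μ) : StrictMonoOn (branchParam μ) (Ioi 0) := by
  refine strictMonoOn_of_deriv_pos (convex_Ioi 0)
    (fun z hz => (hasDerivAt_branchParam hμ hz).continuousAt.continuousWithinAt) fun z hz => ?_
  rw [interior_Ioi] at hz
  rw [(hasDerivAt_branchParam hμ hz).deriv]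
  exact mul_pos (branchParam_pos hμ hz) (paramRate_pos hμ hz)

lemma tendsto_branchParam {μ : ℝ} (hμ : 0 < μ) :
    Tendsto (branchParam μ) (𝓝[>] 0) (𝓝 (bifParam μ)) := by
  have h1 : Tendsto (fun z : ℝ => 2 * Real.cosh (z / 2)) (𝓝[>] 0) (𝓝 2) := by
    have : Continuous fun z : ℝ => 2 * Real.cosh (z / 2) := by fun_prop
    simpa using (this.tendsto 0).mono_left nhdsWithin_le_nhds
  have h2 := (Real.continuous_sqrt.tendsto _).comp
    (tendsto_sinhRatio hμ (show 0 < μ + 1 by linarith))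
  have h3 := h1.div h2 (Real.sqrt_pos.2 (by positivity)).ne'
  have e : bifParam μ = 2 / √(μ / (μ + 1)) := by
    rw [bifParam, ← inv_div, Real.sqrt_inv, div_eq_mul_inv 2]
  rw [e]
  exact h3

lemma bifParam_lt_branchParam {μ z : ℝ} (hμ : 0 < μ) (hz : 0 < z) :
    bifParam μ < branchParam μ z := by
  refine lt_of_le_of_lt ?_ (strictMonoOn_branchParam hμ (mem_Ioi.2 (half_pos hz)) (mem_Ioi.2 hz)
    (half_lt_self hz))
  refine le_of_tendsto (tendsto_branchParam hμ) ?_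
  filter_upwards [Ioo_mem_nhdsGT (half_pos hz)] with s hs
  exact (strictMonoOn_branchParam hμ (mem_Ioi.2 hs.1) (mem_Ioi.2 (half_pos hz)) hs.2).le

lemma branchParam_surj {μ k : ℝ} (hμ : 0 < μ) (hk : bifParam μ < k) :
    ∃ z, 0 < z ∧ branchParam μ z = k := by
  obtain ⟨a, hak, ha⟩ := (((tendsto_branchParam hμ).eventually (gt_mem_nhds hk)).and
    self_mem_nhdsWithin).exists
  have htop : Tendsto (branchParam μ) atTop atTop := by
    have h1 : Tendsto (fun z : ℝ => 2 * (z / 2)) atTop atTop := by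
      refine tendsto_id.congr fun z => ?_
      simp only [id]; ring
    refine tendsto_atTop_mono' _ ?_ h1
    filter_upwards [eventually_gt_atTop 0] with z hz
    have h2 : √(sinhRatio μ (μ + 1) z) ≤ 1 :=
      Real.sqrt_le_one.2 (sinhRatio_le_one (by linarith) (by linarith) hz)
    have h3 := Real.sqrt_pos.2 (sinhRatio_pos hμ (show 0 < μ + 1 by linarith) hz)
    have h4 : z / 2 ≤ Real.cosh (z / 2) :=
      ((Real.self_lt_sinh_iff.2 (half_pos hz)).trans (Real.sinh_lt_cosh _)).le
    rw [branchParam, le_div_iff₀ h3]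
    nlinarith
  obtain ⟨b, hbk, hb⟩ := ((htop.eventually (eventually_ge_atTop k)).and
    (eventually_gt_atTop 0)).exists
  obtain ⟨z, hz, hzk⟩ := isPreconnected_Ioi.intermediate_value (show a ∈ Ioi (0 : ℝ) from ha)
    (show b ∈ Ioi (0 : ℝ) from hb)
    (fun z hz => (hasDerivAt_branchParam hμ hz).continuousAt.continuousWithinAt) ⟨hak.le, hbk⟩
  exact ⟨z, hz, hzk⟩

lemma tendsto_profileScale {μ : ℝ} (hμ : 0 < μ) :
    Tendsto (profileScale μ) (𝓝[>] 0) (𝓝 ((1 / (μ + 1)) ^ (1 / (2 * μ)))) :=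
  (tendsto_sinhRatio one_pos (show 0 < μ + 1 by linarith)).rpow_const (Or.inr (by positivity))

lemma tendsto_branchRight {μ : ℝ} (hμ : 0 < μ) :
    Tendsto (branchRight μ) (𝓝[>] 0) (𝓝 ((1 / (μ + 1)) ^ (1 / (2 * μ)))) := by
  have h1 : Tendsto (fun z : ℝ => Real.exp (z / 2)) (𝓝[>] 0) (𝓝 1) := by
    have : Continuous fun z : ℝ => Real.exp (z / 2) := by fun_prop
    simpa using (this.tendsto 0).mono_left nhdsWithin_le_nhds
  have h2 := h1.mul (tendsto_profileScale hμ)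
  rw [one_mul] at h2
  exact h2

lemma tendsto_branchLeft {μ : ℝ} (hμ : 0 < μ) :
    Tendsto (branchLeft μ) (𝓝[>] 0) (𝓝 ((1 / (μ + 1)) ^ (1 / (2 * μ)))) := by
  have h1 : Tendsto (fun z : ℝ => Real.exp (-(z / 2))) (𝓝[>] 0) (𝓝 1) := by
    have : Continuous fun z : ℝ => Real.exp (-(z / 2)) := by fun_prop
    simpa using (this.tendsto 0).mono_left nhdsWithin_le_nhds
  have h2 := h1.mul (tendsto_profileScale hμ)
  rw [one_mul] at h2
  exact h2

lemma tendsto_branchRight_atTop {μ : ℝ} (hμ : 0 < μ) :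
    Tendsto (branchRight μ) atTop (𝓝 1) := by
  have h1 : Tendsto (fun z => Real.exp (-z) * sinhRatio μ (μ + 1) z) atTop (𝓝 0) := by
    refine squeeze_zero' ?_ ?_ Real.tendsto_exp_neg_atTop_nhds_zero
    · filter_upwards [eventually_gt_atTop 0] with z hz
      exact (mul_pos (Real.exp_pos _) (sinhRatio_pos hμ (by linarith) hz)).le
    · filter_upwards [eventually_gt_atTop 0] with z hz
      exact mul_le_of_le_one_right (Real.exp_pos _).le
        (sinhRatio_le_one (by linarith) (by linarith) hz)
  have h2 := ((h1.const_sub 1).rpow_const (p := 1 / (2 * μ)) (Or.inl (by norm_num)))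
  rw [sub_zero, Real.one_rpow] at h2
  refine h2.congr' ?_
  filter_upwards [eventually_gt_atTop 0] with z hz
  rw [← branchRight_rpow hμ hz, ← Real.rpow_mul (branchRight_pos hμ hz).le,
    mul_one_div_cancel (by positivity), Real.rpow_one]

/-! ### The minimax property -/

lemma reduced_comm (μ k x y : ℝ) : reduced μ k x y = reduced μ k y x := by
  unfold reduced; rw [add_comm y x]; ring

lemma tendsto_reduced {μ k x y : ℝ} (hμ : 0 < μ) {ι : Type*} {l : Filter ι} {X Y : ι → ℝ}
    (hX : Tendsto X l (𝓝 x)) (hY : Tendsto Y l (𝓝 y)) :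
    Tendsto (fun i => reduced μ k (X i) (Y i)) l (𝓝 (reduced μ k x y)) :=
  ((((continuous_fieldInt hμ).tendsto x).comp hX).add
    (((continuous_fieldInt hμ).tendsto y).comp hY)).sub (((hX.add hY).pow 2).div_const _)

/-- Up to exchanging the coordinates, a ray has slope e^{-z} with z > 0, slope 1 or slope 0. Rays of
the first kind meet the curve; the other two are reached in the limits z → 0 and z → ∞. One good
point per ray suffices, because c bounds the reduced action along the whole ray within the unit
square. -/
lemma isRayMinimax_of_curve {μ k x y x₀ x₁ : ℝ} (hμ : 0 < μ) {X : ℝ → ℝ}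
    (hX0 : ∀ z, 0 < z → 0 ≤ X z) (hX1 : ∀ z, 0 < z → X z ≤ 1)
    (h0 : Tendsto X (𝓝[>] 0) (𝓝 x₀)) (h1 : Tendsto X atTop (𝓝 x₁))
    (hmin : ∀ z, 0 < z → reduced μ k x y ≤ reduced μ k (X z) (Real.exp (-z) * X z)) :
    IsRayMinimax μ k x y := by
  have key : ∀ A B c : ℝ, 0 ≤ B → B ≤ A → 0 < A →
      (∀ t, 0 ≤ t → t * A ≤ 1 → t * B ≤ 1 → reduced μ k (t * A) (t * B) ≤ c) →
      reduced μ k x y ≤ c := by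
    intro A B c hB hBA hA hc
    have hc' : ∀ a, 0 ≤ a → a ≤ 1 → reduced μ k a (B / A * a) ≤ c := by
      intro a ha ha1
      have := hc (a / A) (by positivity) (by rw [div_mul_cancel₀ _ hA.ne']; exact ha1)
        (le_trans (mul_le_mul_of_nonneg_left hBA (by positivity))
          (by rw [div_mul_cancel₀ _ hA.ne']; exact ha1))
      rwa [div_mul_cancel₀ _ hA.ne', show a / A * B = B / A * a by ring] at this
    rcases hBA.eq_or_lt with rfl | hlt
    · rw [div_self hA.ne'] at hc'
      have hx0 : 0 ≤ x₀ := ge_of_tendsto h0 (by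
        filter_upwards [self_mem_nhdsWithin] with z hz using hX0 z hz)
      have hx1 : x₀ ≤ 1 := le_of_tendsto h0 (by
        filter_upwards [self_mem_nhdsWithin] with z hz using hX1 z hz)
      have he : Tendsto (fun z : ℝ => Real.exp (-z)) (𝓝[>] 0) (𝓝 1) := by
        have : Continuous fun z : ℝ => Real.exp (-z) := by fun_prop
        simpa using (this.tendsto 0).mono_left nhdsWithin_le_nhds
      refine le_trans (ge_of_tendsto (tendsto_reduced (k := k) hμ h0 (he.mul h0)) ?_)
        (hc' x₀ hx0 hx1)
      filter_upwards [self_mem_nhdsWithin] with z hz using hmin z hz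
    · rcases hB.eq_or_lt with rfl | hBpos
      · rw [zero_div] at hc'
        have hx0 : 0 ≤ x₁ := ge_of_tendsto h1 (by
          filter_upwards [eventually_gt_atTop 0] with z hz using hX0 z hz)
        have hx1 : x₁ ≤ 1 := le_of_tendsto h1 (by
          filter_upwards [eventually_gt_atTop 0] with z hz using hX1 z hz)
        refine le_trans (ge_of_tendsto (tendsto_reduced (k := k) hμ h1
          (Real.tendsto_exp_neg_atTop_nhds_zero.mul h1)) ?_) (hc' x₁ hx0 hx1)
        filter_upwards [eventually_gt_atTop 0] with z hz using hmin z hz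
      · have hr : 0 < B / A := div_pos hBpos hA
        have hz : 0 < -Real.log (B / A) :=
          neg_pos.2 (Real.log_neg hr ((div_lt_one hA).2 hlt))
        have h2 := hmin _ hz
        rw [neg_neg, Real.exp_log hr] at h2
        exact h2.trans (hc' _ (hX0 _ hz) (hX1 _ hz))
  intro A B c hA hB hAB hc
  rcases le_total B A with h | h
  · exact key A B c hB h (by rwa [max_eq_left h] at hAB) hc
  · refine key B A c hA h (by rwa [max_eq_right h] at hAB) fun t ht h1 h2 => ?_
    rw [reduced_comm]
    exact hc t ht h2 h1

lemma HasDerivAt.reduced {μ k z x' y' : ℝ} (hμ : 0 < μ) {X Y : ℝ → ℝ}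
    (hX : HasDerivAt X x' z) (hY : HasDerivAt Y y' z) :
    HasDerivAt (fun z => reduced μ k (X z) (Y z))
      ((field μ (X z) - (X z + Y z) / k) * x' + (field μ (Y z) - (X z + Y z) / k) * y') z := by
  have h1 := (hasDerivAt_fieldInt hμ (X z)).comp z hX
  have h2 := (hasDerivAt_fieldInt hμ (Y z)).comp z hY
  have h3 := (((hX.add hY).pow 2).div_const (2 * k))
  refine ((h1.add h2).sub h3).congr_deriv ?_
  simp only [Pi.add_apply, Nat.cast_ofNat, Nat.add_one_sub_one, pow_one]
  rw [show 2 * (X z + Y z) * (x' + y') / (2 * k) = (X z + Y z) / k * (x' + y') by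
    rw [mul_assoc, mul_div_mul_left _ _ two_ne_zero]; ring]
  ring

/-- The derivative of the smaller value is eliminated through `branch_log_deriv`, so that the sign
of each of the two summands can be read off separately. -/
lemma hasDerivAt_reduced_scaled_branch {μ k z a : ℝ} (hμ : 0 < μ) (hz : 0 < z) :
    HasDerivAt (fun z => reduced μ k (a * branchRight μ z) (a * branchLeft μ z))
      ((field μ (a * branchRight μ z) - field μ (a * branchLeft μ z)) *
        (a * branchRight μ z * ((1 - (mcoth (μ + 1) z - mcoth 1 z) / μ) / 2)) +
      ((a * branchRight μ z + a * branchLeft μ z) / k - field μ (a * branchLeft μ z)) *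
        (jumpRate μ z * (a * branchRight μ z + a * branchLeft μ z))) z := by
  refine (HasDerivAt.reduced hμ ((hasDerivAt_branchRight hμ hz).const_mul a)
    ((hasDerivAt_branchLeft hμ hz).const_mul a)).congr_deriv ?_
  have h := branch_log_deriv (μ := μ) (z := z)
  linear_combination (field μ (a * branchLeft μ z) -
    (a * branchRight μ z + a * branchLeft μ z) / k) * a * h

/-- On the branch both values of `field` equal the sum of the boundary values divided by
`branchParam μ z`. The z-derivative of the reduced action therefore has the sign of 1/k -
1/`branchParam μ z`, and monotonicity of `branchParam` puts the minimum at z₀. -/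
lemma isRayMinimax_branch {μ z₀ : ℝ} (hμ : 0 < μ) (hz₀ : 0 < z₀) :
    IsRayMinimax μ (branchParam μ z₀) (branchRight μ z₀) (branchLeft μ z₀) := by
  set k := branchParam μ z₀ with hk
  have hk0 : 0 < k := branchParam_pos hμ hz₀
  refine isRayMinimax_of_curve hμ (fun z hz => (branchRight_pos hμ hz).le)
    (fun z hz => (branchRight_lt_one hμ hz).le) (tendsto_branchRight hμ)
    (tendsto_branchRight_atTop hμ) fun z hz => ?_
  rw [← branchLeft_eq]
  have hd : ∀ z, 0 < z → HasDerivAt (fun z => reduced μ k (branchRight μ z) (branchLeft μ z))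
      ((branchRight μ z + branchLeft μ z) * (1 / k - 1 / branchParam μ z) *
        (jumpRate μ z * (branchRight μ z + branchLeft μ z))) z := by
    intro z hz
    have h := hasDerivAt_reduced_scaled_branch (k := k) (a := 1) hμ hz
    simp only [one_mul] at h
    refine h.congr_deriv ?_
    have e := branch_add_div_branchParam hμ hz
    rw [field_branchRight hμ hz, field_branchLeft hμ hz, ← e]
    ring
  have hc : ContinuousOn (fun z => reduced μ k (branchRight μ z) (branchLeft μ z)) (Ioi 0) :=
    fun z hz => (hd z hz).continuousAt.continuousWithinAt
  have hpos : ∀ z, 0 < z → 0 < branchRight μ z + branchLeft μ z := fun z hz =>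
    add_pos (branchRight_pos hμ hz) (branchLeft_pos hμ hz)
  rcases le_total z z₀ with h | h
  · have hanti : AntitoneOn (fun z => reduced μ k (branchRight μ z) (branchLeft μ z))
        (Ioc 0 z₀) := by
      refine antitoneOn_of_deriv_nonpos (convex_Ioc 0 z₀) (hc.mono Ioc_subset_Ioi_self)
        (fun s hs => ?_) fun s hs => ?_
      · rw [interior_Ioc] at hs
        exact (hd s hs.1).differentiableAt.differentiableWithinAt
      · rw [interior_Ioc] at hs
        rw [(hd s hs.1).deriv]
        have h1 : 1 / k ≤ 1 / branchParam μ s :=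
          one_div_le_one_div_of_le (branchParam_pos hμ hs.1)
            (strictMonoOn_branchParam hμ (mem_Ioi.2 hs.1) (mem_Ioi.2 hz₀) hs.2).le
        exact mul_nonpos_of_nonpos_of_nonneg
          (mul_nonpos_of_nonneg_of_nonpos (hpos s hs.1).le (by linarith))
          (mul_pos (jumpRate_pos hμ hs.1) (hpos s hs.1)).le
    exact hanti ⟨hz, h⟩ ⟨hz₀, le_rfl⟩ h
  · have hmono : MonotoneOn (fun z => reduced μ k (branchRight μ z) (branchLeft μ z))
        (Ici z₀) := by
      refine monotoneOn_of_deriv_nonneg (convex_Ici z₀)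
        (hc.mono fun s hs => lt_of_lt_of_le hz₀ hs) (fun s hs => ?_) fun s hs => ?_
      · rw [interior_Ici] at hs
        exact (hd s (hz₀.trans hs)).differentiableAt.differentiableWithinAt
      · rw [interior_Ici] at hs
        have hs0 : 0 < s := hz₀.trans hs
        rw [(hd s hs0).deriv]
        have h1 : 1 / branchParam μ s ≤ 1 / k :=
          one_div_le_one_div_of_le hk0
            (strictMonoOn_branchParam hμ (mem_Ioi.2 hz₀) (mem_Ioi.2 hs0) hs).le
        exact mul_nonneg (mul_nonneg (hpos s hs0).le (by linarith))
          (mul_pos (jumpRate_pos hμ hs0) (hpos s hs0)).le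
    exact hmono (mem_Ici.2 le_rfl) (mem_Ici.2 h) h

/-! ### The symmetric critical point and its minimax property up to the bifurcation -/

/-- The common boundary value of the symmetric stationary state. -/
noncomputable def symVal (μ k : ℝ) : ℝ := (1 - 4 / k ^ 2) ^ (1 / (2 * μ))

lemma one_sub_four_div_pos {k : ℝ} (hk : 2 < k) : 0 < 1 - 4 / k ^ 2 := by
  rw [sub_pos, div_lt_one (by positivity)]; nlinarith

lemma symVal_pos {μ k : ℝ} (hk : 2 < k) : 0 < symVal μ k :=
  Real.rpow_pos_of_pos (one_sub_four_div_pos hk) _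

lemma symVal_rpow {μ k : ℝ} (hμ : 0 < μ) (hk : 2 < k) :
    symVal μ k ^ (2 * μ) = 1 - 4 / k ^ 2 := by
  rw [symVal, ← Real.rpow_mul (one_sub_four_div_pos hk).le, one_div_mul_cancel (by positivity),
    Real.rpow_one]

lemma symVal_lt_one {μ k : ℝ} (hμ : 0 < μ) (hk : 2 < k) : symVal μ k < 1 := by
  refine Real.rpow_lt_one (one_sub_four_div_pos hk).le ?_ (by positivity)
  have : 0 < 4 / k ^ 2 := by positivity
  linarith

lemma field_symVal {μ k : ℝ} (hμ : 0 < μ) (hk : 2 < k) :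
    field μ (symVal μ k) = 2 * symVal μ k / k := by
  rw [field, symVal_rpow hμ hk, sub_sub_cancel, show 4 / k ^ 2 = (2 / k) ^ 2 by
    rw [div_pow]; norm_num, Real.sqrt_sq (by positivity)]
  ring

lemma isCritical_symVal {μ k : ℝ} (hμ : 0 < μ) (hk : 2 < k) :
    IsCritical μ k (symVal μ k) (symVal μ k) where
  left_mem := ⟨symVal_pos hk, symVal_lt_one hμ hk⟩
  right_mem := ⟨symVal_pos hk, symVal_lt_one hμ hk⟩
  field_left := by rw [field_symVal hμ hk]; ring
  field_right := by rw [field_symVal hμ hk]; ring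

lemma sq_bifParam {μ : ℝ} (hμ : 0 < μ) : bifParam μ ^ 2 = 4 * ((μ + 1) / μ) := by
  rw [bifParam, mul_pow, Real.sq_sqrt (by positivity)]; norm_num

lemma two_lt_bifParam {μ : ℝ} (hμ : 0 < μ) : 2 < bifParam μ := by
  have h0 : 0 ≤ bifParam μ := by unfold bifParam; positivity
  refine lt_of_pow_lt_pow_left₀ 2 h0 ?_
  rw [sq_bifParam hμ]
  have : 1 < (μ + 1) / μ := by rw [one_lt_div hμ]; linarith
  linarith

/-- The test curve is the asymmetric branch multiplied by a factor a ≤ 1 chosen so that it starts,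
as z → 0, at the symmetric critical point. The reduced action is nondecreasing along it. -/
lemma isRayMinimax_symVal {μ k : ℝ} (hμ : 0 < μ) (hk : 2 < k) (hkb : k ≤ bifParam μ) :
    IsRayMinimax μ k (symVal μ k) (symVal μ k) := by
  have hk0 : 0 < k := by linarith
  have hk2 : k ^ 2 ≤ 4 * ((μ + 1) / μ) := by
    rw [← sq_bifParam hμ]; exact pow_le_pow_left₀ hk0.le hkb 2
  -- c is a^{2μ} for the scaling factor a, and c ≤ 1 is equivalent to k ≤ `bifParam μ`.
  set c : ℝ := (μ + 1) * (1 - 4 / k ^ 2) with hc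
  have hc0 : 0 < c := mul_pos (by linarith) (one_sub_four_div_pos hk)
  have hck : c * k ^ 2 = (μ + 1) * (k ^ 2 - 4) := by rw [hc]; field_simp
  have hc1 : c ≤ 1 := by
    rw [mul_div_assoc', le_div_iff₀ hμ] at hk2
    have : c * k ^ 2 ≤ 1 * k ^ 2 := by rw [hck]; linarith
    exact le_of_mul_le_mul_right this (by positivity)
  set a : ℝ := c ^ (1 / (2 * μ)) with ha
  have ha0 : 0 < a := Real.rpow_pos_of_pos hc0 _
  have ha1 : a ≤ 1 := Real.rpow_le_one hc0.le hc1 (by positivity)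
  have hac : a ^ (2 * μ) = c := by
    rw [ha, ← Real.rpow_mul hc0.le, one_div_mul_cancel (by positivity), Real.rpow_one]
  have hlim : a * (1 / (μ + 1)) ^ (1 / (2 * μ)) = symVal μ k := by
    rw [ha, ← Real.mul_rpow hc0.le (by positivity), symVal, hc]
    congr 1
    field_simp
  have hR : Tendsto (fun z => a * branchRight μ z) (𝓝[>] 0) (𝓝 (symVal μ k)) := by
    rw [← hlim]; exact (tendsto_branchRight hμ).const_mul a
  have hL : Tendsto (fun z => a * branchLeft μ z) (𝓝[>] 0) (𝓝 (symVal μ k)) := by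
    rw [← hlim]; exact (tendsto_branchLeft hμ).const_mul a
  have hxpos : ∀ z, 0 < z → 0 < a * branchRight μ z := fun z hz =>
    mul_pos ha0 (branchRight_pos hμ hz)
  have hypos : ∀ z, 0 < z → 0 < a * branchLeft μ z := fun z hz =>
    mul_pos ha0 (branchLeft_pos hμ hz)
  have hx1 : ∀ z, 0 < z → a * branchRight μ z ≤ 1 := fun z hz =>
    mul_le_one₀ ha1 (branchRight_pos hμ hz).le (branchRight_lt_one hμ hz).le
  have hy1 : ∀ z, 0 < z → a * branchLeft μ z ≤ 1 := fun z hz =>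
    mul_le_one₀ ha1 (branchLeft_pos hμ hz).le (branchLeft_lt_one hμ hz).le
  refine isRayMinimax_of_curve (X := fun z => a * branchRight μ z) hμ (fun z hz => (hxpos z hz).le)
    hx1 hR ((tendsto_branchRight_atTop hμ).const_mul a) fun z hz => ?_
  rw [show Real.exp (-z) * (a * branchRight μ z) = a * branchLeft μ z by
    rw [branchLeft_eq]; ring]
  -- Write x, y for the unscaled branch values. As x² - x^{2μ+2} = y² - y^{2μ+2}, the difference of
  -- the squared fields is a²(1 - c)(x² - y²).
  have hfield : ∀ z, 0 < z → field μ (a * branchLeft μ z) ≤ field μ (a * branchRight μ z) := by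
    intro z hz
    refine le_of_sq_le_sq ?_ (field_nonneg (hxpos z hz).le)
    rw [sq_field hμ (hxpos z hz).le (hx1 z hz), sq_field hμ (hypos z hz).le (hy1 z hz),
      rpow_two_mul_add_two (hxpos z hz).le hμ, rpow_two_mul_add_two (hypos z hz).le hμ,
      Real.mul_rpow ha0.le (branchRight_pos hμ hz).le,
      Real.mul_rpow ha0.le (branchLeft_pos hμ hz).le, hac]
    have e1 := sq_field hμ (branchRight_pos hμ hz).le (branchRight_lt_one hμ hz).le
    have e2 := sq_field hμ (branchLeft_pos hμ hz).le (branchLeft_lt_one hμ hz).le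
    rw [rpow_two_mul_add_two (branchRight_pos hμ hz).le hμ] at e1
    rw [rpow_two_mul_add_two (branchLeft_pos hμ hz).le hμ] at e2
    rw [field_branchRight hμ hz, ← field_branchLeft hμ hz, e2] at e1
    have h1 : branchLeft μ z ^ 2 ≤ branchRight μ z ^ 2 :=
      pow_le_pow_left₀ (branchLeft_pos hμ hz).le (branchLeft_lt_branchRight hμ hz).le 2
    have h2 : 0 ≤ a ^ 2 * ((1 - c) * (branchRight μ z ^ 2 - branchLeft μ z ^ 2)) :=
      mul_nonneg (sq_nonneg a) (mul_nonneg (by linarith) (by linarith))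
    linear_combination h2 + a ^ 2 * c * e1
  have hfield2 : ∀ z, 0 < z → field μ (a * branchLeft μ z) ≤
      (a * branchRight μ z + a * branchLeft μ z) / k := by
    intro z hz
    have hρ : (μ + 1) * (Real.exp (-(μ * z)) * sinhRatio 1 (μ + 1) z) ≤ 1 := by
      have h1 := sinhRatio_le one_pos (show 1 < μ + 1 by linarith) hz
      rw [le_div_iff₀ (by linarith)] at h1
      have h2 : Real.exp (-(μ * z)) ≤ 1 := Real.exp_le_one_iff.2 (by nlinarith)
      have h3 := sinhRatio_pos one_pos (show 0 < μ + 1 by linarith) hz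
      nlinarith [mul_le_mul_of_nonneg_right h2 h3.le]
    have hβ := exp_neg_mul_sinhRatio hμ hz
    set β := Real.exp (-(μ * z)) * sinhRatio 1 (μ + 1) z
    set κ := sinhRatio μ (μ + 1) z
    have hκ : 0 < κ := sinhRatio_pos hμ (by linarith) hz
    have hlt : bifParam μ ^ 2 ≤ branchParam μ z ^ 2 :=
      pow_le_pow_left₀ (by linarith [two_lt_bifParam hμ]) (bifParam_lt_branchParam hμ hz).le 2
    rw [sq_bifParam hμ, branchParam, div_pow, Real.sq_sqrt hκ.le, le_div_iff₀ hκ] at hlt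
    have hyβ : (a * branchLeft μ z) ^ (2 * μ) = c * β := by
      rw [Real.mul_rpow ha0.le (branchLeft_pos hμ hz).le, hac, branchLeft_rpow hμ hz, ← hβ]
    have hexp : (2 * Real.cosh (z / 2)) ^ 2 * Real.exp z = (1 + Real.exp z) ^ 2 := by
      have h4 : Real.exp z = Real.exp (z / 2) ^ 2 := by
        rw [← Real.exp_nat_mul]; congr 1; push_cast; ring
      have h5 : Real.exp (z / 2) * Real.exp (-(z / 2)) = 1 := by rw [← Real.exp_add]; simp
      rw [Real.cosh_eq, h4]
      linear_combination
        (2 * Real.exp (z / 2) ^ 2 + Real.exp (z / 2) * Real.exp (-(z / 2)) + 1) * h5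
    -- The left side is affine in k² with slope 1 - (μ+1)β ≥ 0, so the worst case is k = `bifParam
    -- μ`. There c = 1, and the inequality becomes `bifParam μ` ≤ `branchParam μ z`.
    have hk3 : k ^ 2 * (1 - c * β) ≤ (1 + Real.exp z) ^ 2 := by
      calc k ^ 2 * (1 - c * β) = k ^ 2 * (1 - (μ + 1) * β) + 4 * ((μ + 1) * β) := by
            linear_combination (-β) * hck
        _ ≤ 4 * ((μ + 1) / μ) * (1 - (μ + 1) * β) + 4 * ((μ + 1) * β) := by
            have := mul_le_mul_of_nonneg_right hk2 (show 0 ≤ 1 - (μ + 1) * β by linarith)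
            linarith
        _ = 4 * ((μ + 1) / μ) * (1 - β) := by field_simp; ring
        _ = (4 * ((μ + 1) / μ) * κ) * Real.exp z := by rw [hβ]; ring
        _ ≤ (2 * Real.cosh (z / 2)) ^ 2 * Real.exp z :=
            mul_le_mul_of_nonneg_right hlt (Real.exp_pos z).le
        _ = _ := hexp
    have hsum : a * branchRight μ z + a * branchLeft μ z =
        a * branchLeft μ z * (1 + Real.exp z) := by
      have : branchRight μ z = Real.exp z * branchLeft μ z := by
        rw [branchLeft_eq, ← mul_assoc, ← Real.exp_add]; simp
      rw [this]; ring
    rw [hsum, field, hyβ, mul_div_assoc]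
    refine mul_le_mul_of_nonneg_left ?_ (hypos z hz).le
    rw [le_div_iff₀ hk0]
    refine le_of_sq_le_sq ?_ (by have := Real.exp_pos z; positivity)
    have hnn : 0 ≤ 1 - c * β := by
      rw [← hyβ, sub_nonneg]
      exact Real.rpow_le_one (hypos z hz).le (hy1 z hz) (by positivity)
    rw [mul_pow, Real.sq_sqrt hnn, mul_comm]
    exact hk3
  have hmono : MonotoneOn (fun z => reduced μ k (a * branchRight μ z) (a * branchLeft μ z))
      (Ioi 0) := by
    have hd := fun z (hz : 0 < z) => hasDerivAt_reduced_scaled_branch (k := k) (a := a) hμ hz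
    refine monotoneOn_of_deriv_nonneg (convex_Ioi 0)
      (fun s hs => (hd s hs).continuousAt.continuousWithinAt) (fun s hs => ?_) fun s hs => ?_
    · rw [interior_Ioi] at hs
      exact (hd s hs).differentiableAt.differentiableWithinAt
    · rw [interior_Ioi] at hs
      have hs : 0 < s := hs
      rw [(hd s hs).deriv]
      have h1 : (mcoth (μ + 1) s - mcoth 1 s) / μ ≤ 1 := by
        rw [div_le_one hμ]
        have := mcoth_sub_le one_pos (show 1 ≤ μ + 1 by linarith) hs
        linarith
      refine add_nonneg (mul_nonneg (sub_nonneg.2 (hfield s hs))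
        (mul_nonneg (hxpos s hs).le (by linarith))) (mul_nonneg (sub_nonneg.2 (hfield2 s hs))
        (mul_nonneg (jumpRate_pos hμ hs).le (add_pos (hxpos s hs) (hypos s hs)).le))
  refine le_of_tendsto (tendsto_reduced hμ hR hL) ?_
  filter_upwards [Ioo_mem_nhdsGT hz] with s hs
  exact hmono (mem_Ioi.2 hs.1) (mem_Ioi.2 hz) hs.2.le

/-! ### The minimax value as a function of the parameter `k` -/

/-- Meant for the bifurcation point, where the derivative is computed on each side separately but
its formula is continuous across. -/
lemma hasDerivAt_of_eventually_punctured {f g : ℝ → ℝ} {a : ℝ}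
    (hd : ∀ᶠ y in 𝓝[≠] a, HasDerivAt f (g y) y) (hf : ContinuousAt f a) (hg : ContinuousAt g a) :
    HasDerivAt f (g a) a := by
  rw [eventually_nhdsWithin_iff, Metric.eventually_nhds_iff_ball] at hd
  obtain ⟨ε, hε, hd⟩ := hd
  rw [Real.ball_eq_Ioo] at hd
  have hright : ∀ y ∈ Ioo a (a + ε), HasDerivAt f (g y) y := fun y hy =>
    hd y ⟨by linarith [hy.1], hy.2⟩ hy.1.ne'
  have hleft : ∀ y ∈ Ioo (a - ε) a, HasDerivAt f (g y) y := fun y hy =>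
    hd y ⟨hy.1, by linarith [hy.2]⟩ hy.2.ne
  have h1 : HasDerivWithinAt f (g a) (Ici a) a := by
    refine hasDerivWithinAt_Ici_of_tendsto_deriv (s := Ioo a (a + ε))
      (fun y hy => (hright y hy).differentiableAt.differentiableWithinAt) hf.continuousWithinAt
      (Ioo_mem_nhdsGT (by linarith)) ?_
    refine (hg.tendsto.mono_left nhdsWithin_le_nhds).congr' ?_
    filter_upwards [Ioo_mem_nhdsGT (show a < a + ε by linarith)] with y hy
    exact (hright y hy).deriv.symm
  have h2 : HasDerivWithinAt f (g a) (Iic a) a := by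
    refine hasDerivWithinAt_Iic_of_tendsto_deriv (s := Ioo (a - ε) a)
      (fun y hy => (hleft y hy).differentiableAt.differentiableWithinAt) hf.continuousWithinAt
      (Ioo_mem_nhdsLT (by linarith)) ?_
    refine (hg.tendsto.mono_left nhdsWithin_le_nhds).congr' ?_
    filter_upwards [Ioo_mem_nhdsLT (show a - ε < a by linarith)] with y hy
    exact (hleft y hy).deriv.symm
  have := h2.union h1
  rwa [Iic_union_Ici, hasDerivWithinAt_univ] at this

/-- The inverse of `branchParam`. -/
noncomputable def branchInv (μ k : ℝ) : ℝ := Function.invFunOn (branchParam μ) (Ioi 0) k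

lemma branchInv_pos {μ k : ℝ} (hμ : 0 < μ) (hk : bifParam μ < k) : 0 < branchInv μ k :=
  Function.invFunOn_mem (branchParam_surj hμ hk)

lemma branchParam_branchInv {μ k : ℝ} (hμ : 0 < μ) (hk : bifParam μ < k) :
    branchParam μ (branchInv μ k) = k :=
  Function.invFunOn_eq (branchParam_surj hμ hk)

lemma branchInv_lt_iff {μ k z : ℝ} (hμ : 0 < μ) (hk : bifParam μ < k) (hz : 0 < z) :
    branchInv μ k < z ↔ k < branchParam μ z := by
  rw [← (strictMonoOn_branchParam hμ).lt_iff_lt (mem_Ioi.2 (branchInv_pos hμ hk)) (mem_Ioi.2 hz),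
    branchParam_branchInv hμ hk]

lemma continuousAt_branchInv {μ k : ℝ} (hμ : 0 < μ) (hk : bifParam μ < k) :
    ContinuousAt (branchInv μ) k := by
  have hm : StrictMonoOn (branchInv μ) (Ioi (bifParam μ)) := fun k₁ h1 k₂ h2 h12 => by
    rw [branchInv_lt_iff hμ h1 (branchInv_pos hμ h2), branchParam_branchInv hμ h2]
    exact h12
  refine hm.continuousAt_of_image_mem_nhds (Ioi_mem_nhds hk) ?_
  filter_upwards [Ioi_mem_nhds (branchInv_pos hμ hk)] with z hz
  have hz' := bifParam_lt_branchParam hμ hz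
  refine ⟨branchParam μ z, hz', ?_⟩
  exact (strictMonoOn_branchParam hμ).injOn (mem_Ioi.2 (branchInv_pos hμ hz')) hz
    (branchParam_branchInv hμ hz')

lemma hasDerivAt_branchInv {μ k : ℝ} (hμ : 0 < μ) (hk : bifParam μ < k) :
    HasDerivAt (branchInv μ) (k * paramRate μ (branchInv μ k))⁻¹ k := by
  have hz := branchInv_pos hμ hk
  have h := hasDerivAt_branchParam hμ hz
  rw [branchParam_branchInv hμ hk] at h
  refine HasDerivAt.of_local_left_inverse (continuousAt_branchInv hμ hk) h ?_ ?_
  · have hk0 : 0 < k := by linarith [two_lt_bifParam hμ]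
    exact (mul_pos hk0 (paramRate_pos hμ hz)).ne'
  · filter_upwards [Ioi_mem_nhds hk] with y hy
    exact branchParam_branchInv hμ hy

lemma tendsto_branchInv {μ : ℝ} (hμ : 0 < μ) :
    Tendsto (branchInv μ) (𝓝[>] (bifParam μ)) (𝓝[>] 0) := by
  have h0 : ∀ᶠ k in 𝓝[>] (bifParam μ), 0 < branchInv μ k := by
    filter_upwards [self_mem_nhdsWithin] with k hk using branchInv_pos hμ hk
  refine tendsto_nhdsWithin_iff.2 ⟨?_, h0⟩
  rw [tendsto_order]
  refine ⟨fun a ha => ?_, fun a ha => ?_⟩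
  · filter_upwards [h0] with k hk using ha.trans hk
  · filter_upwards [Ioo_mem_nhdsGT (bifParam_lt_branchParam hμ ha)] with k hk
    exact (branchInv_lt_iff hμ hk.1 ha).2 hk.2

open Classical in
/-- The larger boundary value of the ground state. -/
noncomputable def critRight (μ k : ℝ) : ℝ :=
  if k ≤ bifParam μ then symVal μ k else branchRight μ (branchInv μ k)

open Classical in
/-- The smaller boundary value of the ground state. -/
noncomputable def critLeft (μ k : ℝ) : ℝ :=
  if k ≤ bifParam μ then symVal μ k else branchLeft μ (branchInv μ k)

lemma critRight_of_le {μ k : ℝ} (hk : k ≤ bifParam μ) : critRight μ k = symVal μ k := if_pos hk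

lemma critLeft_of_le {μ k : ℝ} (hk : k ≤ bifParam μ) : critLeft μ k = symVal μ k := if_pos hk

lemma critRight_of_lt {μ k : ℝ} (hk : bifParam μ < k) :
    critRight μ k = branchRight μ (branchInv μ k) := if_neg (not_le.2 hk)

lemma critLeft_of_lt {μ k : ℝ} (hk : bifParam μ < k) :
    critLeft μ k = branchLeft μ (branchInv μ k) := if_neg (not_le.2 hk)

lemma isCritical_crit {μ k : ℝ} (hμ : 0 < μ) (hk : 2 < k) :
    IsCritical μ k (critRight μ k) (critLeft μ k) := by
  rcases le_or_gt k (bifParam μ) with h | h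
  · rw [critRight_of_le h, critLeft_of_le h]
    exact isCritical_symVal hμ hk
  · rw [critRight_of_lt h, critLeft_of_lt h]
    have := isCritical_branch hμ (branchInv_pos hμ h)
    rwa [branchParam_branchInv hμ h] at this

lemma isRayMinimax_crit {μ k : ℝ} (hμ : 0 < μ) (hk : 2 < k) :
    IsRayMinimax μ k (critRight μ k) (critLeft μ k) := by
  rcases le_or_gt k (bifParam μ) with h | h
  · rw [critRight_of_le h, critLeft_of_le h]
    exact isRayMinimax_symVal hμ hk h
  · rw [critRight_of_lt h, critLeft_of_lt h]
    have := isRayMinimax_branch hμ (branchInv_pos hμ h)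
    rwa [branchParam_branchInv hμ h] at this

lemma hasDerivAt_symVal {μ k : ℝ} (hμ : 0 < μ) (hk : 2 < k) :
    HasDerivAt (symVal μ) (symVal μ k * (4 / (μ * k * (k ^ 2 - 4)))) k := by
  have h0 := one_sub_four_div_pos hk
  have hk4 : 0 < k ^ 2 - 4 := by nlinarith
  have hk0 : 0 < k := by linarith
  have h1 : HasDerivAt (fun k : ℝ => 1 - 4 / k ^ 2) (8 / k ^ 3) k := by
    refine (((hasDerivAt_const k (4 : ℝ)).div (hasDerivAt_pow 2 k)
      (pow_ne_zero 2 hk0.ne')).const_sub 1).congr_deriv ?_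
    field_simp
    norm_num
    ring
  refine (h1.rpow_const (p := 1 / (2 * μ)) (Or.inl h0.ne')).congr_deriv ?_
  rw [Real.rpow_sub_one h0.ne', symVal]
  have : k ^ 2 - 4 ≠ 0 := hk4.ne'
  have e : 1 - 4 / k ^ 2 = (k ^ 2 - 4) / k ^ 2 := by field_simp
  nth_rewrite 2 [e]
  field_simp
  norm_num

lemma sq_bifParam_sub {μ : ℝ} (hμ : 0 < μ) : bifParam μ ^ 2 - 4 = 4 / μ := by
  rw [sq_bifParam hμ]; field_simp; ring

lemma symVal_bifParam {μ : ℝ} (hμ : 0 < μ) :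
    symVal μ (bifParam μ) = (1 / (μ + 1)) ^ (1 / (2 * μ)) := by
  rw [symVal, sq_bifParam hμ]
  congr 1
  field_simp
  ring

lemma continuousAt_critRight {μ : ℝ} (hμ : 0 < μ) : ContinuousAt (critRight μ) (bifParam μ) := by
  rw [continuousAt_iff_continuous_left'_right']
  constructor
  · refine ((hasDerivAt_symVal hμ (two_lt_bifParam hμ)).continuousAt.continuousWithinAt).congr
      (fun k hk => critRight_of_le (le_of_lt hk)) (critRight_of_le le_rfl)
  · rw [ContinuousWithinAt, critRight_of_le le_rfl, symVal_bifParam hμ]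
    refine ((tendsto_branchRight hμ).comp (tendsto_branchInv hμ)).congr' ?_
    filter_upwards [self_mem_nhdsWithin] with k hk using (critRight_of_lt hk).symm

lemma continuousAt_critLeft {μ : ℝ} (hμ : 0 < μ) : ContinuousAt (critLeft μ) (bifParam μ) := by
  rw [continuousAt_iff_continuous_left'_right']
  constructor
  · refine ((hasDerivAt_symVal hμ (two_lt_bifParam hμ)).continuousAt.continuousWithinAt).congr
      (fun k hk => critLeft_of_le (le_of_lt hk)) (critLeft_of_le le_rfl)
  · rw [ContinuousWithinAt, critLeft_of_le le_rfl, symVal_bifParam hμ]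
    refine ((tendsto_branchLeft hμ).comp (tendsto_branchInv hμ)).congr' ?_
    filter_upwards [self_mem_nhdsWithin] with k hk using (critLeft_of_lt hk).symm

/-- The minimax value of the reduced action. -/
noncomputable def minimaxValue (μ k : ℝ) : ℝ := reduced μ k (critRight μ k) (critLeft μ k)

/-- The square of the jump of the ground state. -/
noncomputable def jumpSq (μ k : ℝ) : ℝ := (critRight μ k + critLeft μ k) ^ 2

open Classical in
/-- The logarithmic derivative of `jumpSq` with respect to `log k`. -/
noncomputable def jumpSqRate (μ k : ℝ) : ℝ :=
  -- The value at the bifurcation itself is immaterial: only the two one-sided limits are used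
  -- there.
  if k ≤ bifParam μ then 8 / (μ * (k ^ 2 - 4))
  else -2 * (jumpRate μ (branchInv μ k) / paramRate μ (branchInv μ k))

lemma continuousAt_minimaxValue_bifParam {μ : ℝ} (hμ : 0 < μ) :
    ContinuousAt (minimaxValue μ) (bifParam μ) := by
  have hR := continuousAt_critRight hμ
  have hL := continuousAt_critLeft hμ
  have h2 := two_lt_bifParam hμ
  have h1 := ((continuous_fieldInt hμ).continuousAt.comp hR).add
    ((continuous_fieldInt hμ).continuousAt.comp hL)
  exact h1.sub (((hR.add hL).pow 2).div (continuousAt_const.mul continuousAt_id)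
    (mul_ne_zero two_ne_zero (show bifParam μ ≠ 0 by linarith)))

lemma continuousAt_jumpSq_bifParam {μ : ℝ} (hμ : 0 < μ) : ContinuousAt (jumpSq μ) (bifParam μ) :=
  ((continuousAt_critRight hμ).add (continuousAt_critLeft hμ)).pow 2

/-- Envelope theorem: at a critical point the variations of X and Y contribute nothing, and only the
explicit dependence on k survives. -/
lemma IsCritical.hasDerivAt_reduced {μ k x' y' : ℝ} (hμ : 0 < μ) (hk : k ≠ 0) {X Y : ℝ → ℝ}
    (h : IsCritical μ k (X k) (Y k)) (hX : HasDerivAt X x' k) (hY : HasDerivAt Y y' k) :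
    HasDerivAt (fun k => reduced μ k (X k) (Y k)) ((X k + Y k) ^ 2 / (2 * k ^ 2)) k := by
  have h1 := (hasDerivAt_fieldInt hμ (X k)).comp k hX
  have h2 := (hasDerivAt_fieldInt hμ (Y k)).comp k hY
  have h3 := ((hX.add hY).pow 2).div ((hasDerivAt_id k).const_mul 2)
    (mul_ne_zero two_ne_zero hk)
  refine ((h1.add h2).sub h3).congr_deriv ?_
  rw [h.field_left, h.field_right]
  simp only [Pi.add_apply, Pi.pow_apply, Nat.cast_ofNat, Nat.add_one_sub_one, pow_one, id]
  field_simp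
  ring

lemma hasDerivAt_crit_branch {μ k : ℝ} (hμ : 0 < μ) (hk : bifParam μ < k) :
    HasDerivAt (fun k => branchRight μ (branchInv μ k)) (branchRight μ (branchInv μ k) *
      ((1 - (mcoth (μ + 1) (branchInv μ k) - mcoth 1 (branchInv μ k)) / μ) / 2) *
      (k * paramRate μ (branchInv μ k))⁻¹) k ∧
    HasDerivAt (fun k => branchLeft μ (branchInv μ k)) (branchLeft μ (branchInv μ k) *
      ((-1 - (mcoth (μ + 1) (branchInv μ k) - mcoth 1 (branchInv μ k)) / μ) / 2) *
      (k * paramRate μ (branchInv μ k))⁻¹) k :=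
  ⟨(hasDerivAt_branchRight hμ (branchInv_pos hμ hk)).comp k (hasDerivAt_branchInv hμ hk),
    (hasDerivAt_branchLeft hμ (branchInv_pos hμ hk)).comp k (hasDerivAt_branchInv hμ hk)⟩

lemma hasDerivAt_minimaxValue_of_ne {μ k : ℝ} (hμ : 0 < μ) (hk : 2 < k) (hne : k ≠ bifParam μ) :
    HasDerivAt (minimaxValue μ) (jumpSq μ k / (2 * k ^ 2)) k := by
  have hk0 : k ≠ 0 := by linarith
  rcases lt_or_gt_of_ne hne with h | h
  · have h1 := (isCritical_symVal hμ hk).hasDerivAt_reduced hμ hk0 (hasDerivAt_symVal hμ hk)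
      (hasDerivAt_symVal hμ hk)
    rw [jumpSq, critRight_of_le h.le, critLeft_of_le h.le]
    refine h1.congr_of_eventuallyEq ?_
    filter_upwards [Iio_mem_nhds h] with y hy
    rw [minimaxValue, critRight_of_le (le_of_lt hy), critLeft_of_le (le_of_lt hy)]
  · have hc := isCritical_crit hμ hk
    rw [critRight_of_lt h, critLeft_of_lt h] at hc
    obtain ⟨hR, hL⟩ := hasDerivAt_crit_branch hμ h
    have h1 := hc.hasDerivAt_reduced hμ hk0 (X := fun k => branchRight μ (branchInv μ k))
      (Y := fun k => branchLeft μ (branchInv μ k)) hR hL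
    rw [jumpSq, critRight_of_lt h, critLeft_of_lt h]
    refine h1.congr_of_eventuallyEq ?_
    filter_upwards [Ioi_mem_nhds h] with y hy
    rw [minimaxValue, critRight_of_lt hy, critLeft_of_lt hy]

lemma hasDerivAt_minimaxValue {μ k : ℝ} (hμ : 0 < μ) (hk : 2 < k) :
    HasDerivAt (minimaxValue μ) (jumpSq μ k / (2 * k ^ 2)) k := by
  rcases eq_or_ne k (bifParam μ) with rfl | hne
  · refine hasDerivAt_of_eventually_punctured (g := fun k => jumpSq μ k / (2 * k ^ 2)) ?_
      (continuousAt_minimaxValue_bifParam hμ) ?_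
    · filter_upwards [self_mem_nhdsWithin, nhdsWithin_le_nhds (Ioi_mem_nhds hk)] with y hy hy2
      exact hasDerivAt_minimaxValue_of_ne hμ hy2 hy
    · exact (continuousAt_jumpSq_bifParam hμ).div (by fun_prop) (by positivity)
  · exact hasDerivAt_minimaxValue_of_ne hμ hk hne

lemma hasDerivAt_jumpSq {μ k : ℝ} (hμ : 0 < μ) (hk : 2 < k) (hne : k ≠ bifParam μ) :
    HasDerivAt (jumpSq μ) (jumpSq μ k * jumpSqRate μ k / k) k := by
  have hk0 : k ≠ 0 := by linarith
  rcases lt_or_gt_of_ne hne with h | h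
  · have h1 := ((hasDerivAt_symVal hμ hk).add (hasDerivAt_symVal hμ hk)).pow 2
    rw [jumpSq, critRight_of_le h.le, critLeft_of_le h.le, jumpSqRate, if_pos h.le]
    refine (h1.congr_deriv ?_).congr_of_eventuallyEq ?_
    · have : k ^ 2 - 4 ≠ 0 := by nlinarith
      simp only [Pi.add_apply, Nat.cast_ofNat, Nat.add_one_sub_one, pow_one]
      field_simp
      ring
    · filter_upwards [Iio_mem_nhds h] with y hy
      simp only [jumpSq, Pi.add_apply, Pi.pow_apply]
      rw [critRight_of_le (le_of_lt hy), critLeft_of_le (le_of_lt hy)]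
  · obtain ⟨hR, hL⟩ := hasDerivAt_crit_branch hμ h
    have h1 := (hR.add hL).pow 2
    rw [jumpSq, critRight_of_lt h, critLeft_of_lt h, jumpSqRate, if_neg (not_le.2 h)]
    have hB := paramRate_pos hμ (branchInv_pos hμ h)
    refine (h1.congr_deriv ?_).congr_of_eventuallyEq ?_
    · have hl := branch_log_deriv (μ := μ) (z := branchInv μ k)
      simp only [Pi.add_apply, Nat.cast_ofNat, Nat.add_one_sub_one, pow_one]
      rw [← add_mul, hl]
      field_simp
    · filter_upwards [Ioi_mem_nhds h] with y hy
      simp only [jumpSq, Pi.add_apply, Pi.pow_apply]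
      rw [critRight_of_lt hy, critLeft_of_lt hy]

lemma tendsto_jumpSqRate_left {μ : ℝ} (hμ : 0 < μ) :
    Tendsto (jumpSqRate μ) (𝓝[<] (bifParam μ)) (𝓝 2) := by
  have h0 := sq_bifParam_sub hμ
  have h1 : ContinuousAt (fun k : ℝ => 8 / (μ * (k ^ 2 - 4))) (bifParam μ) := by
    refine continuousAt_const.div (by fun_prop) ?_
    rw [h0]; positivity
  have h2 := h1.tendsto.mono_left (nhdsWithin_le_nhds (s := Iio (bifParam μ)))
  rw [h0, mul_div_cancel₀ _ hμ.ne', show (8 : ℝ) / 4 = 2 by norm_num] at h2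
  refine h2.congr' ?_
  filter_upwards [self_mem_nhdsWithin] with k hk using (if_pos (le_of_lt hk)).symm

lemma tendsto_jumpSqRate_right {μ : ℝ} (hμ : 0 < μ) :
    Tendsto (jumpSqRate μ) (𝓝[>] (bifParam μ)) (𝓝 (-2 * ((2 * μ + 1) / (4 * μ + 5)))) := by
  have h2 := ((tendsto_jumpRate_div_paramRate hμ).comp (tendsto_branchInv hμ)).const_mul (-2)
  refine h2.congr' ?_
  filter_upwards [self_mem_nhdsWithin] with k hk using (if_neg (not_le.2 hk)).symm

/-! ### Positivity and bounds for the minimax value and the jump -/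

/-- On [0, x] replace √(1 - s^{2μ}) by its smallest value, taken at s = x. -/
lemma mul_field_div_two_lt_fieldInt {μ x : ℝ} (hμ : 0 < μ) (hx : 0 < x) (hx1 : x ≤ 1) :
    x * field μ x / 2 < fieldInt μ x := by
  have e : x * field μ x / 2 = ∫ s in (0 : ℝ)..x, s * √(1 - x ^ (2 * μ)) := by
    rw [intervalIntegral.integral_mul_const, integral_id, field]; ring
  rw [e, fieldInt]
  refine intervalIntegral.integral_lt_integral_of_continuousOn_of_le_of_exists_lt hx
    (by fun_prop) (continuous_field hμ).continuousOn (fun s hs => ?_)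
    ⟨x / 2, ⟨by linarith, by linarith⟩, ?_⟩
  · refine mul_le_mul_of_nonneg_left (Real.sqrt_le_sqrt ?_) hs.1.le
    have := Real.rpow_le_rpow hs.1.le hs.2 (show 0 ≤ 2 * μ by positivity)
    linarith
  · refine mul_lt_mul_of_pos_left (Real.sqrt_lt_sqrt ?_ ?_) (by linarith)
    · have := Real.rpow_le_one hx.le hx1 (show 0 ≤ 2 * μ by positivity)
      linarith
    · have := Real.rpow_lt_rpow (show 0 ≤ x / 2 by positivity) (half_lt_self hx)
        (show 0 < 2 * μ by positivity)
      linarith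

lemma fieldInt_le {μ x : ℝ} (hμ : 0 < μ) (hx : 0 ≤ x) : fieldInt μ x ≤ x ^ 2 / 2 := by
  have e : x ^ 2 / 2 = ∫ s in (0 : ℝ)..x, s := by rw [integral_id]; ring
  rw [e, fieldInt]
  refine intervalIntegral.integral_mono_on hx ((continuous_field hμ).intervalIntegrable _ _)
    (continuous_id.intervalIntegrable _ _) fun s hs => ?_
  refine mul_le_of_le_one_right hs.1 (Real.sqrt_le_one.2 ?_)
  have := Real.rpow_nonneg hs.1 (2 * μ)
  linarith

/-- Criticality splits the jump term into x · `field μ x`/2 + y · `field μ y`/2, and each half is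
smaller than the corresponding `fieldInt`. -/
lemma IsCritical.reduced_pos {μ k x y : ℝ} (hμ : 0 < μ) (hk : k ≠ 0) (h : IsCritical μ k x y) :
    0 < reduced μ k x y := by
  have h1 := mul_field_div_two_lt_fieldInt hμ h.left_mem.1 h.left_mem.2.le
  have h2 := mul_field_div_two_lt_fieldInt hμ h.right_mem.1 h.right_mem.2.le
  rw [h.field_left] at h1
  rw [h.field_right] at h2
  have e : (x + y) ^ 2 / (2 * k) = x * ((x + y) / k) / 2 + y * ((x + y) / k) / 2 := by
    field_simp
  unfold reduced
  linarith

lemma minimaxValue_pos {μ k : ℝ} (hμ : 0 < μ) (hk : 2 < k) : 0 < minimaxValue μ k :=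
  (isCritical_crit hμ hk).reduced_pos hμ (by linarith)

lemma jumpSq_pos {μ k : ℝ} (hμ : 0 < μ) (hk : 2 < k) : 0 < jumpSq μ k :=
  pow_pos (add_pos (isCritical_crit hμ hk).left_mem.1 (isCritical_crit hμ hk).right_mem.1) 2

lemma jumpSq_le {μ k : ℝ} (hμ : 0 < μ) (hk : 2 < k) : jumpSq μ k ≤ 4 := by
  have h := isCritical_crit hμ hk
  have h1 := h.left_mem
  have h2 := h.right_mem
  unfold jumpSq
  nlinarith [h1.1, h1.2, h2.1, h2.2]

lemma minimaxValue_mono {μ k l : ℝ} (hμ : 0 < μ) (hk : 2 < k) (hkl : k ≤ l) :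
    minimaxValue μ k ≤ minimaxValue μ l := by
  have hm : MonotoneOn (minimaxValue μ) (Ioi 2) := by
    refine monotoneOn_of_deriv_nonneg (convex_Ioi 2)
      (fun k hk => (hasDerivAt_minimaxValue hμ hk).continuousAt.continuousWithinAt)
      (fun k hk => ?_) fun k hk => ?_
    · rw [interior_Ioi] at hk
      exact (hasDerivAt_minimaxValue hμ hk).differentiableAt.differentiableWithinAt
    · rw [interior_Ioi] at hk
      rw [(hasDerivAt_minimaxValue hμ hk).deriv]
      have := jumpSq_pos hμ hk
      positivity
  exact hm (mem_Ioi.2 hk) (mem_Ioi.2 (hk.trans_le hkl)) hkl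

/-- The second derivative of `d`, up to the positive factor `((μ+1)/λ)^{1/μ} ω^{1/μ - 3/2}`. -/
noncomputable def curvature (μ k : ℝ) : ℝ :=
  (1 / μ ^ 2 - 1 / 4) * minimaxValue μ k +
    jumpSq μ k / (2 * k) * (1 / μ - 1 / 4 + jumpSqRate μ k / 4)

/-- The value of `curvature` at the bifurcation when `jumpSqRate` is replaced by `R`. -/
noncomputable def bifCurvature (μ R : ℝ) : ℝ :=
  (1 / μ ^ 2 - 1 / 4) * minimaxValue μ (bifParam μ) +
    jumpSq μ (bifParam μ) / (2 * bifParam μ) * (1 / μ - 1 / 4 + R / 4)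

lemma tendsto_curvature {μ R : ℝ} (hμ : 0 < μ) {l : Filter ℝ} (hl : l ≤ 𝓝 (bifParam μ))
    (hR : Tendsto (jumpSqRate μ) l (𝓝 R)) : Tendsto (curvature μ) l (𝓝 (bifCurvature μ R)) := by
  have h2 := two_lt_bifParam hμ
  have hD := (continuousAt_minimaxValue_bifParam hμ).tendsto.mono_left hl
  have hP : Tendsto (fun k => jumpSq μ k / (2 * k)) l
      (𝓝 (jumpSq μ (bifParam μ) / (2 * bifParam μ))) :=
    ((continuousAt_jumpSq_bifParam hμ).div (continuousAt_const.mul continuousAt_id)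
      (mul_ne_zero two_ne_zero (show bifParam μ ≠ 0 by linarith))).tendsto.mono_left hl
  exact (hD.const_mul _).add (hP.mul ((hR.div_const 4).const_add _))

/-! ### Sign of the curvature on the two branches -/

lemma one_div_sq_sub_quarter_nonneg {μ : ℝ} (hμ : 0 < μ) (hμ2 : μ ≤ 2) : 0 ≤ 1 / μ ^ 2 - 1 / 4 := by
  rw [sub_nonneg]
  exact one_div_le_one_div_of_le (by positivity) (by nlinarith)

lemma two_le_symmetric_rate {μ k : ℝ} (hμ : 0 < μ) (hk : 2 < k) (hkb : k ≤ bifParam μ) :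
    2 ≤ 8 / (μ * (k ^ 2 - 4)) := by
  have h1 : 0 < k ^ 2 - 4 := by nlinarith
  have h2 : k ^ 2 - 4 ≤ 4 / μ := by
    rw [← sq_bifParam_sub hμ]
    have := pow_le_pow_left₀ (show 0 ≤ k by linarith) hkb 2
    linarith
  rw [le_div_iff₀ hμ] at h2
  rw [le_div_iff₀ (by positivity)]
  linarith

/-- On the symmetric branch the curvature is positive. -/
lemma symmetric_curvature_pos {μ k R : ℝ} (hμ : 0 < μ) (hk : 2 < k) (hkb : k ≤ bifParam μ)
    (hR : 2 ≤ R) : 0 < (1 / μ ^ 2 - 1 / 4) * minimaxValue μ k +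
      jumpSq μ k / (2 * k) * (1 / μ - 1 / 4 + R / 4) := by
  have hD := minimaxValue_pos hμ hk
  have hP := jumpSq_pos hμ hk
  have hk0 : 0 < k := by linarith
  have hq : 0 < jumpSq μ k / (2 * k) := by positivity
  have hμi : 0 < 1 / μ := by positivity
  rcases le_or_gt μ 2 with h | h
  · have h1 := mul_nonneg (one_div_sq_sub_quarter_nonneg hμ h) hD.le
    have h2 := mul_pos hq (show 0 < 1 / μ - 1 / 4 + R / 4 by linarith)
    linarith
  -- For μ > 2 the coefficient of D is negative but above -1/4. Let x be the symmetric value.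
  -- Bounding `field` by the identity gives D ≤ x²(1 - 2/k), and this is at most x²(2/k) = P/(2k)
  -- because k ≤ `bifParam μ` < 4; the second term, with bracket above 1/4, then compensates.
  · have hx := symVal_pos (μ := μ) hk
    have hDle : minimaxValue μ k ≤ symVal μ k ^ 2 * (1 - 2 / k) := by
      rw [minimaxValue, critRight_of_le hkb, critLeft_of_le hkb, reduced]
      have h1 := fieldInt_le hμ hx.le
      have e : (symVal μ k + symVal μ k) ^ 2 / (2 * k) = symVal μ k ^ 2 * (2 / k) := by
        field_simp; ring
      rw [e]
      linarith
    have hPe : jumpSq μ k / (2 * k) = symVal μ k ^ 2 * (2 / k) := by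
      rw [jumpSq, critRight_of_le hkb, critLeft_of_le hkb]
      field_simp; ring
    have ht : 1 / 2 < 2 / k := by
      rw [div_lt_div_iff₀ two_pos hk0]
      have h1 : k ^ 2 < 4 ^ 2 := by
        refine lt_of_le_of_lt (pow_le_pow_left₀ hk0.le hkb 2) ?_
        have h2 : (μ + 1) / μ < 2 := by rw [div_lt_iff₀ hμ]; linarith
        rw [sq_bifParam hμ]; linarith
      have := lt_of_pow_lt_pow_left₀ 2 (by norm_num) h1
      linarith
    have hm : 0 ≤ 1 / μ ^ 2 := by positivity
    rw [hPe]
    have a1 : symVal μ k ^ 2 * (2 / k) * (1 / 4) <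
        symVal μ k ^ 2 * (2 / k) * (1 / μ - 1 / 4 + R / 4) :=
      mul_lt_mul_of_pos_left (by linarith) (by positivity)
    have a2 : symVal μ k ^ 2 * (1 - 2 / k) ≤ symVal μ k ^ 2 * (2 / k) :=
      mul_le_mul_of_nonneg_left (by linarith) (sq_nonneg _)
    have a3 : 0 ≤ 1 / μ ^ 2 * minimaxValue μ k := by positivity
    linarith

lemma curvature_pos_of_lt {μ k : ℝ} (hμ : 0 < μ) (hk : 2 < k) (hkb : k < bifParam μ) :
    0 < curvature μ k := by
  refine symmetric_curvature_pos hμ hk hkb.le ?_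
  rw [jumpSqRate, if_pos hkb.le]
  exact two_le_symmetric_rate hμ hk hkb.le

lemma curvature_pos_of_gt {μ k : ℝ} (hμ : 0 < μ) (hμ2 : μ ≤ 2) (hkb : bifParam μ < k) :
    0 < curvature μ k := by
  have hk : 2 < k := (two_lt_bifParam hμ).trans hkb
  have hD := minimaxValue_pos hμ hk
  have hP := jumpSq_pos hμ hk
  have hq : 0 < jumpSq μ k / (2 * k) := by positivity
  have h1 := mul_nonneg (one_div_sq_sub_quarter_nonneg hμ hμ2) hD.le
  have hz := branchInv_pos hμ hkb
  have h2 : jumpRate μ (branchInv μ k) / paramRate μ (branchInv μ k) < 2 / μ - 1 / 2 := by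
    rw [div_lt_iff₀ (paramRate_pos hμ hz), mul_comm]
    exact jumpRate_lt hμ hμ2 hz
  have h3 : 2 / μ = 2 * (1 / μ) := by ring
  have h4 := mul_pos hq (show 0 < 1 / μ - 1 / 4 + jumpSqRate μ k / 4 by
    rw [jumpSqRate, if_neg (not_le.2 hkb)]; linarith)
  unfold curvature
  linarith

/-- D stays above its value at the bifurcation, so the first term is at most a constant -e < 0. The
boundary values are below 1, hence P ≤ 4 and the second term is at most 1/(2k). -/
lemma curvature_neg_of_large {μ : ℝ} (hμ : 2 < μ) :
    ∃ k₁, bifParam μ ≤ k₁ ∧ ∀ k, k₁ < k → curvature μ k < 0 := by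
  have hμ0 : 0 < μ := by linarith
  have hb := two_lt_bifParam hμ0
  have hD := minimaxValue_pos hμ0 hb
  have hq : 1 / μ ^ 2 < 1 / 4 := one_div_lt_one_div_of_lt (by norm_num) (by nlinarith)
  set e := (1 / 4 - 1 / μ ^ 2) * minimaxValue μ (bifParam μ) with he
  have he0 : 0 < e := mul_pos (by linarith) hD
  refine ⟨max (bifParam μ) (1 / e), le_max_left _ _, fun k hk => ?_⟩
  have hkb : bifParam μ < k := (le_max_left _ _).trans_lt hk
  have hke : 1 / e < k := (le_max_right _ _).trans_lt hk
  have hk2 : 2 < k := hb.trans hkb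
  have hz := branchInv_pos hμ0 hkb
  have h1 : e ≤ (1 / 4 - 1 / μ ^ 2) * minimaxValue μ k :=
    mul_le_mul_of_nonneg_left (minimaxValue_mono hμ0 hb hkb.le) (by linarith)
  have h2 : 1 / μ - 1 / 4 + jumpSqRate μ k / 4 ≤ 1 / 4 := by
    rw [jumpSqRate, if_neg (not_le.2 hkb)]
    have h3 := div_pos (jumpRate_pos hμ0 hz) (paramRate_pos hμ0 hz)
    have h4 : 1 / μ ≤ 1 / 2 := one_div_le_one_div_of_le two_pos hμ.le
    linarith
  have hP := jumpSq_pos hμ0 hk2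
  have h5 : jumpSq μ k / (2 * k) * (1 / μ - 1 / 4 + jumpSqRate μ k / 4) ≤ 1 / (2 * k) := by
    calc _ ≤ jumpSq μ k / (2 * k) * (1 / 4) :=
          mul_le_mul_of_nonneg_left h2 (by positivity)
      _ = jumpSq μ k * (1 / (8 * k)) := by field_simp; ring
      _ ≤ 4 * (1 / (8 * k)) := mul_le_mul_of_nonneg_right (jumpSq_le hμ0 hk2) (by positivity)
      _ = 1 / (2 * k) := by field_simp; ring
  have h6 : 1 / (2 * k) < e := by
    rw [div_lt_iff₀ he0] at hke
    rw [div_lt_iff₀ (by positivity)]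
    nlinarith
  unfold curvature
  linarith

/-! ### The sign of the right limit of the second derivative at the bifurcation -/

/-- With x the symmetric boundary value at the bifurcation, 1 - (xs)^{2μ} = μ/(μ+1) · (1 + `excess μ
s`). -/
noncomputable def excess (μ s : ℝ) : ℝ := (1 - s ^ (2 * μ)) / μ

/-- The ratio of the minimax value to `jumpSq / (2k)` at the bifurcation. -/
noncomputable def bifRatio (μ : ℝ) : ℝ := ∫ s in (0 : ℝ)..1, 2 * s * (√(1 + excess μ s) - 1)

lemma excess_nonneg {μ s : ℝ} (hμ : 0 < μ) (hs : s ∈ Icc (0 : ℝ) 1) : 0 ≤ excess μ s :=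
  div_nonneg (sub_nonneg.2 (Real.rpow_le_one hs.1 hs.2 (by positivity))) hμ.le

lemma continuous_excess {μ : ℝ} (hμ : 0 < μ) : Continuous (excess μ) :=
  (continuous_const.sub (Real.continuous_rpow_const (by positivity))).div_const μ

lemma mul_excess_mono {μ ν s : ℝ} (hμ : 0 < μ) (hμν : μ ≤ ν) (hs : s ∈ Icc (0 : ℝ) 1) :
    μ / ν * excess μ s ≤ excess ν s := by
  have hν := hμ.trans_le hμν
  unfold excess
  rw [show μ / ν * ((1 - s ^ (2 * μ)) / μ) = (1 - s ^ (2 * μ)) / ν by field_simp]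
  refine div_le_div_of_nonneg_right ?_ hν.le
  have : s ^ (2 * ν) ≤ s ^ (2 * μ) :=
    Real.rpow_le_rpow_of_exponent_ge' hs.1 hs.2 (by positivity) (by linarith)
  linarith

/-- Concavity of w ↦ √(1 + w) - 1, which vanishes at w = 0. -/
lemma mul_sqrt_sub_one_le {θ w : ℝ} (hθ : 0 ≤ θ) (hθ1 : θ ≤ 1) (hw : 0 ≤ w) :
    θ * (√(1 + w) - 1) ≤ √(1 + θ * w) - 1 := by
  have h1 : 1 ≤ √(1 + w) := Real.one_le_sqrt.2 (by linarith)
  have h2 := Real.sq_sqrt (show 0 ≤ 1 + w by linarith)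
  rw [le_sub_iff_add_le]
  refine Real.le_sqrt_of_sq_le ?_
  have h3 : 0 ≤ θ * (1 - θ) * (√(1 + w) - 1) ^ 2 :=
    mul_nonneg (mul_nonneg hθ (by linarith)) (sq_nonneg _)
  linear_combination h3 + θ * h2

/-- For each s in [0, 1], μ · `excess μ s` is nondecreasing in μ. Concavity of the square root then
moves the factor μ/ν from inside the root to the outside. -/
lemma mul_bifRatio_mono {μ ν : ℝ} (hμ : 0 < μ) (hμν : μ ≤ ν) :
    μ * bifRatio μ ≤ ν * bifRatio ν := by
  have hν := hμ.trans_le hμν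
  have hc : ∀ μ : ℝ, 0 < μ → Continuous fun s => 2 * s * (√(1 + excess μ s) - 1) := fun μ hμ => by
    have := continuous_excess hμ
    fun_prop
  have h : μ / ν * bifRatio μ ≤ bifRatio ν := by
    unfold bifRatio
    rw [← intervalIntegral.integral_const_mul]
    refine intervalIntegral.integral_mono_on zero_le_one
      ((continuous_const.mul (hc μ hμ)).intervalIntegrable _ _)
      ((hc ν hν).intervalIntegrable _ _) fun s hs => ?_
    have h1 := mul_sqrt_sub_one_le (div_nonneg hμ.le hν.le) ((div_le_one hν).2 hμν)
      (excess_nonneg hμ hs)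
    have h2 := Real.sqrt_le_sqrt (add_le_add_right (mul_excess_mono hμ hμν hs) 1)
    have h3 := mul_le_mul_of_nonneg_left (h1.trans (sub_le_sub_right h2 1))
      (show 0 ≤ 2 * s by linarith [hs.1])
    linarith
  rw [div_mul_eq_mul_div, div_le_iff₀ hν] at h
  linarith

lemma continuousOn_bifRatio : ContinuousOn bifRatio (Ici 1) := by
  -- Truncating μ below at 1 keeps the exponent and the denominator positive, so the integrand is
  -- jointly continuous on the whole plane.
  have h : Continuous fun μ : ℝ => ∫ s in (0 : ℝ)..1, 2 * s * (√(1 + excess (max μ 1) s) - 1) := by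
    apply intervalIntegral.continuous_parametric_intervalIntegral_of_continuous'
    have hm : ∀ x : ℝ × ℝ, 0 < max x.1 1 := fun x => lt_max_of_lt_right one_pos
    have h1 : Continuous fun x : ℝ × ℝ => x.2 ^ (2 * max x.1 1) :=
      continuous_snd.rpow (by fun_prop) fun x => Or.inr (by have := hm x; positivity)
    have h2 : Continuous fun x : ℝ × ℝ => excess (max x.1 1) x.2 :=
      (continuous_const.sub h1).div (by fun_prop) fun x => (hm x).ne'
    change Continuous fun x : ℝ × ℝ => 2 * x.2 * (√(1 + excess (max x.1 1) x.2) - 1)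
    fun_prop
  refine h.continuousOn.congr fun μ hμ => ?_
  simp only [max_eq_left (mem_Ici.1 hμ), bifRatio]

lemma jumpSq_bif (μ : ℝ) : jumpSq μ (bifParam μ) / (2 * bifParam μ) =
    symVal μ (bifParam μ) ^ 2 * (2 / bifParam μ) := by
  rw [jumpSq, critRight_of_le le_rfl, critLeft_of_le le_rfl]
  rcases eq_or_ne (bifParam μ) 0 with h | h
  · simp [h]
  · field_simp; ring

/-- Rescaling the variable of `fieldInt` by the boundary value x extracts the factor x² · 2/k, which
is also the jump term; as 2s has integral 1 over [0, 1], subtracting that term puts the -1 inside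
`bifRatio`. -/
lemma minimaxValue_bif {μ : ℝ} (hμ : 0 < μ) : minimaxValue μ (bifParam μ) =
    jumpSq μ (bifParam μ) / (2 * bifParam μ) * bifRatio μ := by
  have hk := two_lt_bifParam hμ
  have hk0 : 0 < bifParam μ := by linarith
  rw [jumpSq_bif, minimaxValue, critRight_of_le le_rfl, critLeft_of_le le_rfl, reduced]
  have hxr : symVal μ (bifParam μ) ^ (2 * μ) = 1 / (μ + 1) := by
    rw [symVal_rpow hμ hk, sq_bifParam hμ]; field_simp; ring
  have hx := symVal_pos (μ := μ) hk
  set x := symVal μ (bifParam μ)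
  set t := 2 / bifParam μ with ht
  have ht0 : 0 < t := by positivity
  have ht2 : t ^ 2 = μ / (μ + 1) := by
    rw [ht, div_pow, sq_bifParam hμ]; field_simp; norm_num
  have h1 : fieldInt μ x = x ^ 2 * t * ∫ s in (0 : ℝ)..1, s * √(1 + excess μ s) := by
    have h2 := intervalIntegral.mul_integral_comp_mul_left (a := 0) (b := 1) (f := field μ) x
    rw [mul_zero, mul_one] at h2
    rw [fieldInt, ← h2, ← intervalIntegral.integral_const_mul,
      ← intervalIntegral.integral_const_mul]
    refine intervalIntegral.integral_congr fun s hs => ?_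
    rw [uIcc_of_le zero_le_one] at hs
    have e : 1 - (x * s) ^ (2 * μ) = t ^ 2 * (1 + excess μ s) := by
      rw [Real.mul_rpow hx.le hs.1, hxr, ht2, excess]
      field_simp
      ring
    simp only [field]
    rw [e, Real.sqrt_mul (sq_nonneg t), Real.sqrt_sq ht0.le]
    ring
  have hc := continuous_excess hμ
  have h3 : bifRatio μ = 2 * (∫ s in (0 : ℝ)..1, s * √(1 + excess μ s)) - 1 := by
    have e : ∀ s : ℝ, 2 * s * (√(1 + excess μ s) - 1) = 2 * (s * √(1 + excess μ s)) - 2 * s :=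
      fun s => by ring
    simp only [bifRatio, e]
    rw [intervalIntegral.integral_sub
      (Continuous.intervalIntegrable (by fun_prop) _ _)
      (Continuous.intervalIntegrable (by fun_prop) _ _),
      intervalIntegral.integral_const_mul, intervalIntegral.integral_const_mul, integral_id]
    norm_num
  have h4 : (x + x) ^ 2 / (2 * bifParam μ) = x ^ 2 * t := by rw [ht]; field_simp; ring
  rw [h1, h3, h4]
  ring

lemma bifRatio_pos {μ : ℝ} (hμ : 0 < μ) : 0 < bifRatio μ := by
  have hk := two_lt_bifParam hμ
  have h := minimaxValue_pos hμ hk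
  rw [minimaxValue_bif hμ] at h
  have := jumpSq_pos hμ hk
  exact (mul_pos_iff_of_pos_left (by positivity)).1 h

/-- The sign of the right limit of the second derivative at the bifurcation. -/
noncomputable def signFun (μ : ℝ) : ℝ :=
  (1 / μ ^ 2 - 1 / 4) * bifRatio μ + (1 / μ - (8 * μ + 7) / (4 * (4 * μ + 5)))

lemma bifCurvature_right {μ : ℝ} (hμ : 0 < μ) :
    bifCurvature μ (-2 * ((2 * μ + 1) / (4 * μ + 5))) =
      jumpSq μ (bifParam μ) / (2 * bifParam μ) * signFun μ := by
  rw [bifCurvature, minimaxValue_bif hμ, signFun]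
  have : 1 / μ - 1 / 4 + -2 * ((2 * μ + 1) / (4 * μ + 5)) / 4 =
      1 / μ - (8 * μ + 7) / (4 * (4 * μ + 5)) := by
    field_simp; ring
  rw [this]
  ring

lemma signFun_pos_of_le {μ : ℝ} (hμ : 0 < μ) (hμ2 : μ ≤ 2) : 0 < signFun μ := by
  have h1 := mul_nonneg (one_div_sq_sub_quarter_nonneg hμ hμ2) (bifRatio_pos hμ).le
  have h2 : 1 / 2 ≤ 1 / μ := one_div_le_one_div_of_le hμ hμ2
  have h3 : (8 * μ + 7) / (4 * (4 * μ + 5)) < 1 / 2 := by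
    rw [div_lt_div_iff₀ (by positivity) two_pos]; linarith
  unfold signFun
  linarith

lemma signFun_neg_of_ge {μ : ℝ} (hμ : 5 / 2 ≤ μ) : signFun μ < 0 := by
  have hμ0 : 0 < μ := by linarith
  have h1 : 1 / μ ^ 2 ≤ 1 / 4 := one_div_le_one_div_of_le (by norm_num) (by nlinarith)
  have h2 := mul_nonneg (sub_nonneg.2 h1) (bifRatio_pos hμ0).le
  have h3 : 1 / μ ≤ 2 / 5 := by
    rw [div_le_div_iff₀ hμ0 (by norm_num)]; linarith
  have h4 : 2 / 5 < (8 * μ + 7) / (4 * (4 * μ + 5)) := by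
    rw [div_lt_div_iff₀ (by norm_num) (by positivity)]; linarith
  unfold signFun
  linarith

/-- The first term of `signFun` is minus the product of (μ² - 4)/(4μ³) and μ · `bifRatio μ`, both
nonnegative and nondecreasing on this interval. Strictness comes from 1/μ. -/
lemma strictAntiOn_signFun : StrictAntiOn signFun (Icc 2 (5 / 2)) := by
  intro a ha b hb hab
  have ha0 : 0 < a := by linarith [ha.1]
  have hb0 : 0 < b := by linarith [hb.1]
  have e : ∀ μ : ℝ, 0 < μ → (1 / μ ^ 2 - 1 / 4) * bifRatio μ =
      -((μ ^ 2 - 4) / (4 * μ ^ 3) * (μ * bifRatio μ)) := fun μ hμ => by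
    field_simp; ring
  have h1 : (a ^ 2 - 4) / (4 * a ^ 3) ≤ (b ^ 2 - 4) / (4 * b ^ 3) := by
    rw [div_le_div_iff₀ (by positivity) (by positivity)]
    -- (μ² - 4)/μ³ increases as long as μ² ≤ 12, since its derivative is (12 - μ²)/μ⁴.
    have hab2 : a * b ≤ 12 := by nlinarith [ha.1, ha.2, hb.1, hb.2]
    have h2 : 0 ≤ 4 * (a ^ 2 + a * b + b ^ 2) - a ^ 2 * b ^ 2 := by
      nlinarith [mul_nonneg (mul_pos ha0 hb0).le (sub_nonneg.2 hab2), sq_nonneg (a - b)]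
    linear_combination 4 * mul_nonneg (sub_nonneg.2 hab.le) h2
  have h2 := mul_bifRatio_mono ha0 hab.le
  have h3 : (a ^ 2 - 4) / (4 * a ^ 3) * (a * bifRatio a) ≤
      (b ^ 2 - 4) / (4 * b ^ 3) * (b * bifRatio b) := by
    refine mul_le_mul h1 h2 (mul_pos ha0 (bifRatio_pos ha0)).le ?_
    exact div_nonneg (by nlinarith [hb.1]) (by positivity)
  have h4 : 1 / b < 1 / a := one_div_lt_one_div_of_lt ha0 hab
  have h5 : (8 * a + 7) / (4 * (4 * a + 5)) ≤ (8 * b + 7) / (4 * (4 * b + 5)) := by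
    rw [div_le_div_iff₀ (by positivity) (by positivity)]; nlinarith
  unfold signFun
  rw [e a ha0, e b hb0]
  linarith

/-- The sign is constant on (0, 2] and on [5/2, ∞), and strict monotonicity in between allows a
single zero. `signFun` depends on μ only, which is why one threshold serves all γ and λ. -/
lemma exists_threshold : ∃ μs ∈ Ioo (2 : ℝ) (5 / 2), ∀ μ, 0 < μ →
    (μ < μs → 0 < signFun μ) ∧ (μ = μs → signFun μ = 0) ∧ (μs < μ → signFun μ < 0) := by
  have hc : ContinuousOn signFun (Icc 2 (5 / 2)) := by
    have h1 : ContinuousOn bifRatio (Icc 2 (5 / 2)) :=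
      continuousOn_bifRatio.mono fun x hx => by
        have := hx.1
        exact mem_Ici.2 (by linarith)
    have hne : ∀ x ∈ Icc (2 : ℝ) (5 / 2), x ≠ 0 := fun x hx => by linarith [hx.1]
    have h2 : ContinuousOn (fun x : ℝ => 1 / x ^ 2 - 1 / 4) (Icc 2 (5 / 2)) :=
      (continuousOn_const.div (by fun_prop) fun x hx => pow_ne_zero 2 (hne x hx)).sub
        continuousOn_const
    have h3 : ContinuousOn (fun x : ℝ => 1 / x - (8 * x + 7) / (4 * (4 * x + 5)))
        (Icc 2 (5 / 2)) :=
      (continuousOn_const.div (by fun_prop) hne).sub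
        (ContinuousOn.div (by fun_prop) (by fun_prop) fun x hx => by linarith [hx.1])
    exact (h2.mul h1).add h3
  obtain ⟨μs, hμs, h0⟩ := intermediate_value_Icc' (by norm_num : (2 : ℝ) ≤ 5 / 2) hc
    ⟨(signFun_neg_of_ge le_rfl).le, (signFun_pos_of_le two_pos le_rfl).le⟩
  have hne2 : μs ≠ 2 := fun h => by
    have := signFun_pos_of_le two_pos le_rfl
    rw [← h, h0] at this
    exact lt_irrefl _ this
  have hne5 : μs ≠ 5 / 2 := fun h => by
    have := signFun_neg_of_ge (le_refl (5 / 2 : ℝ))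
    rw [← h, h0] at this
    exact lt_irrefl _ this
  refine ⟨μs, ⟨lt_of_le_of_ne hμs.1 hne2.symm, lt_of_le_of_ne hμs.2 hne5⟩, fun μ hμ => ?_⟩
  refine ⟨fun h => ?_, fun h => h ▸ h0, fun h => ?_⟩
  · rcases le_or_gt μ 2 with h2 | h2
    · exact signFun_pos_of_le hμ h2
    · rw [← h0]
      exact strictAntiOn_signFun ⟨h2.le, h.le.trans hμs.2⟩ hμs h
  · rcases le_or_gt (5 / 2) μ with h2 | h2
    · exact signFun_neg_of_ge h2
    · rw [← h0]
      exact strictAntiOn_signFun hμs ⟨hμs.1.trans h.le, h2.le⟩ h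

/-! ### Derivatives of `d` -/

noncomputable def actionConst (lam μ : ℝ) : ℝ := ((μ + 1) / lam) ^ (1 / μ)

lemma actionConst_pos {lam μ : ℝ} (hlam : 0 < lam) (hμ : 0 < μ) : 0 < actionConst lam μ := by
  unfold actionConst; positivity

lemma two_lt_of_freqLinear_lt {γ ω : ℝ} (hγ : 0 < γ) (hω : freqLinear γ < ω) : 2 < γ * √ω := by
  have h : 2 / γ < √ω := by
    refine Real.lt_sqrt_of_sq_lt ?_
    rw [div_pow]
    unfold freqLinear at hω
    norm_num at hω ⊢
    exact hω
  rwa [div_lt_iff₀ hγ, mul_comm] at h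

lemma freqLinear_pos {γ : ℝ} (hγ : 0 < γ) : 0 < freqLinear γ := by
  unfold freqLinear; positivity

lemma mul_sqrt_freqBif {γ μ : ℝ} (hγ : 0 < γ) : γ * √(freqBif γ μ) = bifParam μ := by
  have e : freqBif γ μ = (2 / γ) ^ 2 * ((μ + 1) / μ) := by
    rw [freqBif, div_pow]; norm_num
  rw [e, Real.sqrt_mul (sq_nonneg _), Real.sqrt_sq (by positivity), bifParam]
  field_simp

lemma freqLinear_lt_freqBif {γ μ : ℝ} (hγ : 0 < γ) (hμ : 0 < μ) : freqLinear γ < freqBif γ μ := by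
  unfold freqLinear freqBif
  refine lt_mul_of_one_lt_right (by positivity) ?_
  rw [one_lt_div hμ]; linarith

lemma mul_sqrt_lt {γ ω₁ ω₂ : ℝ} (hγ : 0 < γ) (h1 : 0 ≤ ω₁) (h : ω₁ < ω₂) :
    γ * √ω₁ < γ * √ω₂ := mul_lt_mul_of_pos_left (Real.sqrt_lt_sqrt h1 h) hγ

lemma groundAction_eq_minimaxValue {γ lam μ ω : ℝ} (hγ : 0 < γ) (hlam : 0 < lam) (hμ : 0 < μ)
    (hω : freqLinear γ < ω) : groundAction γ lam μ ω =
      actionConst lam μ * ω ^ (1 / 2 + 1 / μ) * minimaxValue μ (γ * √ω) := by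
  have hω0 : 0 < ω := (freqLinear_pos hγ).trans hω
  have hk := two_lt_of_freqLinear_lt hγ hω
  rw [groundAction_eq hγ hlam hμ hω0 (isCritical_crit hμ hk) (isRayMinimax_crit hμ hk),
    minimaxValue]
  congr 1
  rw [amplitude, ← Real.rpow_natCast, ← Real.rpow_mul (by positivity),
    show 1 / (2 * μ) * ((2 : ℕ) : ℝ) = 1 / μ by push_cast; field_simp,
    show (μ + 1) * ω / lam = (μ + 1) / lam * ω by ring, Real.mul_rpow (by positivity) hω0.le,
    Real.rpow_add hω0, ← Real.sqrt_eq_rpow, actionConst]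
  ring

/-- The first derivative of `d`. -/
noncomputable def groundActionDeriv (γ lam μ ω : ℝ) : ℝ :=
  actionConst lam μ * (ω ^ (1 / μ - 1 / 2) * ((1 / 2 + 1 / μ) * minimaxValue μ (γ * √ω) +
    jumpSq μ (γ * √ω) / (4 * (γ * √ω))))

lemma hasDerivAt_mul_sqrt {γ ω : ℝ} (hω : 0 < ω) :
    HasDerivAt (fun ω => γ * √ω) (γ * √ω / (2 * ω)) ω := by
  refine ((Real.hasDerivAt_sqrt hω.ne').const_mul γ).congr_deriv ?_
  have h := Real.sq_sqrt hω.le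
  have := Real.sqrt_pos.2 hω
  field_simp
  linear_combination (-γ) * h

lemma hasDerivAt_groundAction {γ lam μ ω : ℝ} (hγ : 0 < γ) (hlam : 0 < lam) (hμ : 0 < μ)
    (hω : freqLinear γ < ω) :
    HasDerivAt (groundAction γ lam μ) (groundActionDeriv γ lam μ ω) ω := by
  have hω0 : 0 < ω := (freqLinear_pos hγ).trans hω
  have hk := two_lt_of_freqLinear_lt hγ hω
  have h1 : HasDerivAt (fun ω => minimaxValue μ (γ * √ω))
      (jumpSq μ (γ * √ω) / (2 * (γ * √ω) ^ 2) * (γ * √ω / (2 * ω))) ω :=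
    HasDerivAt.comp (h₂ := minimaxValue μ) ω (hasDerivAt_minimaxValue hμ hk)
      (hasDerivAt_mul_sqrt hω0)
  have h2 := (Real.hasDerivAt_rpow_const (p := 1 / 2 + 1 / μ) (Or.inl hω0.ne')).const_mul
    (actionConst lam μ)
  refine ((h2.mul h1).congr_deriv ?_).congr_of_eventuallyEq ?_
  · rw [groundActionDeriv, show (1 : ℝ) / 2 + 1 / μ - 1 = 1 / μ - 1 / 2 by ring,
      show (1 : ℝ) / 2 + 1 / μ = 1 / μ - 1 / 2 + 1 by ring, Real.rpow_add_one hω0.ne']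
    have hs := Real.sqrt_pos.2 hω0
    field_simp
    ring
  · filter_upwards [Ioi_mem_nhds hω] with y hy
    exact groundAction_eq_minimaxValue hγ hlam hμ hy

/-- The second derivative of `d` away from the bifurcation. -/
noncomputable def groundActionDeriv₂ (γ lam μ ω : ℝ) : ℝ :=
  actionConst lam μ * ω ^ (1 / μ - 3 / 2) * curvature μ (γ * √ω)

/-- Every derivative of k = γ√ω contributes a factor k/(2ω), so a common power of ω splits off; the
coefficient 1/μ² - 1/4 in `curvature` is the product (1/μ + 1/2)(1/μ - 1/2). -/
lemma hasDerivAt_groundActionDeriv {γ lam μ ω : ℝ} (hγ : 0 < γ) (hμ : 0 < μ)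
    (hω : freqLinear γ < ω) (hne : γ * √ω ≠ bifParam μ) :
    HasDerivAt (groundActionDeriv γ lam μ) (groundActionDeriv₂ γ lam μ ω) ω := by
  have hω0 : 0 < ω := (freqLinear_pos hγ).trans hω
  have hk := two_lt_of_freqLinear_lt hγ hω
  have hk0 : 0 < γ * √ω := by linarith
  have hks := hasDerivAt_mul_sqrt (γ := γ) hω0
  have h1 : HasDerivAt (fun ω => minimaxValue μ (γ * √ω))
      (jumpSq μ (γ * √ω) / (2 * (γ * √ω) ^ 2) * (γ * √ω / (2 * ω))) ω :=
    HasDerivAt.comp (h₂ := minimaxValue μ) ω (hasDerivAt_minimaxValue hμ hk) hks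
  have h2 : HasDerivAt (fun ω => jumpSq μ (γ * √ω))
      (jumpSq μ (γ * √ω) * jumpSqRate μ (γ * √ω) / (γ * √ω) * (γ * √ω / (2 * ω))) ω :=
    HasDerivAt.comp (h₂ := jumpSq μ) ω (hasDerivAt_jumpSq hμ hk hne) hks
  have h3 := Real.hasDerivAt_rpow_const (p := 1 / μ - 1 / 2) (Or.inl hω0.ne')
  have h4 := (h1.const_mul (1 / 2 + 1 / μ)).add (h2.div (hks.const_mul 4) (by positivity))
  refine ((h3.mul h4).const_mul (actionConst lam μ)).congr_deriv ?_
  simp only [Pi.add_apply, Pi.div_apply]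
  rw [groundActionDeriv₂, curvature, show (1 : ℝ) / μ - 1 / 2 - 1 = 1 / μ - 3 / 2 by ring,
    show (1 : ℝ) / μ - 1 / 2 = 1 / μ - 3 / 2 + 1 by ring, Real.rpow_add_one hω0.ne']
  set k := γ * √ω
  field_simp
  ring

lemma continuousAt_groundActionDeriv_bif {γ lam μ : ℝ} (hγ : 0 < γ) (hμ : 0 < μ) :
    ContinuousAt (groundActionDeriv γ lam μ) (freqBif γ μ) := by
  have hω0 : 0 < freqBif γ μ := (freqLinear_pos hγ).trans (freqLinear_lt_freqBif hγ hμ)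
  have hb := two_lt_bifParam hμ
  have hks := (hasDerivAt_mul_sqrt (γ := γ) hω0).continuousAt
  have hD : ContinuousAt (fun ω => minimaxValue μ (γ * √ω)) (freqBif γ μ) :=
    ContinuousAt.comp (g := minimaxValue μ)
      (by rw [mul_sqrt_freqBif hγ]; exact continuousAt_minimaxValue_bifParam hμ) hks
  have hP : ContinuousAt (fun ω => jumpSq μ (γ * √ω)) (freqBif γ μ) :=
    ContinuousAt.comp (g := jumpSq μ)
      (by rw [mul_sqrt_freqBif hγ]; exact continuousAt_jumpSq_bifParam hμ) hks
  refine continuousAt_const.mul (ContinuousAt.mul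
    (Real.continuousAt_rpow_const _ _ (Or.inl hω0.ne')) ((continuousAt_const.mul hD).add
    (hP.div (continuousAt_const.mul hks) ?_)))
  rw [mul_sqrt_freqBif hγ]
  positivity

lemma deriv_groundAction_eventuallyEq {γ lam μ ω : ℝ} (hγ : 0 < γ) (hlam : 0 < lam) (hμ : 0 < μ)
    (hω : freqLinear γ < ω) :
    deriv (groundAction γ lam μ) =ᶠ[𝓝 ω] groundActionDeriv γ lam μ := by
  filter_upwards [Ioi_mem_nhds hω] with y hy
  exact (hasDerivAt_groundAction hγ hlam hμ hy).deriv

lemma mul_sqrt_lt_bifParam {γ μ ω : ℝ} (hγ : 0 < γ) (hω : 0 ≤ ω) (h : ω < freqBif γ μ) :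
    γ * √ω < bifParam μ := by
  rw [← mul_sqrt_freqBif hγ]; exact mul_sqrt_lt hγ hω h

lemma bifParam_lt_mul_sqrt {γ μ ω : ℝ} (hγ : 0 < γ) (hμ : 0 < μ) (h : freqBif γ μ < ω) :
    bifParam μ < γ * √ω := by
  rw [← mul_sqrt_freqBif hγ]
  exact mul_sqrt_lt hγ ((freqLinear_pos hγ).trans (freqLinear_lt_freqBif hγ hμ)).le h

lemma mul_sqrt_ne_bifParam {γ μ ω : ℝ} (hγ : 0 < γ) (hμ : 0 < μ) (hω : 0 ≤ ω)
    (h : ω ≠ freqBif γ μ) : γ * √ω ≠ bifParam μ := by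
  rcases lt_or_gt_of_ne h with h | h
  · exact (mul_sqrt_lt_bifParam hγ hω h).ne
  · exact (bifParam_lt_mul_sqrt hγ hμ h).ne'

lemma hasDerivAt_deriv_groundAction {γ lam μ ω : ℝ} (hγ : 0 < γ) (hlam : 0 < lam) (hμ : 0 < μ)
    (hω : freqLinear γ < ω) (hne : ω ≠ freqBif γ μ) :
    HasDerivAt (deriv (groundAction γ lam μ)) (groundActionDeriv₂ γ lam μ ω) ω :=
  (hasDerivAt_groundActionDeriv hγ hμ hω
    (mul_sqrt_ne_bifParam hγ hμ ((freqLinear_pos hγ).trans hω).le hne)).congr_of_eventuallyEq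
    (deriv_groundAction_eventuallyEq hγ hlam hμ hω)

lemma deriv_deriv_groundAction {γ lam μ ω : ℝ} (hγ : 0 < γ) (hlam : 0 < lam) (hμ : 0 < μ)
    (hω : freqLinear γ < ω) (hne : ω ≠ freqBif γ μ) :
    deriv (deriv (groundAction γ lam μ)) ω =
      actionConst lam μ * ω ^ (1 / μ - 3 / 2) * curvature μ (γ * √ω) :=
  (hasDerivAt_deriv_groundAction hγ hlam hμ hω hne).deriv

/-- The positive factor relating `d''` to `curvature` at the bifurcation. -/
noncomputable def bifFactor (γ lam μ : ℝ) : ℝ :=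
  actionConst lam μ * freqBif γ μ ^ (1 / μ - 3 / 2)

lemma bifFactor_pos {γ lam μ : ℝ} (hγ : 0 < γ) (hlam : 0 < lam) (hμ : 0 < μ) :
    0 < bifFactor γ lam μ :=
  mul_pos (actionConst_pos hlam hμ)
    (Real.rpow_pos_of_pos ((freqLinear_pos hγ).trans (freqLinear_lt_freqBif hγ hμ)) _)

/-- The filter l is left general so that both sides of ω* are covered at once; the side enters only
through the limit R of the rate. -/
lemma tendsto_deriv_deriv_groundAction {γ lam μ R : ℝ} (hγ : 0 < γ) (hlam : 0 < lam) (hμ : 0 < μ)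
    {l : Filter ℝ} (hl : l ≤ 𝓝[≠] (freqBif γ μ))
    (hR : Tendsto (jumpSqRate μ) (l.map fun ω => γ * √ω) (𝓝 R)) :
    Tendsto (deriv (deriv (groundAction γ lam μ))) l
      (𝓝 (bifFactor γ lam μ * bifCurvature μ R)) := by
  have hω0 := (freqLinear_pos hγ).trans (freqLinear_lt_freqBif hγ hμ)
  have hl' : l ≤ 𝓝 (freqBif γ μ) := hl.trans nhdsWithin_le_nhds
  have hk : Tendsto (fun ω => γ * √ω) l (𝓝 (bifParam μ)) := by
    rw [← mul_sqrt_freqBif hγ]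
    exact (hasDerivAt_mul_sqrt hω0).continuousAt.tendsto.mono_left hl'
  have h1 : Tendsto (fun ω => curvature μ (γ * √ω)) l (𝓝 (bifCurvature μ R)) :=
    tendsto_map'_iff.1 (tendsto_curvature hμ hk hR)
  have h2 : Tendsto (fun ω : ℝ => ω ^ (1 / μ - 3 / 2)) l
      (𝓝 (freqBif γ μ ^ (1 / μ - 3 / 2))) :=
    (Real.continuousAt_rpow_const _ _ (Or.inl hω0.ne')).tendsto.mono_left hl'
  refine ((h2.const_mul (actionConst lam μ)).mul h1).congr' ?_
  filter_upwards [hl self_mem_nhdsWithin, hl' (Ioi_mem_nhds (freqLinear_lt_freqBif hγ hμ))]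
    with ω hne hω
  exact (deriv_deriv_groundAction hγ hlam hμ hω hne).symm

lemma continuousAt_deriv_groundAction {γ lam μ : ℝ} (hγ : 0 < γ) (hlam : 0 < lam) (hμ : 0 < μ) :
    ContinuousAt (deriv (groundAction γ lam μ)) (freqBif γ μ) :=
  (continuousAt_groundActionDeriv_bif hγ hμ).congr
    (deriv_groundAction_eventuallyEq hγ hlam hμ (freqLinear_lt_freqBif hγ hμ)).symm

/-- The one-sided derivative of d' comes from the limit of d'' together with the continuity of d' at
ω*. -/
lemma isRightSecondDeriv_groundAction {γ lam μ : ℝ} (hγ : 0 < γ) (hlam : 0 < lam) (hμ : 0 < μ) :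
    IsRightSecondDeriv (groundAction γ lam μ) (freqBif γ μ)
      (bifFactor γ lam μ * bifCurvature μ (-2 * ((2 * μ + 1) / (4 * μ + 5)))) := by
  have hlt := freqLinear_lt_freqBif hγ hμ
  have hω0 := (freqLinear_pos hγ).trans hlt
  have h : Tendsto (deriv (deriv (groundAction γ lam μ))) (𝓝[>] (freqBif γ μ))
      (𝓝 (bifFactor γ lam μ * bifCurvature μ (-2 * ((2 * μ + 1) / (4 * μ + 5))))) := by
    refine tendsto_deriv_deriv_groundAction hγ hlam hμ
      (nhdsWithin_mono _ fun x hx => ne_of_gt hx) ?_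
    refine (tendsto_jumpSqRate_right hμ).mono_left (tendsto_nhdsWithin_iff.2 ⟨?_, ?_⟩)
    · rw [← mul_sqrt_freqBif hγ]
      exact (hasDerivAt_mul_sqrt hω0).continuousAt.tendsto.mono_left nhdsWithin_le_nhds
    · filter_upwards [self_mem_nhdsWithin] with ω hω using bifParam_lt_mul_sqrt hγ hμ hω
  refine ⟨h, (hasDerivWithinAt_Ici_of_tendsto_deriv (s := Ioi (freqBif γ μ)) (fun ω hω => ?_)
    (continuousAt_deriv_groundAction hγ hlam hμ).continuousWithinAt self_mem_nhdsWithin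
    h).mono Ioi_subset_Ici_self⟩
  exact (hasDerivAt_deriv_groundAction hγ hlam hμ (hlt.trans hω)
    (ne_of_gt hω)).differentiableAt.differentiableWithinAt

lemma isLeftSecondDeriv_groundAction {γ lam μ : ℝ} (hγ : 0 < γ) (hlam : 0 < lam) (hμ : 0 < μ) :
    IsLeftSecondDeriv (groundAction γ lam μ) (freqBif γ μ)
      (bifFactor γ lam μ * bifCurvature μ 2) := by
  have hlt := freqLinear_lt_freqBif hγ hμ
  have hω0 := (freqLinear_pos hγ).trans hlt
  have h : Tendsto (deriv (deriv (groundAction γ lam μ))) (𝓝[<] (freqBif γ μ))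
      (𝓝 (bifFactor γ lam μ * bifCurvature μ 2)) := by
    refine tendsto_deriv_deriv_groundAction hγ hlam hμ
      (nhdsWithin_mono _ fun x hx => ne_of_lt hx) ?_
    refine (tendsto_jumpSqRate_left hμ).mono_left (tendsto_nhdsWithin_iff.2 ⟨?_, ?_⟩)
    · rw [← mul_sqrt_freqBif hγ]
      exact (hasDerivAt_mul_sqrt hω0).continuousAt.tendsto.mono_left nhdsWithin_le_nhds
    · filter_upwards [Ioo_mem_nhdsLT hω0] with ω hω
      exact mul_sqrt_lt_bifParam hγ hω.1.le hω.2
  refine ⟨h, (hasDerivWithinAt_Iic_of_tendsto_deriv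
    (s := Ioo (freqLinear γ) (freqBif γ μ)) (fun ω hω => ?_)
    (continuousAt_deriv_groundAction hγ hlam hμ).continuousWithinAt (Ioo_mem_nhdsLT hlt)
    h).mono Iio_subset_Iic_self⟩
  exact (hasDerivAt_deriv_groundAction hγ hlam hμ hω.1
    (ne_of_lt hω.2)).differentiableAt.differentiableWithinAt

lemma deriv_deriv_pos_of_curvature_pos {γ lam μ ω : ℝ} (hγ : 0 < γ) (hlam : 0 < lam) (hμ : 0 < μ)
    (hω : freqLinear γ < ω) (hne : ω ≠ freqBif γ μ) (h : 0 < curvature μ (γ * √ω)) :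
    0 < deriv (deriv (groundAction γ lam μ)) ω := by
  rw [deriv_deriv_groundAction hγ hlam hμ hω hne]
  exact mul_pos (mul_pos (actionConst_pos hlam hμ)
    (Real.rpow_pos_of_pos ((freqLinear_pos hγ).trans hω) _)) h

lemma deriv_deriv_pos_of_lt {γ lam μ ω : ℝ} (hγ : 0 < γ) (hlam : 0 < lam) (hμ : 0 < μ)
    (hω : freqLinear γ < ω) (hlt : ω < freqBif γ μ) :
    0 < deriv (deriv (groundAction γ lam μ)) ω :=
  deriv_deriv_pos_of_curvature_pos hγ hlam hμ hω hlt.ne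
    (curvature_pos_of_lt hμ (two_lt_of_freqLinear_lt hγ hω)
      (mul_sqrt_lt_bifParam hγ ((freqLinear_pos hγ).trans hω).le hlt))

lemma bifCurvature_left_pos {μ : ℝ} (hμ : 0 < μ) : 0 < bifCurvature μ 2 :=
  symmetric_curvature_pos hμ (two_lt_bifParam hμ) le_rfl le_rfl

/-- The two sides share D and P; only the rate differs, being negative on the right and 2 on the
left. -/
lemma bifCurvature_right_lt_left {μ : ℝ} (hμ : 0 < μ) :
    bifCurvature μ (-2 * ((2 * μ + 1) / (4 * μ + 5))) < bifCurvature μ 2 := by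
  have hb := two_lt_bifParam hμ
  have hP := jumpSq_pos hμ hb
  have h0 : 0 < (2 * μ + 1) / (4 * μ + 5) := by positivity
  unfold bifCurvature
  exact add_lt_add_right (mul_lt_mul_of_pos_left (by linarith) (by positivity)) _

end DeltaPrimeNLS

/-! ### Assembly of the proposition -/

open DeltaPrimeNLS

theorem proposition6p5 :
    ∃ μs ∈ Set.Ioo (2 : ℝ) (5 / 2), ∀ γ lam μ : ℝ, 0 < γ → 0 < lam → 0 < μ →
      (∀ ω, DeltaPrimeNLS.freqLinear γ < ω →
        DifferentiableAt ℝ (DeltaPrimeNLS.groundAction γ lam μ) ω) ∧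
      (∀ ω, DeltaPrimeNLS.freqLinear γ < ω → ω ≠ DeltaPrimeNLS.freqBif γ μ →
        DifferentiableAt ℝ (deriv (DeltaPrimeNLS.groundAction γ lam μ)) ω) ∧
      ∃ dLeft dRight : ℝ,
        DeltaPrimeNLS.IsLeftSecondDeriv (DeltaPrimeNLS.groundAction γ lam μ)
          (DeltaPrimeNLS.freqBif γ μ) dLeft ∧
        DeltaPrimeNLS.IsRightSecondDeriv (DeltaPrimeNLS.groundAction γ lam μ)
          (DeltaPrimeNLS.freqBif γ μ) dRight ∧
        (μ ≤ 2 →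
          (∀ ω, DeltaPrimeNLS.freqLinear γ < ω → ω ≠ DeltaPrimeNLS.freqBif γ μ →
            0 < deriv (deriv (DeltaPrimeNLS.groundAction γ lam μ)) ω) ∧
          0 < dRight ∧ dRight < dLeft) ∧
        (2 < μ →
          (∀ ω ∈ Set.Ioo (DeltaPrimeNLS.freqLinear γ) (DeltaPrimeNLS.freqBif γ μ),
            0 < deriv (deriv (DeltaPrimeNLS.groundAction γ lam μ)) ω) ∧
          0 < dLeft) ∧
        (μ < μs →
          0 < dRight ∧
          ∃ ω₁, DeltaPrimeNLS.freqBif γ μ < ω₁ ∧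
            ∀ ω ∈ Set.Ioo (DeltaPrimeNLS.freqBif γ μ) ω₁,
              0 < deriv (deriv (DeltaPrimeNLS.groundAction γ lam μ)) ω) ∧
        (μ = μs → dRight = 0) ∧
        (μs < μ → dRight < 0) ∧
        (2 < μ →
          ∃ ω₂, DeltaPrimeNLS.freqBif γ μ ≤ ω₂ ∧
            ∀ ω, ω₂ < ω →
              deriv (deriv (DeltaPrimeNLS.groundAction γ lam μ)) ω < 0) := by
  obtain ⟨μs, hμs, hsign⟩ := exists_threshold
  refine ⟨μs, hμs, fun γ lam μ hγ hlam hμ => ?_⟩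
  have hblt := freqLinear_lt_freqBif hγ hμ
  have hF := bifFactor_pos hγ hlam hμ
  have hq : 0 < jumpSq μ (bifParam μ) / (2 * bifParam μ) := by
    have hb := two_lt_bifParam hμ
    have := jumpSq_pos hμ hb
    positivity
  have hR := isRightSecondDeriv_groundAction hγ hlam hμ
  have hL := isLeftSecondDeriv_groundAction hγ hlam hμ
  obtain ⟨hs1, hs2, hs3⟩ := hsign μ hμ
  have hdR : ∀ {s : Prop}, (s → 0 < signFun μ) → s → 0 < bifFactor γ lam μ *
      bifCurvature μ (-2 * ((2 * μ + 1) / (4 * μ + 5))) := fun h hs => by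
    rw [bifCurvature_right hμ]; exact mul_pos hF (mul_pos hq (h hs))
  refine ⟨fun ω hω => (hasDerivAt_groundAction hγ hlam hμ hω).differentiableAt,
    fun ω hω hne => (hasDerivAt_deriv_groundAction hγ hlam hμ hω hne).differentiableAt,
    _, _, hL, hR, fun hμ2 => ⟨fun ω hω hne => ?_, ?_, ?_⟩, fun _ => ⟨fun ω hω => ?_, ?_⟩,
    fun h => ⟨hdR hs1 h, ?_⟩, fun h => ?_, fun h => ?_, fun h => ?_⟩
  · rcases lt_or_gt_of_ne hne with h | h
    · exact deriv_deriv_pos_of_lt hγ hlam hμ hω h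
    · exact deriv_deriv_pos_of_curvature_pos hγ hlam hμ hω hne
        (curvature_pos_of_gt hμ hμ2 (bifParam_lt_mul_sqrt hγ hμ h))
  · exact hdR (signFun_pos_of_le hμ) hμ2
  · exact mul_lt_mul_of_pos_left (bifCurvature_right_lt_left hμ) hF
  · exact deriv_deriv_pos_of_lt hγ hlam hμ hω.1 hω.2
  · exact mul_pos hF (bifCurvature_left_pos hμ)
  -- The right limit of d'' is positive, so d'' is positive on some interval to the right of ω*; its
  -- endpoint is ω₁.
  · obtain ⟨u, hu, hsub⟩ := mem_nhdsGT_iff_exists_Ioo_subset.1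
      (hR.1.eventually (lt_mem_nhds (hdR hs1 h)))
    exact ⟨u, hu, fun ω hω => hsub hω⟩
  · rw [bifCurvature_right hμ, hs2 h]; ring
  · rw [bifCurvature_right hμ]
    exact mul_neg_of_pos_of_neg hF (mul_neg_of_pos_of_neg hq (hs3 h))
  · obtain ⟨k₁, hk₁, hneg⟩ := curvature_neg_of_large h
    have hk₁0 : 0 < k₁ := by linarith [two_lt_bifParam hμ]
    -- (k₁/γ)² is the frequency at which γ√ω reaches k₁.
    refine ⟨max (freqBif γ μ) ((k₁ / γ) ^ 2), le_max_left _ _, fun ω hω => ?_⟩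
    have h1 : freqBif γ μ < ω := (le_max_left _ _).trans_lt hω
    have h2 : k₁ < γ * √ω := by
      have := Real.lt_sqrt_of_sq_lt ((le_max_right _ _).trans_lt hω)
      rwa [div_lt_iff₀ hγ, mul_comm] at this
    rw [deriv_deriv_groundAction hγ hlam hμ (hblt.trans h1) h1.ne']
    exact mul_neg_of_pos_of_neg (mul_pos (actionConst_pos hlam hμ)
      (Real.rpow_pos_of_pos (((freqLinear_pos hγ).trans hblt).trans h1) _)) (hneg _ h2)
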